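/- Let $n,d\ge 1$ be integers, let $p\in(1,n)$, put $p^*=\frac{np}{n-p}$, and let $\Omega\subset\mathbb R^n$ be a bounded open set. Let $A$ be a continuous map from $\overline\Omega$ to the real symmetric $n\times n$ matrices for which there is $\tau>0$ with $\tau|\xi|^2\le\langle A(x)\xi,\xi\rangle$ for all $(x,\xi)\in\overline\Omega\times\mathbb R^n$, and set $$L_{A,p}u=\operatorname{div}\!\left(\langle A(x)\nabla u,\nabla u\rangle^{\frac{p-2}{2}}A(x)\nabla u\right).$$ Let $\lambda_1(A,p)$ be the first eigenvalue of $-L_{A,p}$ on $\Omega$, that is, the smallest $\lambda\in\mathbb R$ for which $-L_{A,p}u=\lambda|u|^{p-2}u$ has a weak solution $u\in W_0^{1,p}(\Omega)\setminus\{0\}$. Let $G\in C^1(\mathbb R^d)$ satisfy $G(\varrho s)=\varrho^{p^*}G(s)$ for all $\varrho>0$, $s\in\mathbb R^d$, and $G(s)>0$ for all $s\ne 0$. Suppose that there are a point $x_0\in\Omega$ at which $\det A$ attains its minimum over $\overline\Omega$ and constants $C_0>0$ and $\gamma\in(0,p]$ such that $$\langle A(x)\xi,\xi\rangle^{p/2}\ge\langle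 A(x_0)\xi,\xi\rangle^{p/2}+C_0|x-x_0|^\gamma|\xi|^p\qquad\text{for all }(x,\xi)\in\Omega\times\mathbb R^n.$$ Then there is $\lambda^*\in(0,\lambda_1(A,p))$ with the following property. Let $F\in C^1(\mathbb R^d)$ be any function with $F(\varrho s)=\varrho^pF(s)$ for all $\varrho>0$, $s\in\mathbb R^d$, and let $M_F$ and $\mu_F$ be the maximum and the minimum of $F$ over $\mathbb S_p^{d-1}=\{s\in\mathbb R^d:|s_1|^p+\dots+|s_d|^p=1\}$. If $M_F\in(0,\lambda_1(A,p))$ and $\mu_F>\lambda^*$, then the system $$-L_{A,p}\mathbf u=\tfrac1p\nabla F(\mathbf u)+\tfrac1{p^*}\nabla G(\mathbf u)\ \text{ in }\Omega,\qquad \mathbf u=0\ \text{ on }\partial\Omega,$$ in which $L_{A,p}$ acts on $\mathbf u=(u_1,\dots,u_d)$ componentwise, has a nontrivial weak solution $\mathbf u$. Here a weak solution is a function $\mathbf u=(u_1,\dots,u_d)$ with all $u_j\in W_0^{1,p}(\Omega)$ such that, for every $j$ and every $\varphi\in W_0^{1,p}(\Omega)$, $$\int_\Omega\langle A\nabla u_j,\nabla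 u_j\rangle^{\frac{p-2}{2}}\langle A\nabla u_j,\nabla\varphi\rangle\,dx=\int_\Omega\Big(\tfrac1p\,\partial_jF(\mathbf u)+\tfrac1{p^*}\,\partial_jG(\mathbf u)\Big)\varphi\,dx,$$ and weak solutions of the eigenvalue equation are understood in the same way. -/

import Mathlib

open MeasureTheory Filter Topology
open scoped ContDiff Matrix ENNReal

namespace AnisoPLap

/-- `ℝⁿ` with its Euclidean norm. -/
abbrev Eucl (n : ℕ) : Type := EuclideanSpace ℝ (Fin n)

noncomputable section

/-- The bilinear form `⟨M ξ, ζ⟩` of a real `n × n` matrix `M`. -/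
def matForm {n : ℕ} (M : Matrix (Fin n) (Fin n) ℝ) (ξ ζ : Eucl n) : ℝ :=
  (M *ᵥ ξ.ofLp) ⬝ᵥ ζ.ofLp

/-- The assumptions on the coefficient matrix: `A` is continuous on the closure of `Ω`, symmetric
there, and uniformly positive definite there. -/
structure IsCoefficient {n : ℕ} (Ω : Set (Eucl n)) (A : Eucl n → Matrix (Fin n) (Fin n) ℝ) :
    Prop where
  continuousOn : ContinuousOn A (closure Ω)
  symm : ∀ x ∈ closure Ω, (A x)ᵀ = A x
  elliptic : ∃ τ : ℝ, 0 < τ ∧ ∀ x ∈ closure Ω, ∀ ξ : Eucl n, τ * ‖ξ‖ ^ 2 ≤ matForm (A x) ξ ξ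

/-- `H` is homogeneous of degree `q`: `H (ρ s) = ρ ^ q H s` for all `ρ > 0` and all `s`. -/
def IsHomogeneous {d : ℕ} (q : ℝ) (H : Eucl d → ℝ) : Prop :=
  ∀ ρ : ℝ, 0 < ρ → ∀ s : Eucl d, H (ρ • s) = ρ ^ q * H s

/-- `H` is positively homogeneous of degree `q`: homogeneous of degree `q`, and positive away from
the origin. -/
def IsPosHomogeneous {d : ℕ} (q : ℝ) (H : Eucl d → ℝ) : Prop :=
  IsHomogeneous q H ∧ ∀ s : Eucl d, s ≠ 0 → 0 < H s

/-- The critical Sobolev exponent `p* = n p / (n - p)`. -/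
def critExp (n : ℕ) (p : ℝ) : ℝ := n * p / (n - p)

/-- The unit sphere `{s : |s₁|^p + ⋯ + |s_d|^p = 1}` of the `p`-norm. -/
def pSphere (d : ℕ) (p : ℝ) : Set (Eucl d) := {s | ∑ j, |s j| ^ p = 1}

/-- `M_F`, the maximum of `F` over the unit sphere of the `p`-norm (for `d ≥ 1` the sphere is
compact and nonempty, so for continuous `F` the supremum is a maximum). -/
def sphereMax {d : ℕ} (p : ℝ) (F : Eucl d → ℝ) : ℝ := sSup (F '' pSphere d p)

/-- `μ_F`, the minimum of `F` over the unit sphere of the `p`-norm. -/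
def sphereMin {d : ℕ} (p : ℝ) (F : Eucl d → ℝ) : ℝ := sInf (F '' pSphere d p)

/-- `φ ∈ C_c^∞(Ω)`. -/
def IsTestFunction {n : ℕ} (Ω : Set (Eucl n)) (φ : Eucl n → ℝ) : Prop :=
  ContDiff ℝ ∞ φ ∧ HasCompactSupport φ ∧ tsupport φ ⊆ Ω

/-- The vector field `v` is the weak gradient of `u` on `Ω`. -/
def IsWeakGradient {n : ℕ} (Ω : Set (Eucl n)) (u : Eucl n → ℝ) (v : Eucl n → Eucl n) : Prop :=
  ∀ φ : Eucl n → ℝ, IsTestFunction Ω φ → ∀ i : Fin n,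
    ∫ x in Ω, u x * gradient φ x i = - ∫ x in Ω, v x i * φ x

/-- `u ∈ W₀^{1,p}(Ω)` with weak gradient `v`: the function `u` lies in `W^{1,p}(Ω)`, has weak
gradient `v`, and is a limit in `W^{1,p}(Ω)` of functions from `C_c^∞(Ω)`. Only the values of `u`
and `v` almost everywhere on `Ω` matter. -/
structure IsW0 {n : ℕ} (Ω : Set (Eucl n)) (p : ℝ) (u : Eucl n → ℝ) (v : Eucl n → Eucl n) :
    Prop where
  memLp : MemLp u (ENNReal.ofReal p) (volume.restrict Ω)
  memLp_grad : MemLp v (ENNReal.ofReal p) (volume.restrict Ω)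
  weakGradient : IsWeakGradient Ω u v
  approx : ∃ φ : ℕ → Eucl n → ℝ, (∀ k, IsTestFunction Ω (φ k)) ∧
    Tendsto (fun k => eLpNorm (fun x => φ k x - u x) (ENNReal.ofReal p) (volume.restrict Ω))
      atTop (𝓝 0) ∧
    Tendsto
      (fun k => eLpNorm (fun x => gradient (φ k) x - v x) (ENNReal.ofReal p) (volume.restrict Ω))
      atTop (𝓝 0)

/-- The dual pairing of `-L_{A,p} u` with `φ`, that is
`∫_Ω ⟨A ∇u, ∇u⟩^((p-2)/2) ⟨A ∇u, ∇φ⟩ dx`, written in terms of the weak gradients `v = ∇u` and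
`ψ = ∇φ`. Where `v x = 0` the integrand is `0`, also for `p < 2`. -/
def opPairing {n : ℕ} (Ω : Set (Eucl n)) (p : ℝ) (A : Eucl n → Matrix (Fin n) (Fin n) ℝ)
    (v ψ : Eucl n → Eucl n) : ℝ :=
  ∫ x in Ω, matForm (A x) (v x) (v x) ^ ((p - 2) / 2) * matForm (A x) (v x) (ψ x)

/-- `lam` is an eigenvalue of `-L_{A,p}` with zero Dirichlet condition: the problem
`-L_{A,p} u = lam |u|^(p-2) u` in `Ω`, `u = 0` on `∂Ω`, has a nontrivial weak solution
`u ∈ W₀^{1,p}(Ω)`. -/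
def IsEigenvalue {n : ℕ} (Ω : Set (Eucl n)) (p : ℝ) (A : Eucl n → Matrix (Fin n) (Fin n) ℝ)
    (lam : ℝ) : Prop :=
  ∃ (u : Eucl n → ℝ) (v : Eucl n → Eucl n), IsW0 Ω p u v ∧
    ¬ (u =ᵐ[volume.restrict Ω] 0) ∧
    ∀ (φ : Eucl n → ℝ) (ψ : Eucl n → Eucl n), IsW0 Ω p φ ψ →
      opPairing Ω p A v ψ = ∫ x in Ω, lam * |u x| ^ (p - 2) * u x * φ x

/-- The first (smallest) eigenvalue `λ₁(A, p)` of `-L_{A,p}` on `W₀^{1,p}(Ω)`. -/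
def firstEigenvalue {n : ℕ} (Ω : Set (Eucl n)) (p : ℝ)
    (A : Eucl n → Matrix (Fin n) (Fin n) ℝ) : ℝ :=
  sInf {lam : ℝ | IsEigenvalue Ω p A lam}

/-- The `j`-th component of `f(s) + g(s)`, where `f = (1/p) ∇F` and `g = (1/p*) ∇G`. -/
def nonlinearity {d : ℕ} (n : ℕ) (p : ℝ) (F G : Eucl d → ℝ) (s : Eucl d) (j : Fin d) : ℝ :=
  1 / p * gradient F s j + 1 / critExp n p * gradient G s j

/-- `u : Ω → ℝᵈ` is a weak solution of `-L_{A,p} u = f(u) + g(u)` in `Ω`, `u = 0` on `∂Ω`: every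
component lies in `W₀^{1,p}(Ω)`, and every component of the equation holds in the dual of
`W₀^{1,p}(Ω)`. -/
def IsWeakSolution {n d : ℕ} (Ω : Set (Eucl n)) (p : ℝ)
    (A : Eucl n → Matrix (Fin n) (Fin n) ℝ) (F G : Eucl d → ℝ) (u : Eucl n → Eucl d) : Prop :=
  ∃ v : Fin d → Eucl n → Eucl n,
    (∀ j, IsW0 Ω p (fun x => u x j) (v j)) ∧
    ∀ (j : Fin d) (φ : Eucl n → ℝ) (ψ : Eucl n → Eucl n), IsW0 Ω p φ ψ →
      IntegrableOn (fun x => nonlinearity n p F G (u x) j * φ x) Ω ∧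
      opPairing Ω p A (v j) ψ = ∫ x in Ω, nonlinearity n p F G (u x) j * φ x

end

end AnisoPLap

/-! Let J(u) = ∑ⱼ ∫⟨A∇uⱼ,∇uⱼ⟩^(p/2) − ∫F(u), and let S be its infimum over the set ∫G(u) = 1. Since
M_F < λ₁, J is at least (1 − M_F/λ₁) times the energy, so S > 0 and minimizing sequences are
bounded. As p* is critical, the constraint may be lost in the limit; the proof does not need it
there.

Ekeland's principle (`exists_minimizing_palais_smale`) gives a minimizing sequence w_k that solves
the Euler–Lagrange equation up to an error tending to zero, with multiplier (p/p*) J(w_k) → (p/p*)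
S. The Boccardo–Murat argument (`exists_subseq_gradient_tendsto_ae`) makes the gradients converge
a.e. along a subsequence, so the limit u solves the equation with multiplier (p/p*) S exactly,
whatever ∫G(u) is (`exists_minimizing_seq_tendsto_solution`). Because p ≠ p*, multiplying u by
S^(1/(p*−p)) gives a solution of the system.

It remains to see that u ≠ 0 (`exists_nontrivial_weakSolution`). By the Sobolev inequality the
energy is at least some m > 0 on the constraint set. If u = 0, then ∫F(w_k) → 0 because the exponent
p is subcritical, so the energies tend to S and S ≥ m. On the other hand, put the normalized first
eigenfunction e in one component and scale it by r to meet the constraint: J is then at most r^p(λ₁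
− μ_F), which is below m as soon as μ_F > λ₁ − m/r^p. Both m and r depend on Ω, A, p and G only, so
λ* can be fixed before F (`exists_threshold`).

The eigenfunction comes from the same minimization with d = 1, F = 0 and |s|^p in place of G; there
the constraint does survive (`exists_first_eigenfunction`). Weak topologies are avoided throughout:
W₀^{1,p} is a closed space of pairs (u, ∇u), weak closedness is replaced by Banach–Saks averages
(`exists_average_close`), and integrals pass to the limit by Vitali's theorem
(`tendsto_integral_of_le_rpow_mul`). -/

namespace AnisoPLap

/-! ### Ekeland's principle and almost critical minimizing sequences. -/

/-- Ekeland's variational principle. -/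
theorem ekeland {X : Type*} [MetricSpace X] [CompleteSpace X] {f : X → ℝ} (hf : Continuous f)
    {m : ℝ} (hm : ∀ x, m ≤ f x) (x₀ : X) {ε : ℝ} (hε : 0 < ε) :
    ∃ x, f x ≤ f x₀ ∧ ∀ w, f x - ε * dist w x ≤ f w := by
  let S : X → Set X := fun x => {w | f w + ε * dist w x ≤ f x}
  have hself : ∀ x, x ∈ S x := fun x => by simp [S]
  have htrans : ∀ x y z, y ∈ S x → z ∈ S y → z ∈ S x := by
    intro x y z hy hz
    simp only [S, Set.mem_ofPred_eq] at *
    have := dist_triangle z y x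
    nlinarith
  have hclosed : ∀ x, IsClosed (S x) := fun x =>
    isClosed_le (hf.add (continuous_const.mul (continuous_id.dist continuous_const)))
      continuous_const
  -- The next point almost minimizes `f` on `S x`; this makes the nested sets `S (x k)` shrink to a
  -- point.
  have hnext : ∀ (k : ℕ) (x : X), ∃ y ∈ S x, ∀ w ∈ S x, f y ≤ f w + (1 / 2 : ℝ) ^ k := by
    intro k x
    have hne : (f '' S x).Nonempty := ⟨_, x, hself x, rfl⟩
    have hbdd : BddBelow (f '' S x) := ⟨m, by rintro _ ⟨w, -, rfl⟩; exact hm w⟩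
    obtain ⟨_, ⟨y, hy, rfl⟩, hlt⟩ := exists_lt_of_csInf_lt hne
      (show sInf (f '' S x) < sInf (f '' S x) + (1 / 2 : ℝ) ^ k by
        have : (0 : ℝ) < (1 / 2) ^ k := by positivity
        linarith)
    refine ⟨y, hy, fun w hw => ?_⟩
    have := csInf_le hbdd ⟨w, hw, rfl⟩
    linarith
  choose g hgS hg using hnext
  let x : ℕ → X := fun k => Nat.rec x₀ (fun k y => g k y) k
  have hx_succ : ∀ k, x (k + 1) = g k (x k) := fun k => rfl
  have hmono : ∀ k l, k ≤ l → x l ∈ S (x k) := by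
    intro k l hkl
    induction l, hkl using Nat.le_induction with
    | base => exact hself _
    | succ l _ ih => exact htrans _ _ _ ih (by rw [hx_succ]; exact hgS _ _)
  have hdist : ∀ k, ∀ w ∈ S (x (k + 1)), dist w (x (k + 1)) ≤ (1 / 2 : ℝ) ^ k / ε := by
    intro k w hw
    have h1 : w ∈ S (x k) := htrans _ _ _ (by rw [hx_succ]; exact hgS _ _) hw
    have h2 := hg k (x k) w h1
    rw [← hx_succ] at h2
    simp only [S, Set.mem_ofPred_eq] at hw
    rw [le_div_iff₀ hε]
    linarith
  have hlim0 : Tendsto (fun k : ℕ => (1 / 2 : ℝ) ^ k / ε) atTop (𝓝 0) := by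
    simpa using (tendsto_pow_atTop_nhds_zero_of_lt_one (by norm_num : (0 : ℝ) ≤ 1 / 2)
      (by norm_num)).div_const ε
  have hcauchy : CauchySeq (fun k => x (k + 1)) := by
    refine cauchySeq_of_le_tendsto_0' (fun k : ℕ => (1 / 2 : ℝ) ^ k / ε) (fun k l hkl => ?_) hlim0
    rw [dist_comm]
    exact hdist k _ (hmono (k + 1) (l + 1) (by omega))
  obtain ⟨y, hy⟩ := cauchySeq_tendsto_of_complete hcauchy
  have hyS : ∀ k, y ∈ S (x k) := fun k =>
    (hclosed _).mem_of_tendsto hy (eventually_atTop.2 ⟨k, fun l hl => hmono k (l + 1) (by omega)⟩)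
  refine ⟨y, ?_, fun w => ?_⟩
  · have := hyS 0
    simp only [S, Set.mem_ofPred_eq] at this
    have h0 : x 0 = x₀ := rfl
    rw [h0] at this
    nlinarith [dist_nonneg (x := y) (y := x₀)]
  -- A point violating the inequality lies in `S y`, hence in every `S (x k)`, so it is the limit
  -- `y` itself.
  · by_contra! hlt
    have hw : w ∈ S y := by simp only [S, Set.mem_ofPred_eq]; linarith
    have hlim : Tendsto (fun k => x (k + 1)) atTop (𝓝 w) := by
      rw [tendsto_iff_dist_tendsto_zero]
      refine squeeze_zero (fun _ => dist_nonneg) (fun k => ?_) hlim0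
      rw [dist_comm]
      exact hdist k w (htrans _ _ _ (hyS (k + 1)) hw)
    have hwy := tendsto_nhds_unique hlim hy
    subst hwy
    simp at hlt

/-- A homogeneous constrained minimization problem has a minimizing sequence satisfying the
Euler–Lagrange equation up to an error tending to zero. -/
theorem exists_minimizing_palais_smale {Y : Type*} [NormedAddCommGroup Y] [NormedSpace ℝ Y]
    [CompleteSpace Y] {J K : Y → ℝ} {J' K' : Y → Y → ℝ} {p q m : ℝ} (hq : 0 < q)
    (hJc : Continuous J) (hKc : Continuous K)
    (hJd : ∀ u φ, HasDerivAt (fun t : ℝ => J (u + t • φ)) (J' u φ) 0)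
    (hKd : ∀ u φ, HasDerivAt (fun t : ℝ => K (u + t • φ)) (K' u φ) 0)
    (hJh : ∀ ρ : ℝ, 0 < ρ → ∀ u, J (ρ • u) = ρ ^ p * J u)
    (hKh : ∀ ρ : ℝ, 0 < ρ → ∀ u, K (ρ • u) = ρ ^ q * K u)
    (hne : ∃ u, K u = 1) (hm : ∀ u, K u = 1 → m ≤ J u) :
    ∃ u : ℕ → Y, (∀ k, K (u k) = 1) ∧
      Tendsto (fun k => J (u k)) atTop (𝓝 (sInf (J '' {u | K u = 1}))) ∧
      ∀ (k : ℕ) φ, |J' (u k) φ - p / q * J (u k) * K' (u k) φ| ≤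
        1 / ((k : ℝ) + 1) * (‖φ‖ + 1 / q * |K' (u k) φ| * ‖u k‖) := by
  -- Ekeland's inequality only bounds right derivatives from below; oddness in `φ` yields the bound
  -- from above.
  have hneg : ∀ (I : Y → ℝ) (I' : Y → Y → ℝ),
      (∀ u φ, HasDerivAt (fun t : ℝ => I (u + t • φ)) (I' u φ) 0) →
      ∀ u φ, I' u (-φ) = -I' u φ := by
    intro I I' hI u φ
    have h1 : HasDerivAt (fun t : ℝ => I (u + t • φ)) (I' u φ) (-0) := by
      rw [neg_zero]; exact hI u φ
    have h2 := h1.scomp (0 : ℝ) (hasDerivAt_neg (0 : ℝ))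
    refine (hI u (-φ)).unique ?_
    convert h2 using 1
    · ext t
      simp
    · simp
  suffices h : ∃ u : ℕ → Y, (∀ k, K (u k) = 1) ∧
      Tendsto (fun k => J (u k)) atTop (𝓝 (sInf (J '' {u | K u = 1}))) ∧
      ∀ (k : ℕ) φ, -(1 / ((k : ℝ) + 1) * (‖φ‖ + 1 / q * |K' (u k) φ| * ‖u k‖)) ≤
        J' (u k) φ - p / q * J (u k) * K' (u k) φ by
    obtain ⟨u, h1, h2, h3⟩ := h
    refine ⟨u, h1, h2, fun k φ => abs_le.2 ⟨h3 k φ, ?_⟩⟩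
    have := h3 k (-φ)
    rw [hneg J J' hJd, hneg K K' hKd, norm_neg, abs_neg] at this
    linarith
  set X : Set Y := {u | K u = 1} with hX
  have hXc : IsClosed X := isClosed_eq hKc continuous_const
  have : CompleteSpace X := hXc.completeSpace_coe
  have hbdd : BddBelow (J '' X) := ⟨m, by rintro _ ⟨w, hw, rfl⟩; exact hm w hw⟩
  have hne' : (J '' X).Nonempty := by obtain ⟨u, hu⟩ := hne; exact ⟨_, u, hu, rfl⟩
  have step : ∀ k : ℕ, ∃ u : X, J u ≤ sInf (J '' X) + 1 / ((k : ℝ) + 1) ∧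
      ∀ w : X, J u - 1 / ((k : ℝ) + 1) * dist w u ≤ J w := by
    intro k
    have hk : (0 : ℝ) < 1 / ((k : ℝ) + 1) := by positivity
    obtain ⟨_, ⟨y, hy, rfl⟩, hlt⟩ := exists_lt_of_csInf_lt hne' (lt_add_of_pos_right _ hk)
    obtain ⟨x, hx1, hx2⟩ := ekeland (X := X) (f := fun w => J w)
      (hJc.comp continuous_subtype_val) (fun w => hm w w.2) ⟨y, hy⟩ hk
    exact ⟨x, hx1.trans hlt.le, hx2⟩
  choose u hu1 hu2 using step
  refine ⟨fun k => u k, fun k => (u k).2, ?_, fun k φ => ?_⟩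
  · refine tendsto_of_tendsto_of_tendsto_of_le_of_le tendsto_const_nhds
      (h := fun k : ℕ => sInf (J '' X) + 1 / ((k : ℝ) + 1)) ?_
      (fun k => csInf_le hbdd ⟨_, (u k).2, rfl⟩) hu1
    simpa using tendsto_const_nhds.add (tendsto_one_div_add_atTop_nhds_zero_nat (𝕜 := ℝ))
  · obtain ⟨v, hv⟩ : ∃ v : Y, v = u k := ⟨_, rfl⟩
    simp only [← hv]
    set ε : ℝ := 1 / ((k : ℝ) + 1) with hε
    have hεpos : 0 < ε := by positivity
    have hKv : K v = 1 := hv ▸ (u k).2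
    have hK0 : K (v + (0 : ℝ) • φ) = 1 := by simpa using hKv
    -- By homogeneity `κ t • (v + t • φ)` stays in the set `K = 1`. It is the competitor in
    -- Ekeland's inequality.
    let κ : ℝ → ℝ := fun t => K (v + t • φ) ^ (-1 / q)
    have hκd : HasDerivAt κ (-1 / q * K' v φ) 0 := by
      have := (hKd v φ).rpow_const (p := -1 / q) (Or.inl (by rw [hK0]; norm_num))
      rw [hK0] at this
      simpa [κ, mul_comm] using this
    have hκ0 : κ 0 = 1 := by simp [κ, hKv]
    have hΦd : HasDerivAt (fun t : ℝ => K (v + t • φ) ^ (-p / q) * J (v + t • φ))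
        (J' v φ - p / q * J v * K' v φ) 0 := by
      have h1 := (hKd v φ).rpow_const (p := -p / q) (Or.inl (by rw [hK0]; norm_num))
      rw [hK0] at h1
      have h2 := h1.mul (hJd v φ)
      rw [hK0] at h2
      refine h2.congr_deriv ?_
      simp
      ring
    have hpos : ∀ᶠ t in 𝓝 (0 : ℝ), 0 < K (v + t • φ) := by
      have := (hKd v φ).continuousAt.eventually (lt_mem_nhds (a := 0) (by simp [hKv]))
      exact this
    -- `Ψ` is `J` along the retracted curve. The term `p / q * J v * K' v φ` in its derivative is
    -- the Lagrange multiplier.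
    let Ψ : ℝ → ℝ := fun t => K (v + t • φ) ^ (-p / q) * J (v + t • φ)
    have hΨ0 : Ψ 0 = J v := by simp [Ψ, hKv]
    -- Ekeland's inequality along the curve, divided by `t > 0`; `t → 0` then gives the claim.
    have key : ∀ᶠ t in 𝓝[>] (0 : ℝ),
        -(ε * (κ t * ‖φ‖ + |t⁻¹ • (κ t - κ 0)| * ‖v‖)) ≤ t⁻¹ • (Ψ t - Ψ 0) := by
      filter_upwards [hpos.filter_mono nhdsWithin_le_nhds, self_mem_nhdsWithin] with t ht ht0
      have ht0 : 0 < t := ht0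
      have hκpos : 0 < κ t := Real.rpow_pos_of_pos ht _
      have hmem : κ t • (v + t • φ) ∈ X := by
        simp only [hX, Set.mem_ofPred_eq, hKh _ hκpos, κ]
        rw [← Real.rpow_mul ht.le, div_mul_cancel₀ _ hq.ne', Real.rpow_neg_one,
          inv_mul_cancel₀ ht.ne']
      have h1 := hu2 k ⟨_, hmem⟩
      have h2 : J (κ t • (v + t • φ)) = Ψ t := by
        rw [hJh _ hκpos]
        simp only [κ, Ψ]
        rw [← Real.rpow_mul ht.le]
        congr 2
        ring
      rw [Subtype.dist_eq] at h1
      simp only [] at h1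
      rw [h2, ← hv, dist_eq_norm] at h1
      have h3 : ‖κ t • (v + t • φ) - v‖ ≤ |κ t - 1| * ‖v‖ + t * κ t * ‖φ‖ := by
        have : κ t • (v + t • φ) - v = (κ t - 1) • v + (t * κ t) • φ := by
          simp only [smul_add, sub_smul, one_smul, smul_smul]
          rw [mul_comm t]
          abel
        rw [this]
        refine (norm_add_le _ _).trans (le_of_eq ?_)
        rw [norm_smul, norm_smul, Real.norm_eq_abs, Real.norm_eq_abs, abs_of_pos (mul_pos ht0 hκpos)]
      rw [hΨ0, hκ0, smul_eq_mul, smul_eq_mul, abs_mul, abs_of_pos (inv_pos.2 ht0)]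
      have h4 : -(ε * (|κ t - 1| * ‖v‖ + t * κ t * ‖φ‖)) ≤ Ψ t - J v := by
        have := mul_le_mul_of_nonneg_left h3 hεpos.le
        linarith
      have h5 := mul_le_mul_of_nonneg_left h4 (inv_pos.2 ht0).le
      refine le_trans (le_of_eq ?_) h5
      field_simp
      ring
    have t1 : Tendsto (fun t => t⁻¹ • (Ψ t - Ψ 0)) (𝓝[>] (0 : ℝ))
        (𝓝 (J' v φ - p / q * J v * K' v φ)) := by
      have := (hasDerivAt_iff_tendsto_slope_zero.1 hΦd).mono_left
        (nhdsWithin_mono _ (fun t ht => (ne_of_gt ht : t ≠ 0)) : 𝓝[>] (0 : ℝ) ≤ 𝓝[≠] 0)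
      simpa [Ψ] using this
    have t2 : Tendsto (fun t => t⁻¹ • (κ t - κ 0)) (𝓝[>] (0 : ℝ)) (𝓝 (-1 / q * K' v φ)) := by
      have := (hasDerivAt_iff_tendsto_slope_zero.1 hκd).mono_left
        (nhdsWithin_mono _ (fun t ht => (ne_of_gt ht : t ≠ 0)) : 𝓝[>] (0 : ℝ) ≤ 𝓝[≠] 0)
      simpa using this
    have t3 : Tendsto κ (𝓝[>] (0 : ℝ)) (𝓝 1) := by
      have := hκd.continuousAt.tendsto.mono_left (nhdsWithin_le_nhds (s := Set.Ioi (0 : ℝ)))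
      rwa [hκ0] at this
    have := le_of_tendsto_of_tendsto
      ((((t3.mul_const ‖φ‖).add (t2.abs.mul_const ‖v‖)).const_mul ε).neg) t1 key
    refine le_trans (le_of_eq ?_) this
    rw [one_mul, abs_mul, abs_div, abs_neg, abs_one, abs_of_pos hq]

/-! ### Integrals of integrands with power growth. -/

section PowerIntegrals

variable {X : Type*} [MeasurableSpace X] {μ : Measure X}
  {V : Type*} [NormedAddCommGroup V] {V' : Type*} [NormedAddCommGroup V']

theorem lpNorm_rpow_eq_integral {q : ℝ} (hq : 0 < q) {U : X → V}
    (hU : MemLp U (ENNReal.ofReal q) μ) :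
    lpNorm U (ENNReal.ofReal q) μ ^ q = ∫ x, ‖U x‖ ^ q ∂μ := by
  rw [← toReal_eLpNorm hU.1, hU.eLpNorm_eq_integral_rpow_norm (by simpa using hq)
    ENNReal.ofReal_ne_top, ENNReal.toReal_ofReal hq.le, ENNReal.toReal_ofReal (by positivity),
    ← Real.rpow_mul (integral_nonneg fun x => by positivity), inv_mul_cancel₀ hq.ne', Real.rpow_one]

theorem integrable_norm_rpow_of_memLp {q : ℝ} (hq : 0 < q) {U : X → V}
    (hU : MemLp U (ENNReal.ofReal q) μ) : Integrable (fun x => ‖U x‖ ^ q) μ := by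
  have := hU.integrable_norm_rpow (by simpa using hq) ENNReal.ofReal_ne_top
  rwa [ENNReal.toReal_ofReal hq.le] at this

theorem memLp_norm_rpow_conj {q : ℝ} (hq : 1 < q) {U : X → V}
    (hU : MemLp U (ENNReal.ofReal q) μ) :
    MemLp (fun x => ‖U x‖ ^ (q - 1)) (ENNReal.ofReal (q / (q - 1))) μ := by
  have := hU.norm_rpow_div (ENNReal.ofReal (q - 1))
  rwa [ENNReal.toReal_ofReal (by linarith), ← ENNReal.ofReal_div_of_pos (by linarith)] at this

theorem integrable_rpow_mul {q : ℝ} (hq : 1 < q) {U : X → V} {Φ : X → V'}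
    (hU : MemLp U (ENNReal.ofReal q) μ) (hΦ : MemLp Φ (ENNReal.ofReal q) μ) :
    Integrable (fun x => ‖U x‖ ^ (q - 1) * ‖Φ x‖) μ := by
  have hc : (q / (q - 1)).HolderConjugate q := (Real.HolderConjugate.conjExponent hq).symm
  have := hc.ennrealOfReal
  exact (memLp_norm_rpow_conj hq hU).integrable_mul hΦ.norm

theorem integral_rpow_mul_le {q : ℝ} (hq : 1 < q) {U : X → V} {Φ : X → V'}
    (hU : MemLp U (ENNReal.ofReal q) μ) (hΦ : MemLp Φ (ENNReal.ofReal q) μ) :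
    ∫ x, ‖U x‖ ^ (q - 1) * ‖Φ x‖ ∂μ ≤
      lpNorm U (ENNReal.ofReal q) μ ^ (q - 1) * lpNorm Φ (ENNReal.ofReal q) μ := by
  have hc : (q / (q - 1)).HolderConjugate q := (Real.HolderConjugate.conjExponent hq).symm
  have hq0 : 0 < q := by linarith
  have hq1 : 0 < q - 1 := by linarith
  refine (integral_mul_le_Lp_mul_Lq_of_nonneg hc (ae_of_all _ fun x => by positivity)
    (ae_of_all _ fun x => by positivity) (memLp_norm_rpow_conj hq hU) hΦ.norm).trans (le_of_eq ?_)
  have h1 : ∀ x, (‖U x‖ ^ (q - 1)) ^ (q / (q - 1)) = ‖U x‖ ^ q := fun x => by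
    rw [← Real.rpow_mul (norm_nonneg _), mul_div_cancel₀ _ hq1.ne']
  simp only [h1]
  rw [← lpNorm_rpow_eq_integral hq0 hU, ← lpNorm_rpow_eq_integral hq0 hΦ,
    ← Real.rpow_mul lpNorm_nonneg, ← Real.rpow_mul lpNorm_nonneg]
  congr 1
  · congr 1; field_simp
  · rw [mul_one_div_cancel hq0.ne', Real.rpow_one]

/-- Integrals converge along an a.e. convergent sequence of integrands that are dominated by
`|u k| ^ (q - 1) * |φ|` with `u k` bounded in `L^q` and `φ ∈ L^q`. -/
theorem tendsto_integral_of_le_rpow_mul [IsFiniteMeasure μ] (hq : 1 < q) {M C : ℝ} (hC : 0 ≤ C)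
    {u : ℕ → X → V} {φ : X → V'} {f : ℕ → X → ℝ} {f₀ : X → ℝ}
    (hu : ∀ k, MemLp (u k) (ENNReal.ofReal q) μ)
    (hM : ∀ k, lpNorm (u k) (ENNReal.ofReal q) μ ≤ M) (hφ : MemLp φ (ENNReal.ofReal q) μ)
    (hf : ∀ k, AEStronglyMeasurable (f k) μ)
    (hle : ∀ k, ∀ᵐ x ∂μ, |f k x| ≤ C * (‖u k x‖ ^ (q - 1) * ‖φ x‖))
    (hf₀ : Integrable f₀ μ) (hlim : ∀ᵐ x ∂μ, Tendsto (fun k => f k x) atTop (𝓝 (f₀ x))) :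
    Tendsto (fun k => ∫ x, f k x ∂μ) atTop (𝓝 (∫ x, f₀ x ∂μ)) := by
  have hq0 : 0 < q := by linarith
  have hM0 : 0 ≤ M := lpNorm_nonneg.trans (hM 0)
  have hfi : ∀ k, Integrable (f k) μ := fun k =>
    ((integrable_rpow_mul hq (hu k) hφ).const_mul C).mono' (hf k) (hle k)
  refine tendsto_integral_of_L1' f₀ hf₀.1 (Eventually.of_forall hfi) ?_
  refine tendsto_Lp_finite_of_tendsto_ae le_rfl ENNReal.one_ne_top hf (memLp_one_iff_integrable.2 hf₀)
    ?_ hlim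
  intro ε hε
  have hD : 0 < C * M ^ (q - 1) + 1 := by positivity
  -- Vitali's theorem needs uniform integrability. Hölder's inequality reduces it to the absolute
  -- continuity of the `L^q` norm of the fixed factor `φ`.
  obtain ⟨δ, hδ, hδ'⟩ := hφ.eLpNorm_indicator_le (by simpa using hq.le) ENNReal.ofReal_ne_top
    (div_pos hε hD)
  refine ⟨δ, hδ, fun k s hs hμs => ?_⟩
  have hφs : MemLp (s.indicator φ) (ENNReal.ofReal q) μ := hφ.indicator hs
  have h1 : lpNorm (s.indicator φ) (ENNReal.ofReal q) μ ≤ ε / (C * M ^ (q - 1) + 1) := by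
    rw [← toReal_eLpNorm hφs.1]
    exact ENNReal.toReal_le_of_le_ofReal (by positivity) (hδ' s hs hμs)
  rw [eLpNorm_one_eq_lintegral_enorm, ← ofReal_integral_norm_eq_lintegral_enorm ((hfi k).indicator hs)]
  refine ENNReal.ofReal_le_ofReal ?_
  have h2 : ∫ x, ‖s.indicator (f k) x‖ ∂μ ≤
      ∫ x, C * (‖u k x‖ ^ (q - 1) * ‖s.indicator φ x‖) ∂μ := by
    refine integral_mono_ae ((hfi k).indicator hs).norm
      ((integrable_rpow_mul hq (hu k) hφs).const_mul C) ?_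
    filter_upwards [hle k] with x hx
    by_cases hxs : x ∈ s
    · simpa [hxs] using hx
    · simp [hxs]
  refine h2.trans ?_
  rw [integral_const_mul]
  have h3 := integral_rpow_mul_le hq (hu k) hφs
  have h4 : lpNorm (u k) (ENNReal.ofReal q) μ ^ (q - 1) * lpNorm (s.indicator φ) (ENNReal.ofReal q) μ
      ≤ M ^ (q - 1) * (ε / (C * M ^ (q - 1) + 1)) := by
    have h0 : 0 ≤ q - 1 := by linarith
    have := hM k
    have := lpNorm_nonneg (f := u k) (p := ENNReal.ofReal q) (μ := μ)
    gcongr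
    exact lpNorm_nonneg
  calc _ ≤ C * (M ^ (q - 1) * (ε / (C * M ^ (q - 1) + 1))) := by
        gcongr; exact h3.trans h4
    _ = C * M ^ (q - 1) / (C * M ^ (q - 1) + 1) * ε := by ring
    _ ≤ 1 * ε := by
        gcongr
        rw [div_le_one hD]; linarith
    _ = ε := one_mul ε

theorem lpNorm_coe_eq_norm (Q : ℝ≥0∞) (U : Lp V Q μ) : lpNorm U Q μ = ‖U‖ := by
  rw [← toReal_eLpNorm (Lp.memLp U).1, Lp.norm_def]

/-- An integrand `g(x, s)` with `g(x, 0) = 0` whose derivative in `s` grows like `|s| ^ (q - 1)`. -/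
structure IsPowerIntegrand [NormedSpace ℝ V] (μ : Measure X) (q : ℝ) (g : X → V → ℝ)
    (g' : X → V → V →L[ℝ] ℝ) : Prop where
  meas : ∀ U : X → V, AEStronglyMeasurable U μ → AEStronglyMeasurable (fun x => g x (U x)) μ
  meas' : ∀ U Φ : X → V, AEStronglyMeasurable U μ → AEStronglyMeasurable Φ μ →
    AEStronglyMeasurable (fun x => g' x (U x) (Φ x)) μ
  zero : ∀ᵐ x ∂μ, g x 0 = 0
  deriv : ∀ᵐ x ∂μ, ∀ s, HasFDerivAt (g x) (g' x s) s
  bound : ∃ C : ℝ, 0 ≤ C ∧ ∀ᵐ x ∂μ, ∀ s, ‖g' x s‖ ≤ C * ‖s‖ ^ (q - 1)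

variable [NormedSpace ℝ V] {q : ℝ} {g : X → V → ℝ} {g' : X → V → V →L[ℝ] ℝ}

/-- Mean value inequality on the ball of radius `‖s‖ + ‖t‖` around the origin. -/
theorem IsPowerIntegrand.abs_sub_le (hg : IsPowerIntegrand μ q g g') (hq : 1 < q) :
    ∃ C : ℝ, 0 ≤ C ∧ ∀ᵐ x ∂μ, ∀ s t : V,
      |g x s - g x t| ≤ C * ((‖s‖ + ‖t‖) ^ (q - 1) * ‖s - t‖) := by
  obtain ⟨C, hC, hb⟩ := hg.bound
  refine ⟨C, hC, ?_⟩
  filter_upwards [hb, hg.deriv] with x hx hd s t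
  have := (convex_closedBall (0 : V) (‖s‖ + ‖t‖)).norm_image_sub_le_of_norm_hasFDerivWithin_le
    (𝕜 := ℝ) (f := g x) (f' := g' x) (C := C * (‖s‖ + ‖t‖) ^ (q - 1)) (x := t) (y := s)
    (fun y _ => (hd y).hasFDerivWithinAt) (fun y hy => (hx y).trans ?_) ?_ ?_
  · rw [← mul_assoc]; exact this
  · have : ‖y‖ ≤ ‖s‖ + ‖t‖ := by simpa using hy
    have h0 : 0 ≤ q - 1 := by linarith
    gcongr
  · simp
  · simp

theorem IsPowerIntegrand.abs_le (hg : IsPowerIntegrand μ q g g') (hq : 1 < q) :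
    ∃ C : ℝ, 0 ≤ C ∧ ∀ᵐ x ∂μ, ∀ s : V, |g x s| ≤ C * ‖s‖ ^ q := by
  obtain ⟨C, hC, hb⟩ := hg.abs_sub_le hq
  refine ⟨C, hC, ?_⟩
  filter_upwards [hb, hg.zero] with x hx h0 s
  have := hx s 0
  rw [h0, sub_zero, norm_zero, add_zero, sub_zero] at this
  refine this.trans (le_of_eq ?_)
  rw [← Real.rpow_add_one' (norm_nonneg _) (by linarith)]
  ring_nf

theorem IsPowerIntegrand.integrable (hg : IsPowerIntegrand μ q g g') (hq : 1 < q) {U : X → V}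
    (hU : MemLp U (ENNReal.ofReal q) μ) : Integrable (fun x => g x (U x)) μ := by
  obtain ⟨C, -, hb⟩ := hg.abs_le hq
  refine ((integrable_norm_rpow_of_memLp (by linarith) hU).const_mul C).mono' (hg.meas U hU.1) ?_
  filter_upwards [hb] with x hx using hx _

theorem IsPowerIntegrand.integrable_deriv (hg : IsPowerIntegrand μ q g g') (hq : 1 < q)
    {U Φ : X → V} (hU : MemLp U (ENNReal.ofReal q) μ) (hΦ : MemLp Φ (ENNReal.ofReal q) μ) :
    Integrable (fun x => g' x (U x) (Φ x)) μ := by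
  obtain ⟨C, hC, hb⟩ := hg.bound
  refine ((integrable_rpow_mul hq hU hΦ).const_mul C).mono' (hg.meas' U Φ hU.1 hΦ.1) ?_
  filter_upwards [hb] with x hx
  refine ((g' x (U x)).le_opNorm _).trans ?_
  rw [← mul_assoc]
  gcongr
  exact hx _

theorem IsPowerIntegrand.abs_integral_deriv_le (hg : IsPowerIntegrand μ q g g') (hq : 1 < q) :
    ∃ C : ℝ, 0 ≤ C ∧ ∀ U Φ : X → V, MemLp U (ENNReal.ofReal q) μ →
      MemLp Φ (ENNReal.ofReal q) μ → |∫ x, g' x (U x) (Φ x) ∂μ| ≤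
        C * (lpNorm U (ENNReal.ofReal q) μ ^ (q - 1) * lpNorm Φ (ENNReal.ofReal q) μ) := by
  obtain ⟨C, hC, hb⟩ := hg.bound
  refine ⟨C, hC, fun U Φ hU hΦ => ?_⟩
  refine (norm_integral_le_of_norm_le (f := fun x => g' x (U x) (Φ x))
    ((integrable_rpow_mul hq hU hΦ).const_mul C) ?_).trans ?_
  · filter_upwards [hb] with x hx
    refine ((g' x (U x)).le_opNorm _).trans ?_
    rw [← mul_assoc]
    gcongr
    exact hx _
  · rw [integral_const_mul]
    gcongr
    exact integral_rpow_mul_le hq hU hΦ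

/-- Differentiation under the integral sign: for `|t| < 1` the derivative is dominated by a multiple
of `(‖U‖ + ‖Φ‖) ^ (q - 1) * ‖Φ‖`, integrable by Hölder. -/
theorem IsPowerIntegrand.hasDerivAt (hg : IsPowerIntegrand μ q g g') (hq : 1 < q)
    {U Φ : X → V} (hU : MemLp U (ENNReal.ofReal q) μ) (hΦ : MemLp Φ (ENNReal.ofReal q) μ) :
    HasDerivAt (fun t : ℝ => ∫ x, g x (U x + t • Φ x) ∂μ) (∫ x, g' x (U x) (Φ x) ∂μ) 0 := by
  obtain ⟨C, hC, hb⟩ := hg.bound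
  have hUΦ : MemLp (fun x => ‖U x‖ + ‖Φ x‖) (ENNReal.ofReal q) μ := hU.norm.add hΦ.norm
  have := (hasDerivAt_integral_of_dominated_loc_of_deriv_le (μ := μ) (𝕜 := ℝ) (x₀ := 0)
    (F := fun t x => g x (U x + t • Φ x)) (F' := fun t x => g' x (U x + t • Φ x) (Φ x))
    (bound := fun x => C * (‖‖U x‖ + ‖Φ x‖‖ ^ (q - 1) * ‖Φ x‖))
    (Metric.ball_mem_nhds (0 : ℝ) one_pos)
    (Eventually.of_forall fun t => hg.meas _ (hU.1.add (hΦ.1.const_smul t)))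
    (by simpa using hg.integrable hq hU)
    (by simpa using hg.meas' U Φ hU.1 hΦ.1) ?_
    ((integrable_rpow_mul hq hUΦ hΦ).const_mul C) ?_).2
  · simpa using this
  · filter_upwards [hb] with x hx t ht
    refine ((g' x (U x + t • Φ x)).le_opNorm _).trans ?_
    rw [← mul_assoc]
    gcongr
    refine (hx _).trans ?_
    have h0 : 0 ≤ q - 1 := by linarith
    gcongr
    rw [Real.norm_of_nonneg (by positivity)]
    refine (norm_add_le _ _).trans ?_
    gcongr
    rw [norm_smul]
    have : ‖t‖ ≤ 1 := by simpa using (Metric.mem_ball.1 ht).le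
    exact mul_le_of_le_one_left (norm_nonneg _) this
  · filter_upwards [hg.deriv] with x hx t _
    have h1 : HasDerivAt (fun t : ℝ => U x + t • Φ x) (Φ x) t := by
      simpa using ((hasDerivAt_id t).smul_const (Φ x)).const_add (U x)
    exact (hx (U x + t • Φ x)).comp_hasDerivAt t h1

theorem IsPowerIntegrand.continuous_Lp (hg : IsPowerIntegrand μ q g g') (hq : 1 < q)
    [Fact (1 ≤ ENNReal.ofReal q)] :
    Continuous (fun U : Lp V (ENNReal.ofReal q) μ => ∫ x, g x (U x) ∂μ) := by
  obtain ⟨C, hC, hb⟩ := hg.abs_sub_le hq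
  rw [continuous_iff_continuousAt]
  intro T
  rw [ContinuousAt, tendsto_iff_dist_tendsto_zero]
  have hq1 : 0 < q - 1 := by linarith
  have hlim : Tendsto (fun U : Lp V (ENNReal.ofReal q) μ =>
      C * ((‖U‖ + ‖T‖) ^ (q - 1) * ‖U - T‖)) (𝓝 T) (𝓝 (C * ((‖T‖ + ‖T‖) ^ (q - 1) * ‖T - T‖))) := by
    have : Continuous fun U : Lp V (ENNReal.ofReal q) μ =>
        C * ((‖U‖ + ‖T‖) ^ (q - 1) * ‖U - T‖) := by
      refine continuous_const.mul (Continuous.mul (Continuous.rpow_const (by fun_prop) ?_) (by fun_prop))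
      exact fun _ => Or.inr hq1.le
    exact this.tendsto T
  rw [sub_self, norm_zero, mul_zero, mul_zero] at hlim
  refine squeeze_zero (fun _ => dist_nonneg) (fun U => ?_) hlim
  have hU := Lp.memLp U
  have hT := Lp.memLp T
  rw [Real.dist_eq, ← integral_sub (hg.integrable hq hU) (hg.integrable hq hT)]
  have hUT : MemLp (fun x => ‖U x‖ + ‖T x‖) (ENNReal.ofReal q) μ := hU.norm.add hT.norm
  refine (norm_integral_le_of_norm_le (f := fun x => g x (U x) - g x (T x))
    ((integrable_rpow_mul hq hUT (hU.sub hT)).const_mul C) ?_).trans ?_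
  · filter_upwards [hb] with x hx
    rw [Real.norm_of_nonneg (show 0 ≤ ‖U x‖ + ‖T x‖ by positivity)]
    exact hx _ _
  · rw [integral_const_mul]
    refine mul_le_mul_of_nonneg_left ((integral_rpow_mul_le hq hUT (hU.sub hT)).trans ?_) hC
    have e1 : lpNorm (⇑U - ⇑T) (ENNReal.ofReal q) μ = ‖U - T‖ := by
      rw [← toReal_eLpNorm (hU.sub hT).1, Lp.norm_def, eLpNorm_congr_ae (Lp.coeFn_sub U T)]
    have e2 : lpNorm (fun x => ‖U x‖ + ‖T x‖) (ENNReal.ofReal q) μ ≤ ‖U‖ + ‖T‖ := by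
      rw [← toReal_eLpNorm hUT.1, Lp.norm_def, Lp.norm_def,
        ← ENNReal.toReal_add hU.eLpNorm_ne_top hT.eLpNorm_ne_top]
      refine ENNReal.toReal_mono (ENNReal.add_ne_top.2 ⟨hU.eLpNorm_ne_top, hT.eLpNorm_ne_top⟩) ?_
      refine (eLpNorm_add_le hU.1.norm hT.1.norm Fact.out).trans ?_
      rw [eLpNorm_norm, eLpNorm_norm]
    rw [e1]
    gcongr
    exact lpNorm_nonneg

end PowerIntegrals

/-! ### Homogeneous `C¹` functions. -/

section Homogeneous

variable {d : ℕ} {q : ℝ} {H : Eucl d → ℝ}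

theorem IsHomogeneous.map_zero (hH : IsHomogeneous q H) (hq : 0 < q) : H 0 = 0 := by
  have h := hH 2 two_pos 0
  rw [smul_zero] at h
  have : (1 : ℝ) < 2 ^ q := Real.one_lt_rpow one_lt_two hq
  nlinarith

theorem IsHomogeneous.fderiv_smul (hH : IsHomogeneous q H) (hHd : ContDiff ℝ 1 H) {ρ : ℝ}
    (hρ : 0 < ρ) (s : Eucl d) : fderiv ℝ H (ρ • s) = ρ ^ (q - 1) • fderiv ℝ H s := by
  have hd : Differentiable ℝ H := hHd.differentiable one_ne_zero
  have h1 : HasFDerivAt (fun s => H (ρ • s)) (ρ • fderiv ℝ H (ρ • s)) s := by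
    have := (hd (ρ • s)).hasFDerivAt.comp s ((hasFDerivAt_id s).const_smul ρ)
    refine this.congr_fderiv ?_
    ext v
    simp
  have h2 : HasFDerivAt (fun s => H (ρ • s)) (ρ ^ q • fderiv ℝ H s) s := by
    simp only [hH ρ hρ]
    exact (hd s).hasFDerivAt.const_smul (ρ ^ q)
  have h3 := h1.unique h2
  rw [Real.rpow_sub_one hρ.ne', div_eq_inv_mul, mul_smul, ← h3, inv_smul_smul₀ hρ.ne']

theorem IsHomogeneous.norm_fderiv_le (hH : IsHomogeneous q H) (hHd : ContDiff ℝ 1 H) (hq : 1 < q) :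
    ∃ C : ℝ, 0 ≤ C ∧ ∀ s, ‖fderiv ℝ H s‖ ≤ C * ‖s‖ ^ (q - 1) := by
  obtain ⟨C, hC⟩ := (isCompact_sphere (0 : Eucl d) 1).exists_bound_of_continuousOn
    (hHd.continuous_fderiv one_ne_zero).continuousOn
  refine ⟨max C 0, le_max_right _ _, fun s => ?_⟩
  by_cases hs : s = 0
  -- Scaling the origin by 2 shows that the derivative there equals `2 ^ (q - 1)` times itself, so
  -- it vanishes.
  · have h := hH.fderiv_smul hHd two_pos 0
    rw [smul_zero] at h
    have h1 : (1 : ℝ) < 2 ^ (q - 1) := Real.one_lt_rpow one_lt_two (by linarith)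
    have h2 : ((2 : ℝ) ^ (q - 1) - 1) • fderiv ℝ H 0 = 0 := by
      rw [sub_smul, ← h, one_smul, sub_self]
    rcases smul_eq_zero.1 h2 with h3 | h3
    · linarith
    · rw [hs, h3, norm_zero]; positivity
  · have hs' : 0 < ‖s‖ := norm_pos_iff.2 hs
    have h := hH.fderiv_smul hHd hs' (‖s‖⁻¹ • s)
    rw [smul_inv_smul₀ hs'.ne'] at h
    rw [h, norm_smul, Real.norm_of_nonneg (by positivity), mul_comm]
    gcongr
    refine (hC _ ?_).trans (le_max_left _ _)
    simp [norm_smul, hs'.ne']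

theorem IsHomogeneous.isPowerIntegrand {X : Type*} [MeasurableSpace X] (μ : Measure X)
    (hH : IsHomogeneous q H) (hHd : ContDiff ℝ 1 H) (hq : 1 < q) :
    IsPowerIntegrand μ q (fun _ => H) (fun _ => fderiv ℝ H) where
  meas U hU := hHd.continuous.comp_aestronglyMeasurable hU
  meas' U Φ hU hΦ := by
    have h : Continuous fun z : Eucl d × Eucl d => fderiv ℝ H z.1 z.2 :=
      ((hHd.continuous_fderiv one_ne_zero).comp continuous_fst).clm_apply continuous_snd
    exact h.comp_aestronglyMeasurable (hU.prodMk hΦ)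
  zero := ae_of_all _ fun _ => hH.map_zero (by linarith)
  deriv := ae_of_all _ fun _ s => (hHd.differentiable one_ne_zero s).hasFDerivAt
  bound := by
    obtain ⟨C, hC, h⟩ := hH.norm_fderiv_le hHd hq
    exact ⟨C, hC, ae_of_all _ fun _ => h⟩

theorem isHomogeneous_norm_rpow : IsHomogeneous q (fun s : Eucl d => ‖s‖ ^ q) := by
  intro ρ hρ s
  simp only [norm_smul, Real.norm_of_nonneg hρ.le]
  exact Real.mul_rpow hρ.le (norm_nonneg _)

end Homogeneous

/-! ### Banach–Saks averages in `L^p`. -/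

section Averages

variable {X : Type*} [MeasurableSpace X] {μ : Measure X} [IsFiniteMeasure μ] {m : ℕ} {p : ℝ}
  [Fact (1 ≤ ENNReal.ofReal p)]

/-- A Brezis–Lieb splitting: `|w + g|^p - |g|^p` is dominated by `(|w + g| + |g|)^(p-1) |w|`, so
Vitali's theorem applies. A far member of a sequence tending to zero a.e. thus adds its norm almost
independently. -/
theorem tendsto_norm_add_rpow (hp : 1 < p) {C : ℝ} {g : ℕ → Lp (Eucl m) (ENNReal.ofReal p) μ}
    (hC : ∀ k, ‖g k‖ ≤ C) (hlim : ∀ᵐ x ∂μ, Tendsto (fun k => g k x) atTop (𝓝 0))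
    (w : Lp (Eucl m) (ENNReal.ofReal p) μ) :
    Tendsto (fun k => ‖w + g k‖ ^ p - ‖g k‖ ^ p) atTop (𝓝 (‖w‖ ^ p)) := by
  have hp0 : 0 < p := by linarith
  have hI := (isHomogeneous_norm_rpow (d := m) (q := p)).isPowerIntegrand μ
    (contDiff_norm_rpow hp) hp
  obtain ⟨D, hD, hb⟩ := hI.abs_sub_le hp
  have hn : ∀ U : Lp (Eucl m) (ENNReal.ofReal p) μ, ‖U‖ ^ p = ∫ x, ‖U x‖ ^ p ∂μ := fun U => by
    rw [← lpNorm_coe_eq_norm, lpNorm_rpow_eq_integral hp0 (Lp.memLp U)]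
  have hi : ∀ U : Lp (Eucl m) (ENNReal.ofReal p) μ, Integrable (fun x => ‖U x‖ ^ p) μ := fun U =>
    integrable_norm_rpow_of_memLp hp0 (Lp.memLp U)
  have hP : (1 : ℝ≥0∞) ≤ ENNReal.ofReal p := Fact.out
  have key := tendsto_integral_of_le_rpow_mul hp hD (μ := μ) (M := ‖w‖ + C + C)
    (u := fun k x => ‖(w + g k) x‖ + ‖g k x‖) (φ := w)
    (f := fun k x => ‖(w + g k) x‖ ^ p - ‖g k x‖ ^ p) (f₀ := fun x => ‖w x‖ ^ p)
    (fun k => (Lp.memLp (w + g k)).norm.add (Lp.memLp (g k)).norm) ?_ (Lp.memLp w)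
    (fun k => ((hi (w + g k)).sub (hi (g k))).1) ?_ (hi w) ?_
  · simp only [hn]
    refine key.congr fun k => ?_
    rw [integral_sub (hi _) (hi _)]
  · intro k
    refine (lpNorm_add_le (Lp.memLp (w + g k)).norm hP).trans ?_
    rw [lpNorm_norm (Lp.memLp _).1, lpNorm_norm (Lp.memLp _).1, lpNorm_coe_eq_norm,
      lpNorm_coe_eq_norm]
    have := norm_add_le w (g k)
    linarith [hC k]
  · intro k
    filter_upwards [hb, Lp.coeFn_add w (g k)] with x hx hadd
    rw [Real.norm_of_nonneg (show 0 ≤ ‖(w + g k) x‖ + ‖g k x‖ by positivity)]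
    have := hx ((w + g k) x) (g k x)
    simpa only [hadd, Pi.add_apply, add_sub_cancel_right] using this
  · have hall : ∀ᵐ x ∂μ, ∀ k, (w + g k) x = w x + g k x :=
      ae_all_iff.2 fun k => Lp.coeFn_add w (g k)
    filter_upwards [hall, hlim] with x hx hl
    simp only [hx]
    have h1 : Tendsto (fun k => ‖w x + g k x‖ ^ p - ‖g k x‖ ^ p) atTop
        (𝓝 (‖w x + 0‖ ^ p - ‖(0 : Eucl m)‖ ^ p)) :=
      ((hl.const_add _).norm.rpow_const (Or.inr hp0.le)).sub
        (hl.norm.rpow_const (Or.inr hp0.le))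
    simpa [Real.zero_rpow hp0.ne'] using h1

/-- Averages of a sparse subfamily of a bounded, a.e. convergent sequence converge in `L^p`. -/
theorem exists_average_close (hp : 1 < p) {C : ℝ} {h : ℕ → Lp (Eucl m) (ENNReal.ofReal p) μ}
    {v : Lp (Eucl m) (ENNReal.ofReal p) μ} (hC : ∀ k, ‖h k‖ ≤ C)
    (hlim : ∀ᵐ x ∂μ, Tendsto (fun k => h k x) atTop (𝓝 (v x))) {ε : ℝ} (hε : 0 < ε) (M : ℕ) :
    ∃ s : Finset ℕ, s.Nonempty ∧ (∀ i ∈ s, M ≤ i) ∧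
      ‖(s.card : ℝ)⁻¹ • ∑ i ∈ s, h i - v‖ < ε := by
  have hp0 : 0 < p := by linarith
  set D : ℝ := C + ‖v‖ with hD
  have hg : ∀ k, ‖h k - v‖ ≤ D := fun k => (norm_sub_le _ _).trans (by linarith [hC k])
  have hD0 : 0 ≤ D := (norm_nonneg _).trans (hg 0)
  have hglim : ∀ᵐ x ∂μ, Tendsto (fun k => (h k - v) x) atTop (𝓝 0) := by
    have hall : ∀ᵐ x ∂μ, ∀ k, (h k - v) x = h k x - v x :=
      ae_all_iff.2 fun k => Lp.coeFn_sub (h k) v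
    filter_upwards [hall, hlim] with x hx hl
    simp only [hx]
    simpa using hl.sub_const (v x)
  have hN : ∀ N : ℕ, ∃ s : Finset ℕ, s.card = N ∧ (∀ i ∈ s, M ≤ i) ∧
      ‖∑ i ∈ s, (h i - v)‖ ^ p ≤ N * (D ^ p + 1) := by
    intro N
    induction N with
    | zero => exact ⟨∅, rfl, by simp, by simp [Real.zero_rpow hp0.ne']⟩
    -- By the splitting, a far enough `k` raises the `p`-th power of the norm by less than `‖h k -
    -- v‖ ^ p + 1`. Taking `k` above all of `s` keeps the indices distinct.
    | succ N ih =>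
      obtain ⟨s, hs, hsM, hsn⟩ := ih
      have hev := (tendsto_norm_add_rpow hp hg hglim (∑ i ∈ s, (h i - v))).eventually
        (gt_mem_nhds (lt_add_one _))
      obtain ⟨k, hk1, hk2, hk3⟩ := (hev.and ((eventually_ge_atTop M).and
        (eventually_ge_atTop (s.sup id + 1)))).exists
      have hks : k ∉ s := fun hmem => by
        have := Finset.le_sup (f := id) hmem
        simp at this
        omega
      refine ⟨insert k s, by simp [hks, hs], ?_, ?_⟩
      · intro i hi
        rcases Finset.mem_insert.1 hi with rfl | hi
        · exact hk2
        · exact hsM i hi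
      · rw [Finset.sum_insert hks, add_comm]
        have h1 : ‖h k - v‖ ^ p ≤ D ^ p := Real.rpow_le_rpow (norm_nonneg _) (hg k) hp0.le
        push_cast
        linarith
  -- The average has `p`-th power at most `N ^ (-p) * N * (D ^ p + 1)`, which tends to zero because
  -- `p > 1`.
  have hlim0 : Tendsto (fun N : ℕ => ((N : ℝ) ^ (1 - p)) * (D ^ p + 1)) atTop (𝓝 0) := by
    have := ((tendsto_rpow_neg_atTop (show 0 < p - 1 by linarith)).comp
      (tendsto_natCast_atTop_atTop (R := ℝ))).mul_const (D ^ p + 1)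
    simpa [Function.comp_def] using this
  obtain ⟨N, hN1, hN2⟩ := ((hlim0.eventually (gt_mem_nhds (Real.rpow_pos_of_pos hε p))).and
    (eventually_ge_atTop 1)).exists
  obtain ⟨s, hs, hsM, hsn⟩ := hN N
  have hN0 : (0 : ℝ) < N := by exact_mod_cast hN2
  refine ⟨s, Finset.card_pos.1 (by omega), hsM, ?_⟩
  have heq : (s.card : ℝ)⁻¹ • ∑ i ∈ s, h i - v = (N : ℝ)⁻¹ • ∑ i ∈ s, (h i - v) := by
    rw [Finset.sum_sub_distrib, Finset.sum_const, smul_sub, hs, ← Nat.cast_smul_eq_nsmul ℝ,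
      inv_smul_smul₀ hN0.ne']
  rw [heq]
  rw [norm_smul, norm_inv, Real.norm_natCast]
  by_contra! hle
  have h1 := Real.rpow_le_rpow hε.le hle hp0.le
  rw [Real.mul_rpow (by positivity) (norm_nonneg _), Real.inv_rpow hN0.le] at h1
  have h2 : ((N : ℝ) ^ p)⁻¹ * ‖∑ i ∈ s, (h i - v)‖ ^ p ≤ ((N : ℝ) ^ p)⁻¹ * (N * (D ^ p + 1)) := by
    gcongr
  have h3 : ((N : ℝ) ^ p)⁻¹ * (N * (D ^ p + 1)) = (N : ℝ) ^ (1 - p) * (D ^ p + 1) := by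
    rw [Real.rpow_sub hN0, Real.rpow_one]
    ring
  linarith

end Averages

/-! ### Bounded a.e. convergent sequences in Lebesgue spaces. -/

section BoundedConvergence

variable {X : Type*} [MeasurableSpace X] {μ : Measure X} {V : Type*} [NormedAddCommGroup V]

theorem memLp_of_tendsto_ae {Q : ℝ≥0∞} {M : ℝ} {u : ℕ → X → V} {v : X → V}
    (hu : ∀ k, AEStronglyMeasurable (u k) μ) (hM : ∀ k, eLpNorm (u k) Q μ ≤ ENNReal.ofReal M)
    (hlim : ∀ᵐ x ∂μ, Tendsto (fun k => u k x) atTop (𝓝 (v x))) :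
    MemLp v Q μ ∧ eLpNorm v Q μ ≤ ENNReal.ofReal M := by
  have h : eLpNorm v Q μ ≤ ENNReal.ofReal M :=
    (Lp.eLpNorm_lim_le_liminf_eLpNorm hu v hlim).trans
      (liminf_le_of_frequently_le' (Frequently.of_forall hM))
  exact ⟨⟨aestronglyMeasurable_of_tendsto_ae atTop hu hlim, h.trans_lt ENNReal.ofReal_lt_top⟩, h⟩

/-- A bound in `L^r` with `r > p` makes the `p`-th powers uniformly integrable: by Hölder the `L^p`
norm over a set `s` is at most `M * μ(s) ^ (1/p - 1/r)`. -/
theorem tendsto_eLpNorm_sub_of_tendsto_ae [IsFiniteMeasure μ] {p r M : ℝ} (hp : 1 ≤ p) (hpr : p < r)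
    {u : ℕ → X → V} {v : X → V} (hu : ∀ k, AEStronglyMeasurable (u k) μ)
    (hM : ∀ k, eLpNorm (u k) (ENNReal.ofReal r) μ ≤ ENNReal.ofReal M)
    (hlim : ∀ᵐ x ∂μ, Tendsto (fun k => u k x) atTop (𝓝 (v x))) :
    Tendsto (fun k => eLpNorm (u k - v) (ENNReal.ofReal p) μ) atTop (𝓝 0) := by
  have hp0 : 0 < p := by linarith
  have hPR : ENNReal.ofReal p ≤ ENNReal.ofReal r := ENNReal.ofReal_le_ofReal hpr.le
  have hv := ((memLp_of_tendsto_ae hu hM hlim).1).mono_exponent hPR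
  refine tendsto_Lp_finite_of_tendsto_ae (by simpa using hp) ENNReal.ofReal_ne_top hu hv ?_ hlim
  intro ε hε
  set a : ℝ := 1 / p - 1 / r with ha
  have ha0 : 0 < a := sub_pos.2 (one_div_lt_one_div_of_lt hp0 hpr)
  have hD : 0 < |M| + 1 := by positivity
  refine ⟨(ε / (|M| + 1)) ^ a⁻¹, by positivity, fun k s hs hμs => ?_⟩
  rw [eLpNorm_indicator_eq_eLpNorm_restrict hs]
  refine (eLpNorm_le_eLpNorm_mul_rpow_measure_univ hPR (hu k).restrict).trans ?_
  rw [Measure.restrict_apply_univ, ENNReal.toReal_ofReal hp0.le,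
    ENNReal.toReal_ofReal (by linarith), ← ha]
  have h1 : eLpNorm (u k) (ENNReal.ofReal r) (μ.restrict s) ≤ ENNReal.ofReal (|M| + 1) :=
    (eLpNorm_mono_measure _ Measure.restrict_le_self).trans
      ((hM k).trans (ENNReal.ofReal_le_ofReal (by linarith [le_abs_self M])))
  have h2 : μ s ^ a ≤ ENNReal.ofReal (ε / (|M| + 1)) := by
    refine (ENNReal.rpow_le_rpow hμs ha0.le).trans (le_of_eq ?_)
    rw [ENNReal.ofReal_rpow_of_pos (by positivity), ← Real.rpow_mul (by positivity),
      inv_mul_cancel₀ ha0.ne', Real.rpow_one]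
  refine (mul_le_mul' h1 h2).trans (le_of_eq ?_)
  rw [← ENNReal.ofReal_mul hD.le, mul_div_cancel₀ _ hD.ne']

end BoundedConvergence

/-! ### Test functions and their gradients. -/

section TestFunctions

variable {n : ℕ} {Ω : Set (Eucl n)} {φ ψ : Eucl n → ℝ}

theorem gradient_inner_eq_fderiv (f : Eucl n → ℝ) (x ξ : Eucl n) :
    inner ℝ (gradient f x) ξ = fderiv ℝ f x ξ := by
  simp [gradient, InnerProductSpace.toDual_symm_apply]

theorem gradient_apply_eq_fderiv (f : Eucl n → ℝ) (x : Eucl n) (i : Fin n) :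
    gradient f x i = fderiv ℝ f x (EuclideanSpace.single i 1) := by
  rw [← gradient_inner_eq_fderiv, EuclideanSpace.inner_single_right]
  simp

theorem norm_gradient_eq (f : Eucl n → ℝ) (x : Eucl n) : ‖gradient f x‖ = ‖fderiv ℝ f x‖ := by
  simp [gradient]

theorem IsTestFunction.differentiable (h : IsTestFunction Ω φ) : Differentiable ℝ φ :=
  h.1.differentiable (by simp)

theorem IsTestFunction.continuous_gradient (h : IsTestFunction Ω φ) : Continuous (gradient φ) :=
  (InnerProductSpace.toDual ℝ (Eucl n)).symm.continuous.comp (h.1.continuous_fderiv (by simp))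

theorem IsTestFunction.tsupport_gradient_subset (h : IsTestFunction Ω φ) :
    Function.support (gradient φ) ⊆ Ω := by
  intro x hx
  refine h.2.2 (tsupport_fderiv_subset ℝ (subset_tsupport _ ?_))
  intro h0
  exact hx (by simp [gradient, h0])

theorem IsTestFunction.hasCompactSupport_gradient (h : IsTestFunction Ω φ) :
    HasCompactSupport (gradient φ) :=
  (h.2.1.fderiv ℝ).comp_left (g := (InnerProductSpace.toDual ℝ (Eucl n)).symm) (map_zero _)

theorem IsTestFunction.memLp (h : IsTestFunction Ω φ) (P : ℝ≥0∞) (μ : Measure (Eucl n))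
    [IsFiniteMeasureOnCompacts μ] : MemLp φ P μ :=
  h.1.continuous.memLp_of_hasCompactSupport h.2.1

theorem IsTestFunction.memLp_gradient (h : IsTestFunction Ω φ) (P : ℝ≥0∞) (μ : Measure (Eucl n))
    [IsFiniteMeasureOnCompacts μ] : MemLp (gradient φ) P μ :=
  h.continuous_gradient.memLp_of_hasCompactSupport h.hasCompactSupport_gradient

theorem IsTestFunction.zero : IsTestFunction Ω (0 : Eucl n → ℝ) :=
  ⟨contDiff_const, HasCompactSupport.zero, by simp [tsupport]⟩

theorem IsTestFunction.comp (h : IsTestFunction Ω φ) {T : ℝ → ℝ} (hT : ContDiff ℝ ∞ T)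
    (h0 : T 0 = 0) : IsTestFunction Ω (T ∘ φ) :=
  ⟨hT.comp h.1, h.2.1.comp_left h0, (closure_mono (Function.support_comp_subset h0 φ)).trans h.2.2⟩

theorem IsTestFunction.add (h : IsTestFunction Ω φ) (h' : IsTestFunction Ω ψ) :
    IsTestFunction Ω (φ + ψ) :=
  ⟨h.1.add h'.1, h.2.1.add h'.2.1,
    (tsupport_add φ ψ).trans (Set.union_subset h.2.2 h'.2.2)⟩

theorem IsTestFunction.smul (h : IsTestFunction Ω φ) (c : ℝ) : IsTestFunction Ω (c • φ) :=
  h.comp (T := fun s => c * s) (contDiff_const.mul contDiff_id) (mul_zero c)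

theorem gradient_add_apply (h : Differentiable ℝ φ) (h' : Differentiable ℝ ψ) (x : Eucl n) :
    gradient (φ + ψ) x = gradient φ x + gradient ψ x := by
  simp [gradient, fderiv_add (h x) (h' x)]

theorem gradient_smul_apply (h : Differentiable ℝ φ) (c : ℝ) (x : Eucl n) :
    gradient (c • φ) x = c • gradient φ x := by
  simp [gradient, fderiv_const_smul (h x)]

theorem gradient_comp_apply (h : Differentiable ℝ φ) {T T' : ℝ → ℝ}
    (hT : ∀ s, HasDerivAt T (T' s) s) (x : Eucl n) :
    gradient (T ∘ φ) x = T' (φ x) • gradient φ x := by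
  have := ((hT (φ x)).comp_hasFDerivAt x (h x).hasFDerivAt).fderiv
  simp [gradient, this]

end TestFunctions

/-! ### The space `W₀^{1,p}(Ω)` as a space of pairs. -/

/-- Pairs of a function and a vector field in `L^p(Ω)`. -/
abbrev LpPair {n : ℕ} (Ω : Set (Eucl n)) (p : ℝ) : Type :=
  Lp ℝ (ENNReal.ofReal p) (volume.restrict Ω) × Lp (Eucl n) (ENNReal.ofReal p) (volume.restrict Ω)

/-- The pairs `(φ, ∇φ)` with `φ ∈ C_c^∞(Ω)`. -/
noncomputable def testPairs {n : ℕ} (Ω : Set (Eucl n)) (p : ℝ) : Submodule ℝ (LpPair Ω p) where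
  carrier := {w | ∃ φ, IsTestFunction Ω φ ∧ w.1 =ᵐ[volume.restrict Ω] φ ∧
    w.2 =ᵐ[volume.restrict Ω] gradient φ}
  zero_mem' := ⟨0, IsTestFunction.zero, Lp.coeFn_zero _ _ _, by
    filter_upwards [Lp.coeFn_zero (Eucl n) (ENNReal.ofReal p) (volume.restrict Ω)] with x hx
    rw [Prod.snd_zero, hx]
    simp [gradient]⟩
  add_mem' := by
    rintro w z ⟨φ, hφ, h1, h2⟩ ⟨ψ, hψ, h3, h4⟩
    refine ⟨φ + ψ, hφ.add hψ, ?_, ?_⟩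
    · filter_upwards [h1, h3, Lp.coeFn_add w.1 z.1] with x a b c
      rw [Prod.fst_add, c, Pi.add_apply, a, b, Pi.add_apply]
    · filter_upwards [h2, h4, Lp.coeFn_add w.2 z.2] with x a b c
      rw [Prod.snd_add, c, Pi.add_apply, a, b, gradient_add_apply hφ.differentiable hψ.differentiable]
  smul_mem' := by
    rintro c w ⟨φ, hφ, h1, h2⟩
    refine ⟨c • φ, hφ.smul c, ?_, ?_⟩
    · filter_upwards [h1, Lp.coeFn_smul c w.1] with x a b
      rw [Prod.smul_fst, b, Pi.smul_apply, a, Pi.smul_apply]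
    · filter_upwards [h2, Lp.coeFn_smul c w.2] with x a b
      rw [Prod.smul_snd, b, Pi.smul_apply, a, gradient_smul_apply hφ.differentiable]

/-- The class of the pair `(φ, ∇φ)` of a test function. -/
noncomputable def IsTestFunction.toPair {n : ℕ} {Ω : Set (Eucl n)}
    {φ : Eucl n → ℝ} (h : IsTestFunction Ω φ) (p : ℝ) :
    LpPair Ω p :=
  ((h.memLp (ENNReal.ofReal p) (volume.restrict Ω)).toLp φ,
    (h.memLp_gradient (ENNReal.ofReal p) (volume.restrict Ω)).toLp (gradient φ))

theorem IsTestFunction.toPair_mem {n : ℕ} {Ω : Set (Eucl n)}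
    {φ : Eucl n → ℝ} (h : IsTestFunction Ω φ) (p : ℝ) :
    h.toPair p ∈ testPairs Ω p :=
  ⟨φ, h, (h.memLp (ENNReal.ofReal p) (volume.restrict Ω)).coeFn_toLp,
    (h.memLp_gradient (ENNReal.ofReal p) (volume.restrict Ω)).coeFn_toLp⟩

/-- The space `W₀^{1,p}(Ω)`, as a closed space of pairs `(u, ∇u)`. -/
noncomputable def sobolevZero {n : ℕ} (Ω : Set (Eucl n)) (p : ℝ) [Fact (1 ≤ ENNReal.ofReal p)] :
    Submodule ℝ (LpPair Ω p) :=
  (testPairs Ω p).topologicalClosure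

/-! ### The Sobolev inequality and integration by parts for test functions. -/

section Preliminaries

variable {n : ℕ} {Ω : Set (Eucl n)} {p : ℝ}

/-- The Gagliardo–Nirenberg–Sobolev inequality on a bounded set. The case `q = p` is a Poincaré
inequality and `q = critExp n p` is the critical embedding. -/
theorem eLpNorm_le_eLpNorm_gradient (hΩb : Bornology.IsBounded Ω) (hp : 1 < p) (hpn : p < n)
    {q : ℝ} (hq1 : 1 ≤ q) (hq : q ≤ critExp n p) :
    ∃ C : ℝ, 0 < C ∧ ∀ φ : Eucl n → ℝ, IsTestFunction Ω φ →
      eLpNorm φ (ENNReal.ofReal q) (volume.restrict Ω) ≤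
        ENNReal.ofReal C * eLpNorm (gradient φ) (ENNReal.ofReal p) (volume.restrict Ω) := by
  have hp0 : 0 < p := by linarith
  have hn0 : (0 : ℝ) < n := hp0.trans hpn
  set K := eLpNormLESNormFDerivOfLeConst ℝ (volume : Measure (Eucl n)) Ω p.toNNReal q.toNNReal
  refine ⟨K + 1, by positivity, fun φ hφ => ?_⟩
  have hsupp : Function.support φ ⊆ Ω := (subset_tsupport φ).trans hφ.2.2
  rw [eLpNorm_restrict_eq_of_support_subset hsupp,
    eLpNorm_restrict_eq_of_support_subset hφ.tsupport_gradient_subset]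
  have h := eLpNorm_le_eLpNorm_fderiv_of_le (F := ℝ) (volume : Measure (Eucl n)) (u := φ) (s := Ω)
    (p := p.toNNReal) (q := q.toNNReal) (hφ.1.of_le (by simp)) hsupp
    (by simpa using hp.le) ?_ ?_ hΩb
  · have hg : eLpNorm (fderiv ℝ φ) (ENNReal.ofReal p) volume =
        eLpNorm (gradient φ) (ENNReal.ofReal p) volume :=
      eLpNorm_congr_norm_ae (ae_of_all _ fun x => (norm_gradient_eq φ x).symm)
    refine h.trans ?_
    change _ * eLpNorm (fderiv ℝ φ) (ENNReal.ofReal p) volume ≤ _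
    rw [hg]
    gcongr
    rw [← ENNReal.ofReal_coe_nnreal]
    exact ENNReal.ofReal_le_ofReal (by linarith)
  · rw [finrank_euclideanSpace_fin, ← NNReal.coe_lt_coe, Real.coe_toNNReal _ hp0.le]
    simpa using hpn
  · rw [finrank_euclideanSpace_fin, Real.coe_toNNReal _ (by linarith), NNReal.coe_inv,
      Real.coe_toNNReal _ hp0.le]
    have h1 : (critExp n p)⁻¹ = p⁻¹ - (n : ℝ)⁻¹ := by
      have : (n : ℝ) - p ≠ 0 := by linarith
      simp only [critExp]
      field_simp
    rw [← h1]
    exact inv_anti₀ (by linarith) hq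

theorem IsTestFunction.integral_mul_gradient {φ ψ : Eucl n → ℝ} (hφ : IsTestFunction Ω φ)
    (hψ : IsTestFunction Ω ψ) (i : Fin n) :
    ∫ x in Ω, φ x * gradient ψ x i = - ∫ x in Ω, gradient φ x i * ψ x := by
  have hcf : ∀ {η : Eucl n → ℝ}, IsTestFunction Ω η → Continuous fun x => gradient η x i :=
    fun h => (EuclideanSpace.proj (𝕜 := ℝ) i).continuous.comp h.continuous_gradient
  rw [setIntegral_eq_integral_of_forall_compl_eq_zero, setIntegral_eq_integral_of_forall_compl_eq_zero]
  · simp only [gradient_apply_eq_fderiv] at hcf ⊢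
    refine integral_mul_fderiv_eq_neg_fderiv_mul_of_integrable ?_ ?_ ?_
      (fun x _ => hφ.differentiable x) (fun x _ => hψ.differentiable x)
    · exact ((hcf hφ).mul hψ.1.continuous).integrable_of_hasCompactSupport hψ.2.1.mul_left
    · exact (hφ.1.continuous.mul (hcf hψ)).integrable_of_hasCompactSupport hφ.2.1.mul_right
    · exact (hφ.1.continuous.mul hψ.1.continuous).integrable_of_hasCompactSupport hφ.2.1.mul_right
  · intro x hx
    rw [image_eq_zero_of_notMem_tsupport fun h => hx (hψ.2.2 h), mul_zero]
  · intro x hx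
    rw [image_eq_zero_of_notMem_tsupport fun h => hx (hφ.2.2 h), zero_mul]

theorem tendsto_integral_mul_of_tendsto_eLpNorm {X : Type*} [MeasurableSpace X] {μ : Measure X}
    [IsFiniteMeasure μ] {P : ℝ≥0∞} (hP : 1 ≤ P) {f : ℕ → X → ℝ} {g h : X → ℝ}
    (hf : ∀ k, MemLp (f k) P μ) (hg : MemLp g P μ)
    (hlim : Tendsto (fun k => eLpNorm (fun x => f k x - g x) P μ) atTop (𝓝 0))
    (hh : MemLp h ∞ μ) :
    Tendsto (fun k => ∫ x, f k x * h x ∂μ) atTop (𝓝 (∫ x, g x * h x ∂μ)) := by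
  have hi : ∀ {u : X → ℝ}, MemLp u P μ → Integrable (fun x => u x * h x) μ := fun hu =>
    (hu.integrable hP).mul_of_top_left hh
  refine tendsto_integral_of_L1' _ (hi hg).1 (Eventually.of_forall fun k => hi (hf k)) ?_
  have h1 : Tendsto (fun k => eLpNorm (fun x => f k x - g x) P μ *
      μ Set.univ ^ (1 / (1 : ℝ≥0∞).toReal - 1 / P.toReal) * eLpNorm h ∞ μ) atTop (𝓝 0) := by
    have := ENNReal.Tendsto.mul_const (ENNReal.Tendsto.mul_const hlim
      (b := μ Set.univ ^ (1 / (1 : ℝ≥0∞).toReal - 1 / P.toReal)) (Or.inr ?_))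
      (b := eLpNorm h ∞ μ) (Or.inr hh.eLpNorm_ne_top)
    · simpa using this
    · refine ENNReal.rpow_ne_top_of_nonneg ?_ (measure_ne_top _ _)
      rw [ENNReal.toReal_one, sub_nonneg, div_one]
      by_cases hPt : P = ⊤
      · simp [hPt]
      · rw [div_le_one]
        · exact (ENNReal.toReal_mono hPt hP)
        · exact ENNReal.toReal_pos (by positivity) hPt
  refine tendsto_of_tendsto_of_tendsto_of_le_of_le tendsto_const_nhds h1 (fun _ => zero_le) fun k => ?_
  have h2 : ((fun x => f k x * h x) - fun x => g x * h x) = (fun x => f k x - g x) • h := by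
    ext x; simp [sub_mul]
  dsimp only
  rw [h2]
  refine (eLpNorm_smul_le_mul_eLpNorm (p := 1) (q := ∞) (r := 1) hh.1 ((hf k).1.sub hg.1)).trans ?_
  gcongr
  exact eLpNorm_le_eLpNorm_mul_rpow_measure_univ hP ((hf k).1.sub hg.1)

theorem IsW0.congr {u u' : Eucl n → ℝ} {v v' : Eucl n → Eucl n} (h : IsW0 Ω p u v)
    (hu : u =ᵐ[volume.restrict Ω] u') (hv : v =ᵐ[volume.restrict Ω] v') : IsW0 Ω p u' v' := by
  refine ⟨h.memLp.ae_eq hu, h.memLp_grad.ae_eq hv, fun φ hφ i => ?_, ?_⟩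
  · have := h.weakGradient φ hφ i
    rwa [integral_congr_ae (g := fun x => u' x * gradient φ x i)
      (by filter_upwards [hu] with x hx; rw [hx]),
      integral_congr_ae (f := fun x => v x i * φ x) (g := fun x => v' x i * φ x)
      (by filter_upwards [hv] with x hx; rw [hx])] at this
  · obtain ⟨φ, hφ, h1, h2⟩ := h.approx
    refine ⟨φ, hφ, h1.congr fun k => eLpNorm_congr_ae ?_, h2.congr fun k => eLpNorm_congr_ae ?_⟩
    · filter_upwards [hu] with x hx; rw [hx]
    · filter_upwards [hv] with x hx; rw [hx]

theorem exists_subseq_tendsto_ae_of_tendsto {V : Type*} [NormedAddCommGroup V]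
    {X : Type*} [MeasurableSpace X] {μ : Measure X} {P : ℝ≥0∞} [Fact (1 ≤ P)]
    {f : ℕ → Lp V P μ} {g : Lp V P μ} (h : Tendsto f atTop (𝓝 g)) :
    ∃ σ : ℕ → ℕ, StrictMono σ ∧ ∀ᵐ x ∂μ, Tendsto (fun k => f (σ k) x) atTop (𝓝 (g x)) :=
  (tendstoInMeasure_of_tendsto_Lp h).exists_seq_tendsto_ae

end Preliminaries

/-! ### Closedness, chain rule and embeddings for `W₀^{1,p}(Ω)`. -/

section Sobolev

variable {n : ℕ} {Ω : Set (Eucl n)} {p : ℝ} [Fact (1 ≤ ENNReal.ofReal p)]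

theorem isClosed_sobolevZero : IsClosed (sobolevZero Ω p : Set (LpPair Ω p)) :=
  Submodule.isClosed_topologicalClosure _

instance : CompleteSpace (sobolevZero Ω p) :=
  isClosed_sobolevZero.completeSpace_coe

theorem mem_sobolevZero_iff_seq {w : LpPair Ω p} : w ∈ sobolevZero Ω p ↔
    ∃ z : ℕ → LpPair Ω p, (∀ k, z k ∈ testPairs Ω p) ∧ Tendsto z atTop (𝓝 w) := by
  rw [sobolevZero, ← SetLike.mem_coe, Submodule.topologicalClosure_coe, mem_closure_iff_seq_limit]
  rfl

theorem testPairs_le_sobolevZero : testPairs Ω p ≤ sobolevZero Ω p :=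
  Submodule.le_topologicalClosure _

/-- `W₀^{1,p}` contains the limits of its sequences whose functions converge in `L^p` and whose
gradients are bounded in `L^p` and converge a.e. -/
theorem mem_sobolevZero_of_tendsto_ae [IsFiniteMeasure (volume.restrict Ω)] (hp : 1 < p) {C : ℝ}
    {w : ℕ → LpPair Ω p} {u : LpPair Ω p} (hw : ∀ k, w k ∈ sobolevZero Ω p)
    (hC : ∀ k, ‖(w k).2‖ ≤ C) (h1 : Tendsto (fun k => (w k).1) atTop (𝓝 u.1))
    (h2 : ∀ᵐ x ∂(volume.restrict Ω), Tendsto (fun k => (w k).2 x) atTop (𝓝 (u.2 x))) :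
    u ∈ sobolevZero Ω p := by
  rw [← SetLike.mem_coe, ← isClosed_sobolevZero.closure_eq, Metric.mem_closure_iff]
  intro ε hε
  obtain ⟨M, hM⟩ := Metric.tendsto_atTop.1 h1 (ε / 2) (half_pos hε)
  -- Averages of the gradients converge strongly, and the same averages of the functions stay close
  -- to `u.1` because all indices are at least `M`. This replaces Mazur's lemma.
  obtain ⟨s, hs, hsM, hlt⟩ := exists_average_close hp hC h2 hε M
  have hc : (0 : ℝ) < s.card := by exact_mod_cast hs.card_pos
  refine ⟨(s.card : ℝ)⁻¹ • ∑ i ∈ s, w i, Submodule.smul_mem _ _ (Submodule.sum_mem _ fun i _ => hw i), ?_⟩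
  rw [dist_comm, Prod.dist_eq, max_lt_iff]
  constructor
  · rw [Prod.smul_fst, Prod.fst_sum, dist_eq_norm]
    have heq : (s.card : ℝ)⁻¹ • ∑ i ∈ s, (w i).1 - u.1 = (s.card : ℝ)⁻¹ • ∑ i ∈ s, ((w i).1 - u.1) := by
      rw [Finset.sum_sub_distrib, Finset.sum_const, smul_sub, ← Nat.cast_smul_eq_nsmul ℝ,
        inv_smul_smul₀ hc.ne']
    rw [heq, norm_smul, norm_inv, Real.norm_natCast, inv_mul_lt_iff₀ hc]
    refine (norm_sum_le_of_le s (f := fun i => (w i).1 - u.1) (n := fun _ => ε / 2) fun i hi => ?_).trans_lt ?_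
    · rw [← dist_eq_norm]; exact (hM i (hsM i hi)).le
    · rw [Finset.sum_const, nsmul_eq_mul]
      nlinarith
  · rw [Prod.smul_snd, Prod.snd_sum, dist_eq_norm]
    exact hlt

/-- Composition with a smooth function `T` with `T 0 = 0` and bounded derivative acts on
`W₀^{1,p}`, and the chain rule holds. -/
theorem exists_comp_mem_sobolevZero [IsFiniteMeasure (volume.restrict Ω)] (hp : 1 < p)
    {T T' : ℝ → ℝ} (hT : ContDiff ℝ ∞ T) (h0 : T 0 = 0) (hT' : ∀ s, HasDerivAt T (T' s) s)
    (hb : ∀ s, |T' s| ≤ 1) {w : LpPair Ω p} (hw : w ∈ sobolevZero Ω p) :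
    ∃ z ∈ sobolevZero Ω p, (z.1 =ᵐ[volume.restrict Ω] fun x => T (w.1 x)) ∧
      (z.2 =ᵐ[volume.restrict Ω] fun x => T' (w.1 x) • w.2 x) ∧ ‖z‖ ≤ ‖w‖ := by
  have hT'c : Continuous T' := by
    have : T' = deriv T := funext fun s => (hT' s).deriv.symm
    rw [this]
    exact hT.continuous_deriv (by simp)
  have hlip : ∀ a b, |T a - T b| ≤ |a - b| := fun a b => by
    have := convex_univ.norm_image_sub_le_of_norm_hasDerivWithin_le (C := 1)
      (fun x _ => (hT' x).hasDerivWithinAt) (fun x _ => hb x) (Set.mem_univ b) (Set.mem_univ a)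
    simpa using this
  obtain ⟨z, hz, hzlim⟩ := mem_sobolevZero_iff_seq.1 hw
  have hz1 : Tendsto (fun k => (z k).1) atTop (𝓝 w.1) := (Prod.tendsto_iff _ _).1 hzlim |>.1
  have hz2 : Tendsto (fun k => (z k).2) atTop (𝓝 w.2) := (Prod.tendsto_iff _ _).1 hzlim |>.2
  obtain ⟨σ, hσ, hσ1⟩ := exists_subseq_tendsto_ae_of_tendsto hz1
  obtain ⟨τ, hτ, hτ2⟩ := exists_subseq_tendsto_ae_of_tendsto (hz2.comp hσ.tendsto_atTop)
  have hz1' : Tendsto (fun k => (z (σ (τ k))).1) atTop (𝓝 w.1) :=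
    hz1.comp (hσ.comp hτ).tendsto_atTop
  choose φ hφ hφ1 hφ2 using hz
  have hTm : MemLp (fun x => T (w.1 x)) (ENNReal.ofReal p) (volume.restrict Ω) := by
    refine (Lp.memLp w.1).of_le (hT.continuous.comp_aestronglyMeasurable (Lp.memLp w.1).1)
      (ae_of_all _ fun x => ?_)
    simpa [h0] using hlip (w.1 x) 0
  have hGm : MemLp (fun x => T' (w.1 x) • w.2 x) (ENNReal.ofReal p) (volume.restrict Ω) := by
    refine (Lp.memLp w.2).of_le ((hT'c.comp_aestronglyMeasurable (Lp.memLp w.1).1).smul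
      (Lp.memLp w.2).1) (ae_of_all _ fun x => ?_)
    rw [norm_smul]
    exact mul_le_of_le_one_left (norm_nonneg _) (hb _)
  refine ⟨(hTm.toLp _, hGm.toLp _), ?_, hTm.coeFn_toLp, hGm.coeFn_toLp, max_le_max
    (Lp.norm_le_norm_of_ae_le ?_) (Lp.norm_le_norm_of_ae_le ?_)⟩
  rotate_left
  · filter_upwards [hTm.coeFn_toLp] with x hx
    rw [hx]
    simpa [h0] using hlip (w.1 x) 0
  · filter_upwards [hGm.coeFn_toLp] with x hx
    rw [hx, norm_smul]
    exact mul_le_of_le_one_left (norm_nonneg _) (hb _)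
  obtain ⟨C, hC⟩ := (hz2.norm.comp (hσ.comp hτ).tendsto_atTop).bddAbove_range
  have hTφ : ∀ k, IsTestFunction Ω (T ∘ φ k) := fun k => (hφ k).comp hT h0
  -- The approximants `T ∘ φ` have gradients `T'(φ) ∇φ`, bounded in `L^p` and a.e. convergent along
  -- the subsequence; strong convergence of the gradients is not needed.
  refine mem_sobolevZero_of_tendsto_ae hp (C := C)
    (w := fun k => (hTφ (σ (τ k))).toPair p)
    (fun k => testPairs_le_sobolevZero (IsTestFunction.toPair_mem _ _)) (fun k => ?_) ?_ ?_
  · refine le_trans ?_ (hC ⟨k, rfl⟩)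
    refine Lp.norm_le_norm_of_ae_le ?_
    filter_upwards [((hTφ (σ (τ k))).memLp_gradient (ENNReal.ofReal p)
      (volume.restrict Ω)).coeFn_toLp, hφ2 (σ (τ k))] with x hx hx2
    simp only [IsTestFunction.toPair, Function.comp_apply]
    rw [hx, hx2, gradient_comp_apply (hφ _).differentiable hT', norm_smul]
    exact mul_le_of_le_one_left (norm_nonneg _) (hb _)
  · rw [tendsto_iff_norm_sub_tendsto_zero] at hz1' ⊢
    refine squeeze_zero (fun _ => norm_nonneg _) (fun k => ?_) hz1'
    refine Lp.norm_le_norm_of_ae_le ?_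
    filter_upwards [((hTφ (σ (τ k))).memLp (ENNReal.ofReal p) (volume.restrict Ω)).coeFn_toLp,
      hφ1 (σ (τ k)), hTm.coeFn_toLp, Lp.coeFn_sub (z (σ (τ k))).1 w.1,
      Lp.coeFn_sub ((hTφ (σ (τ k))).toPair p).1 (hTm.toLp _)] with x a b c e f
    rw [e, f, Pi.sub_apply, Pi.sub_apply, c]
    simp only [IsTestFunction.toPair]
    rw [a, b]
    exact hlip _ _
  · have hall : ∀ᵐ x ∂(volume.restrict Ω), ∀ k, ((hTφ (σ (τ k))).toPair p).2 x =
        T' ((z (σ (τ k))).1 x) • (z (σ (τ k))).2 x := by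
      refine ae_all_iff.2 fun k => ?_
      filter_upwards [((hTφ (σ (τ k))).memLp_gradient (ENNReal.ofReal p)
        (volume.restrict Ω)).coeFn_toLp, hφ2 (σ (τ k)), hφ1 (σ (τ k))] with x hx hx2 hx1
      simp only [IsTestFunction.toPair]
      rw [hx, hx2, hx1, gradient_comp_apply (hφ _).differentiable hT']
    filter_upwards [hall, hσ1, hτ2, hGm.coeFn_toLp] with x hx hx1 hx2 hx3
    simp only [hx, hx3]
    exact ((hT'c.tendsto _).comp (hx1.comp hτ.tendsto_atTop)).smul hx2

/-- Passes from test functions to the closure by Fatou's lemma along an a.e. convergent subsequence.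
-/
theorem eLpNorm_le_norm_snd (hΩb : Bornology.IsBounded Ω) (hp : 1 < p) (hpn : p < n)
    {q : ℝ} (hq1 : 1 ≤ q) (hq : q ≤ critExp n p) :
    ∃ C : ℝ, 0 < C ∧ ∀ w : LpPair Ω p, w ∈ sobolevZero Ω p →
      MemLp w.1 (ENNReal.ofReal q) (volume.restrict Ω) ∧
      eLpNorm w.1 (ENNReal.ofReal q) (volume.restrict Ω) ≤ ENNReal.ofReal (C * ‖w.2‖) := by
  obtain ⟨C, hC, hS⟩ := eLpNorm_le_eLpNorm_gradient hΩb hp hpn hq1 hq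
  refine ⟨C, hC, fun w hw => ?_⟩
  obtain ⟨z, hz, hzlim⟩ := mem_sobolevZero_iff_seq.1 hw
  obtain ⟨hz1, hz2⟩ := (Prod.tendsto_iff _ _).1 hzlim
  obtain ⟨σ, hσ, hσ1⟩ := exists_subseq_tendsto_ae_of_tendsto hz1
  have hzb : ∀ k, eLpNorm (z k).1 (ENNReal.ofReal q) (volume.restrict Ω) ≤
      ENNReal.ofReal (C * ‖(z k).2‖) := by
    intro k
    obtain ⟨φ, hφ, h1, h2⟩ := hz k
    rw [eLpNorm_congr_ae h1, ENNReal.ofReal_mul hC.le, Lp.norm_def, eLpNorm_congr_ae h2,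
      ENNReal.ofReal_toReal (hφ.memLp_gradient _ _).eLpNorm_ne_top]
    exact hS φ hφ
  have h := (Lp.eLpNorm_lim_le_liminf_eLpNorm (p := ENNReal.ofReal q)
    (fun k => (Lp.memLp (z (σ k)).1).1) w.1 hσ1).trans
    ((liminf_le_liminf (Eventually.of_forall fun k => hzb (σ k))).trans
      (ENNReal.tendsto_ofReal ((hz2.norm.const_mul C).comp hσ.tendsto_atTop)).liminf_eq.le)
  exact ⟨⟨(Lp.memLp w.1).1, h.trans_lt ENNReal.ofReal_lt_top⟩, h⟩

theorem isWeakGradient_of_mem_sobolevZero [IsFiniteMeasure (volume.restrict Ω)]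
    {w : LpPair Ω p} (hw : w ∈ sobolevZero Ω p) : IsWeakGradient Ω w.1 w.2 := by
  intro ψ hψ i
  have hP : (1 : ℝ≥0∞) ≤ ENNReal.ofReal p := Fact.out
  obtain ⟨z, hz, hzlim⟩ := mem_sobolevZero_iff_seq.1 hw
  obtain ⟨hz1, hz2⟩ := (Prod.tendsto_iff _ _).1 hzlim
  have hgi : MemLp (fun x => gradient ψ x i) ∞ (volume.restrict Ω) :=
    (EuclideanSpace.proj (𝕜 := ℝ) i).comp_memLp' (hψ.memLp_gradient ∞ _)
  have hci : ∀ v : Lp (Eucl n) (ENNReal.ofReal p) (volume.restrict Ω),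
      MemLp (fun x => v x i) (ENNReal.ofReal p) (volume.restrict Ω) := fun v =>
    (EuclideanSpace.proj (𝕜 := ℝ) i).comp_memLp' (Lp.memLp v)
  have t1 := tendsto_integral_mul_of_tendsto_eLpNorm hP (fun k => Lp.memLp (z k).1)
    (Lp.memLp w.1) ((Lp.tendsto_Lp_iff_tendsto_eLpNorm' _ _).1 hz1) hgi
  have t2 := tendsto_integral_mul_of_tendsto_eLpNorm hP (fun k => hci (z k).2) (hci w.2)
    (h := ψ) ?_ (hψ.memLp ∞ _)
  · refine tendsto_nhds_unique t1 (t2.neg.congr fun k => ?_)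
    obtain ⟨φ, hφ, h1, h2⟩ := hz k
    have e1 : ∫ x in Ω, (z k).1 x * gradient ψ x i = ∫ x in Ω, φ x * gradient ψ x i :=
      integral_congr_ae (by filter_upwards [h1] with x hx; rw [hx])
    have e2 : ∫ x in Ω, (z k).2 x i * ψ x = ∫ x in Ω, gradient φ x i * ψ x :=
      integral_congr_ae (by filter_upwards [h2] with x hx; rw [hx])
    rw [e1, e2, hφ.integral_mul_gradient hψ]
  · refine tendsto_of_tendsto_of_tendsto_of_le_of_le tendsto_const_nhds
      ((Lp.tendsto_Lp_iff_tendsto_eLpNorm' _ _).1 hz2) (fun _ => zero_le) fun k => ?_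
    refine eLpNorm_mono fun x => ?_
    exact PiLp.norm_apply_le ((z k).2 x - w.2 x) i

/-- Together with `IsW0.exists_mem_sobolevZero`, this translates between `IsW0` and the complete
normed space `sobolevZero` in which the variational argument runs. -/
theorem isW0_of_mem_sobolevZero [IsFiniteMeasure (volume.restrict Ω)] {w : LpPair Ω p}
    (hw : w ∈ sobolevZero Ω p) : IsW0 Ω p w.1 w.2 := by
  refine ⟨Lp.memLp _, Lp.memLp _, isWeakGradient_of_mem_sobolevZero hw, ?_⟩
  obtain ⟨z, hz, hzlim⟩ := mem_sobolevZero_iff_seq.1 hw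
  obtain ⟨hz1, hz2⟩ := (Prod.tendsto_iff _ _).1 hzlim
  choose φ hφ h1 h2 using hz
  refine ⟨φ, hφ, ?_, ?_⟩
  · refine ((Lp.tendsto_Lp_iff_tendsto_eLpNorm' _ _).1 hz1).congr fun k => eLpNorm_congr_ae ?_
    filter_upwards [h1 k] with x hx
    rw [Pi.sub_apply, hx]
  · refine ((Lp.tendsto_Lp_iff_tendsto_eLpNorm' _ _).1 hz2).congr fun k => eLpNorm_congr_ae ?_
    filter_upwards [h2 k] with x hx
    rw [Pi.sub_apply, hx]

theorem IsW0.exists_mem_sobolevZero {u : Eucl n → ℝ} {v : Eucl n → Eucl n} (h : IsW0 Ω p u v) :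
    ∃ w ∈ sobolevZero Ω p, w.1 =ᵐ[volume.restrict Ω] u ∧ w.2 =ᵐ[volume.restrict Ω] v := by
  obtain ⟨φ, hφ, h1, h2⟩ := h.approx
  refine ⟨(h.memLp.toLp u, h.memLp_grad.toLp v), ?_, h.memLp.coeFn_toLp, h.memLp_grad.coeFn_toLp⟩
  refine mem_sobolevZero_iff_seq.2 ⟨fun k => (hφ k).toPair p, fun k => (hφ k).toPair_mem p, ?_⟩
  rw [Prod.tendsto_iff]
  constructor
  · exact (Lp.tendsto_Lp_iff_tendsto_eLpNorm'' _ (fun k => (hφ k).memLp _ _) _ h.memLp).2 h1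
  · exact (Lp.tendsto_Lp_iff_tendsto_eLpNorm'' _ (fun k => (hφ k).memLp_gradient _ _) _
      h.memLp_grad).2 h2

end Sobolev

/-! ### The Rellich–Kondrachov theorem by ball averages. -/

section Rellich

variable {n : ℕ} {Ω : Set (Eucl n)}

/-- Fundamental theorem of calculus along the segment from `x` to `x + h`, then Tonelli and
translation invariance. -/
theorem lintegral_enorm_translate_sub_le {φ : Eucl n → ℝ} (hφ : ContDiff ℝ 1 φ) (h : Eucl n) :
    ∫⁻ x, ‖φ (x + h) - φ x‖ₑ ≤ ‖h‖ₑ * ∫⁻ x, ‖fderiv ℝ φ x‖ₑ := by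
  have hc : Continuous (fderiv ℝ φ) := hφ.continuous_fderiv one_ne_zero
  have hpt : ∀ x, ‖φ (x + h) - φ x‖ₑ ≤
      ∫⁻ t in Set.Ioc (0 : ℝ) 1, ‖fderiv ℝ φ (x + t • h)‖ₑ * ‖h‖ₑ := by
    intro x
    have hd : ∀ t ∈ Set.uIcc (0 : ℝ) 1,
        HasDerivAt (fun t : ℝ => φ (x + t • h)) (fderiv ℝ φ (x + t • h) h) t := by
      intro t _
      have h1 : HasDerivAt (fun t : ℝ => x + t • h) h t := by
        simpa using ((hasDerivAt_id t).smul_const h).const_add x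
      exact ((hφ.differentiable one_ne_zero _).hasFDerivAt).comp_hasDerivAt t h1
    have hcont : Continuous fun t : ℝ => fderiv ℝ φ (x + t • h) h :=
      (hc.comp (by fun_prop)).clm_apply continuous_const
    have hftc := intervalIntegral.integral_eq_sub_of_hasDerivAt hd (hcont.intervalIntegrable 0 1)
    simp only [one_smul, zero_smul, add_zero] at hftc
    rw [← hftc, intervalIntegral.integral_of_le zero_le_one]
    refine (enorm_integral_le_lintegral_enorm _).trans (lintegral_mono fun t => ?_)
    exact ContinuousLinearMap.le_opENorm _ _
  have hm : Measurable (fun z : Eucl n × ℝ => ‖fderiv ℝ φ (z.1 + z.2 • h)‖ₑ * ‖h‖ₑ) :=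
    ((hc.comp (by fun_prop : Continuous fun z : Eucl n × ℝ => z.1 + z.2 • h)).enorm.measurable).mul_const _
  calc ∫⁻ x, ‖φ (x + h) - φ x‖ₑ
      ≤ ∫⁻ x, ∫⁻ t in Set.Ioc (0 : ℝ) 1, ‖fderiv ℝ φ (x + t • h)‖ₑ * ‖h‖ₑ := lintegral_mono hpt
    _ = ∫⁻ t in Set.Ioc (0 : ℝ) 1, ∫⁻ x, ‖fderiv ℝ φ (x + t • h)‖ₑ * ‖h‖ₑ :=
        lintegral_lintegral_swap hm.aemeasurable
    _ = ∫⁻ t in Set.Ioc (0 : ℝ) 1, ‖h‖ₑ * ∫⁻ x, ‖fderiv ℝ φ x‖ₑ := by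
        refine lintegral_congr fun t => ?_
        rw [lintegral_mul_const _ (by fun_prop : Measurable fun x => ‖fderiv ℝ φ (x + t • h)‖ₑ),
          lintegral_add_right_eq_self (fun x => ‖fderiv ℝ φ x‖ₑ), mul_comm]
    _ = ‖h‖ₑ * ∫⁻ x, ‖fderiv ℝ φ x‖ₑ := by simp

/-- The uniform probability measure on a ball around the origin. -/
noncomputable def ballMeasure (n : ℕ) (r : ℝ) : Measure (Eucl n) :=
  (volume (Metric.ball (0 : Eucl n) r))⁻¹ • volume.restrict (Metric.ball 0 r)

variable {r : ℝ}

theorem isProbabilityMeasure_ballMeasure (hr : 0 < r) : IsProbabilityMeasure (ballMeasure n r) := by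
  refine ⟨?_⟩
  rw [ballMeasure, Measure.smul_apply, Measure.restrict_apply_univ, smul_eq_mul]
  exact ENNReal.inv_mul_cancel (Metric.measure_ball_pos _ _ hr).ne' measure_ball_lt_top.ne

theorem lintegral_ballMeasure_le (f : Eucl n → ℝ≥0∞) :
    ∫⁻ z, f z ∂(ballMeasure n r) ≤ (volume (Metric.ball (0 : Eucl n) r))⁻¹ * ∫⁻ z, f z := by
  rw [ballMeasure, lintegral_smul_measure, smul_eq_mul]
  gcongr
  exact Measure.restrict_le_self

theorem ae_ballMeasure_norm_le : ∀ᵐ z ∂(ballMeasure n r), ‖z‖ ≤ r := by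
  refine Measure.ae_smul_measure ?_ _
  filter_upwards [ae_restrict_mem measurableSet_ball] with z hz
  simpa using (Metric.mem_ball.1 hz).le

/-- The average of a function over the ball of radius `r` around a point. -/
noncomputable def ballAverage (r : ℝ) (φ : Eucl n → ℝ) (x : Eucl n) : ℝ :=
  ∫ z, φ (x + z) ∂(ballMeasure n r)

theorem integrable_ballMeasure (hr : 0 < r) {f : Eucl n → ℝ} (hf : Continuous f) :
    Integrable f (ballMeasure n r) := by
  refine Integrable.smul_measure ?_ (ENNReal.inv_ne_top.2 (Metric.measure_ball_pos _ _ hr).ne')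
  exact (hf.continuousOn.integrableOn_compact (isCompact_closedBall 0 r)).mono_set
    Metric.ball_subset_closedBall

theorem enorm_ballAverage_le (φ : Eucl n → ℝ) (x : Eucl n) :
    ‖ballAverage r φ x‖ₑ ≤ (volume (Metric.ball (0 : Eucl n) r))⁻¹ * ∫⁻ z, ‖φ z‖ₑ := by
  refine (enorm_integral_le_lintegral_enorm _).trans ((lintegral_ballMeasure_le _).trans ?_)
  refine mul_le_mul_right ?_ _
  exact (lintegral_add_left_eq_self (μ := volume) (fun z => ‖φ z‖ₑ) x).le

/-- For fixed `r`, averages are Lipschitz with a constant controlled by the `L^1` norm of the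
derivative alone. This equicontinuity makes them determined, up to a small error, by finitely many
values. -/
theorem enorm_ballAverage_sub_le (hr : 0 < r) {φ : Eucl n → ℝ} (hφ : ContDiff ℝ 1 φ)
    (x y : Eucl n) : ‖ballAverage r φ x - ballAverage r φ y‖ₑ ≤
      (volume (Metric.ball (0 : Eucl n) r))⁻¹ * (‖x - y‖ₑ * ∫⁻ z, ‖fderiv ℝ φ z‖ₑ) := by
  have hc := hφ.continuous
  rw [ballAverage, ballAverage, ← integral_sub (integrable_ballMeasure hr (by fun_prop))
    (integrable_ballMeasure hr (by fun_prop))]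
  refine (enorm_integral_le_lintegral_enorm _).trans ((lintegral_ballMeasure_le _).trans ?_)
  gcongr
  refine le_trans (le_of_eq ?_) (lintegral_enorm_translate_sub_le hφ (x - y))
  rw [← lintegral_add_right_eq_self (μ := volume) (fun z => ‖φ (z + (x - y)) - φ z‖ₑ) y]
  refine lintegral_congr fun z => ?_
  congr 3
  · abel
  · abel

theorem lintegral_enorm_ballAverage_sub_le (hr : 0 < r) {φ : Eucl n → ℝ} (hφ : ContDiff ℝ 1 φ) :
    ∫⁻ x, ‖ballAverage r φ x - φ x‖ₑ ≤ ENNReal.ofReal r * ∫⁻ z, ‖fderiv ℝ φ z‖ₑ := by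
  have := isProbabilityMeasure_ballMeasure (n := n) hr
  have hc := hφ.continuous
  have hpt : ∀ x, ‖ballAverage r φ x - φ x‖ₑ ≤ ∫⁻ z, ‖φ (x + z) - φ x‖ₑ ∂(ballMeasure n r) := by
    intro x
    have : ballAverage r φ x - φ x = ∫ z, (φ (x + z) - φ x) ∂(ballMeasure n r) := by
      rw [integral_sub (integrable_ballMeasure hr (by fun_prop)) (integrable_const _)]
      simp [ballAverage]
    rw [this]
    exact enorm_integral_le_lintegral_enorm _
  have hm : Measurable (fun z : Eucl n × Eucl n => ‖φ (z.1 + z.2) - φ z.1‖ₑ) :=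
    (by fun_prop : Continuous (fun z : Eucl n × Eucl n => ‖φ (z.1 + z.2) - φ z.1‖ₑ)).measurable
  calc ∫⁻ x, ‖ballAverage r φ x - φ x‖ₑ
      ≤ ∫⁻ x, ∫⁻ z, ‖φ (x + z) - φ x‖ₑ ∂(ballMeasure n r) := lintegral_mono hpt
    _ = ∫⁻ z, (∫⁻ x, ‖φ (x + z) - φ x‖ₑ) ∂(ballMeasure n r) :=
        lintegral_lintegral_swap hm.aemeasurable
    _ ≤ ∫⁻ _, (ENNReal.ofReal r * ∫⁻ z, ‖fderiv ℝ φ z‖ₑ) ∂(ballMeasure n r) := by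
        refine lintegral_mono_ae ?_
        filter_upwards [ae_ballMeasure_norm_le] with z hz
        refine (lintegral_enorm_translate_sub_le hφ z).trans ?_
        gcongr
        rw [← ofReal_norm]
        exact ENNReal.ofReal_le_ofReal hz
    _ = ENNReal.ofReal r * ∫⁻ z, ‖fderiv ℝ φ z‖ₑ := by simp

/-- The classes in `L^1(Ω)` of the test functions whose `W^{1,1}` norms are bounded by `C`. -/
def boundedTestClasses (Ω : Set (Eucl n)) (C : ℝ) : Set (Lp ℝ 1 (volume.restrict Ω)) :=
  {f | ∃ φ, IsTestFunction Ω φ ∧ f =ᵐ[volume.restrict Ω] φ ∧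
    ∫⁻ x, ‖φ x‖ₑ ≤ ENNReal.ofReal C ∧ ∫⁻ x, ‖fderiv ℝ φ x‖ₑ ≤ ENNReal.ofReal C}

/-- Test functions that are bounded in `W^{1,1}` form a totally bounded set in `L^1(Ω)`. -/
theorem totallyBounded_testFunctions (hΩ : IsOpen Ω) (hΩb : Bornology.IsBounded Ω) {C : ℝ} (hC : 0 ≤ C) :
    TotallyBounded (boundedTestClasses Ω C) := by
  refine Metric.totallyBounded_of_finite_discretization fun ε hε => ?_
  -- Averaging at radius `r` costs at most `ε / 4` in `L^1` for each of the two functions compared.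
  obtain ⟨r, hr, hrC⟩ : ∃ r : ℝ, 0 < r ∧ r * C ≤ ε / 4 := by
    refine ⟨ε / (4 * (C + 1)), by positivity, ?_⟩
    rw [div_mul_eq_mul_div, div_le_div_iff₀ (by positivity) (by positivity)]
    nlinarith
  set b : ℝ := (volume (Metric.ball (0 : Eucl n) r)).toReal⁻¹ with hb
  have hb0 : 0 ≤ b := by positivity
  have hbE : (volume (Metric.ball (0 : Eucl n) r))⁻¹ = ENNReal.ofReal b := by
    rw [hb, ENNReal.ofReal_inv_of_pos (ENNReal.toReal_pos (Metric.measure_ball_pos _ _ hr).ne'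
      measure_ball_lt_top.ne), ENNReal.ofReal_toReal measure_ball_lt_top.ne]
  set m : ℝ := (volume Ω).toReal with hm
  have hmE : volume Ω = ENNReal.ofReal m := by
    rw [hm, ENNReal.ofReal_toReal hΩb.measure_lt_top.ne]
  have hm0 : 0 ≤ m := ENNReal.toReal_nonneg
  set δ : ℝ := ε / (16 * (m + 1)) with hδ
  have hδ0 : 0 < δ := by positivity
  -- `b * C` bounds both the averages and their Lipschitz constants, so on a ball of radius `η` an
  -- average varies by at most `δ`.
  set η : ℝ := δ / (b * C + 1) with hη
  have hη0 : 0 < η := by positivity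
  obtain ⟨t, -, htf, htΩ⟩ := Metric.finite_approx_of_totallyBounded
    (hΩb.isCompact_closure.totallyBounded) η hη0
  have := htf.fintype
  set N : ℤ := ⌈b * C / δ⌉ + 1 with hN
  have hval : ∀ φ : Eucl n → ℝ, ∫⁻ x, ‖φ x‖ₑ ≤ ENNReal.ofReal C → ∀ x,
      |ballAverage r φ x| ≤ b * C := by
    intro φ hφ x
    have h1 := (enorm_ballAverage_le (r := r) φ x).trans (mul_le_mul_right hφ _)
    rw [hbE, ← ENNReal.ofReal_mul hb0, ← ofReal_norm, ENNReal.ofReal_le_ofReal_iff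
      (by positivity)] at h1
    exact h1
  have hfl : ∀ φ : Eucl n → ℝ, ∫⁻ x, ‖φ x‖ₑ ≤ ENNReal.ofReal C → ∀ x,
      ⌊ballAverage r φ x / δ⌋ ∈ Set.Icc (-N) N := by
    intro φ hφ x
    have h1 := abs_le.1 (hval φ hφ x)
    have h2 : b * C / δ ≤ (N : ℝ) - 1 := by rw [hN]; push_cast; linarith [Int.le_ceil (b * C / δ)]
    constructor
    · rw [Int.le_floor]
      have : -(b * C / δ) ≤ ballAverage r φ x / δ := by
        rw [← neg_div]; gcongr; exact h1.1
      push_cast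
      linarith
    · have h3 : ballAverage r φ x / δ ≤ b * C / δ := by gcongr; exact h1.2
      have h4 := Int.floor_le (ballAverage r φ x / δ)
      have : ((⌊ballAverage r φ x / δ⌋ : ℤ) : ℝ) ≤ N := by linarith
      exact_mod_cast this
  choose! Φ hΦ1 hΦ2 hΦ3 hΦ4 using fun (f : Lp ℝ 1 (volume.restrict Ω))
    (hf : f ∈ boundedTestClasses Ω C) => hf
  -- A class is encoded by its averages at the points of the `η`-net, rounded down to multiples of
  -- `δ`. Equal codes force averages within `3 * δ` on `Ω`: one `δ` for rounding and one for each
  -- oscillation.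
  refine ⟨t → Set.Icc (-N) N, inferInstance, fun f i => ⟨_, hfl (Φ f) (hΦ3 f f.2) i⟩, ?_⟩
  intro f g hfg
  have hclose : ∀ x ∈ Ω, ‖ballAverage r (Φ f) x - ballAverage r (Φ g) x‖ ≤ 3 * δ := by
    intro x hx
    obtain ⟨y, hy, hxy⟩ := Set.mem_iUnion₂.1 (htΩ (subset_closure hx))
    have hlip : ∀ h ∈ boundedTestClasses Ω C,
        |ballAverage r (Φ h) x - ballAverage r (Φ h) y| ≤ δ := by
      intro h hh
      have h1 := enorm_ballAverage_sub_le hr ((hΦ1 h hh).1.of_le (by simp)) x y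
      have h2 : (volume (Metric.ball (0 : Eucl n) r))⁻¹ *
          (‖x - y‖ₑ * ∫⁻ z, ‖fderiv ℝ (Φ h) z‖ₑ) ≤ ENNReal.ofReal (b * (η * C)) := by
        rw [hbE, ENNReal.ofReal_mul hb0, ENNReal.ofReal_mul hη0.le]
        gcongr
        · rw [← ofReal_norm, ← dist_eq_norm]
          exact ENNReal.ofReal_le_ofReal (Metric.mem_ball.1 hxy).le
        · exact hΦ4 h hh
      have h3 := h1.trans h2
      rw [← ofReal_norm, ENNReal.ofReal_le_ofReal_iff (by positivity)] at h3
      refine h3.trans ?_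
      calc b * (η * C) = b * C / (b * C + 1) * δ := by rw [hη]; ring
        _ ≤ 1 * δ := by gcongr; rw [div_le_one (by positivity)]; linarith
        _ = δ := one_mul δ
    have hfl' : ⌊ballAverage r (Φ f) y / δ⌋ = ⌊ballAverage r (Φ g) y / δ⌋ :=
      congrArg Subtype.val (congrFun hfg ⟨y, hy⟩)
    have h1 := Int.abs_sub_lt_one_of_floor_eq_floor hfl'
    rw [← sub_div, abs_div, abs_of_pos hδ0, div_lt_one hδ0] at h1
    have h2 := hlip f f.2
    have h3 := hlip g g.2
    rw [Real.norm_eq_abs]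
    rw [abs_le] at *
    rw [abs_lt] at h1
    constructor <;> linarith [h1.1, h1.2, h2.1, h2.2, h3.1, h3.2]
  have hT : ∀ h ∈ boundedTestClasses Ω C,
      ∫⁻ x in Ω, ‖ballAverage r (Φ h) x - Φ h x‖ₑ ≤ ENNReal.ofReal (ε / 4) := by
    intro h hh
    refine (setLIntegral_le_lintegral _ _).trans
      ((lintegral_enorm_ballAverage_sub_le hr ((hΦ1 h hh).1.of_le (by simp))).trans ?_)
    refine (mul_le_mul_right (hΦ4 h hh) _).trans ?_
    rw [← ENNReal.ofReal_mul hr.le]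
    exact ENNReal.ofReal_le_ofReal hrC
  have hcont : ∀ h ∈ boundedTestClasses Ω C,
      Measurable fun x => ‖ballAverage r (Φ h) x - Φ h x‖ₑ := by
    intro h hh
    have hc : Continuous (Φ h) := (hΦ1 h hh).1.continuous
    have := isProbabilityMeasure_ballMeasure (n := n) hr
    have h1 : StronglyMeasurable (ballAverage r (Φ h)) :=
      StronglyMeasurable.integral_prod_right (f := fun x z => Φ h (x + z))
        (by fun_prop : Continuous fun z : Eucl n × Eucl n => Φ h (z.1 + z.2)).stronglyMeasurable
    exact (h1.measurable.sub hc.measurable).enorm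
  have hΩae : ∀ᵐ x ∂(volume.restrict Ω), x ∈ Ω := ae_restrict_mem hΩ.measurableSet
  have hdist : edist (f : Lp ℝ 1 (volume.restrict Ω)) g ≤
      ENNReal.ofReal (ε / 4) + ENNReal.ofReal (3 * δ) * volume Ω + ENNReal.ofReal (ε / 4) := by
    rw [Lp.edist_def, eLpNorm_one_eq_lintegral_enorm]
    have hle : ∀ᵐ x ∂(volume.restrict Ω),
        ‖((f : Lp ℝ 1 (volume.restrict Ω)) - (g : Lp ℝ 1 (volume.restrict Ω)) : Eucl n → ℝ) x‖ₑ ≤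
        ‖ballAverage r (Φ f) x - Φ f x‖ₑ + ENNReal.ofReal (3 * δ) +
          ‖ballAverage r (Φ g) x - Φ g x‖ₑ := by
      filter_upwards [hΦ2 f f.2, hΦ2 g g.2, hΩae] with x h1 h2 hx
      rw [Pi.sub_apply, h1, h2]
      simp only [← ofReal_norm]
      rw [← ENNReal.ofReal_add (norm_nonneg _) (by positivity),
        ← ENNReal.ofReal_add (by positivity) (norm_nonneg _)]
      refine ENNReal.ofReal_le_ofReal ?_
      have h3 := hclose x hx
      simp only [Real.norm_eq_abs] at *
      have e : Φ f x - Φ g x = -(ballAverage r (Φ f) x - Φ f x) +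
        (ballAverage r (Φ f) x - ballAverage r (Φ g) x) + (ballAverage r (Φ g) x - Φ g x) := by ring
      rw [e]
      refine (abs_add_le _ _).trans (add_le_add_left ((abs_add_le _ _).trans ?_) _)
      rw [abs_neg]
      linarith
    refine (lintegral_mono_ae hle).trans ?_
    rw [lintegral_add_right _ (hcont g g.2), lintegral_add_right _ measurable_const,
      lintegral_const, Measure.restrict_apply_univ]
    exact add_le_add (add_le_add_left (hT f f.2) _) (hT g g.2)
  rw [hmE, ← ENNReal.ofReal_mul (by positivity), ← ENNReal.ofReal_add (by positivity) (by positivity),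
    ← ENNReal.ofReal_add (by positivity) (by positivity), edist_dist,
    ENNReal.ofReal_le_ofReal_iff (by positivity)] at hdist
  refine hdist.trans_lt ?_
  have : δ * m ≤ ε / 16 := by
    rw [hδ, div_mul_eq_mul_div, div_le_div_iff₀ (by positivity) (by positivity)]
    nlinarith
  linarith

theorem lt_critExp {p : ℝ} (hp : 1 < p) (hpn : p < n) : p < critExp n p := by
  have h : 0 < (n : ℝ) - p := by linarith
  rw [critExp, lt_div_iff₀ h]
  nlinarith

/-- The Rellich–Kondrachov theorem. -/
theorem exists_subseq_tendsto_of_bounded (hΩ : IsOpen Ω) (hΩb : Bornology.IsBounded Ω) {p : ℝ}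
    [Fact (1 ≤ ENNReal.ofReal p)] (hp : 1 < p) (hpn : p < n) {C : ℝ} {w : ℕ → LpPair Ω p}
    (hw : ∀ k, w k ∈ sobolevZero Ω p) (hC : ∀ k, ‖w k‖ ≤ C) :
    ∃ (u : Lp ℝ (ENNReal.ofReal p) (volume.restrict Ω)) (σ : ℕ → ℕ), StrictMono σ ∧
      Tendsto (fun k => (w (σ k)).1) atTop (𝓝 u) ∧
      ∀ᵐ x ∂(volume.restrict Ω), Tendsto (fun k => (w (σ k)).1 x) atTop (𝓝 (u x)) := by
  have : IsFiniteMeasure (volume.restrict Ω) := ⟨by simpa using hΩb.measure_lt_top⟩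
  have hP : (1 : ℝ≥0∞) ≤ ENNReal.ofReal p := Fact.out
  have hp0 : 0 < p := by linarith
  have hC0 : 0 ≤ C := (norm_nonneg _).trans (hC 0)
  -- approximate by test functions
  have happ : ∀ k, ∃ z ∈ testPairs Ω p, dist (w k) z < 1 / ((k : ℝ) + 1) := fun k => by
    have h := hw k
    rw [sobolevZero, ← SetLike.mem_coe, Submodule.topologicalClosure_coe] at h
    exact Metric.mem_closure_iff.1 h _ (by positivity)
  choose z hz hzd using happ
  have hzC : ∀ k, ‖z k‖ ≤ C + 1 := fun k => by
    have h1 : ‖z k‖ ≤ ‖w k‖ + dist (w k) (z k) := by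
      rw [dist_eq_norm]; exact norm_le_norm_add_norm_sub _ _
    have h2 : 1 / ((k : ℝ) + 1) ≤ 1 := by
      rw [div_le_one (by positivity)]; linarith [(Nat.cast_nonneg k : (0 : ℝ) ≤ k)]
    linarith [hC k, hzd k]
  have hzmem : ∀ k, z k ∈ sobolevZero Ω p := fun k => testPairs_le_sobolevZero (hz k)
  choose φ hφ hφ1 hφ2 using hz
  -- the approximations are bounded in `W^{1,1}`
  set e : ℝ := 1 / (1 : ℝ≥0∞).toReal - 1 / (ENNReal.ofReal p).toReal with he
  have he0 : 0 ≤ e := by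
    rw [he, ENNReal.toReal_one, ENNReal.toReal_ofReal hp0.le, sub_nonneg, div_one,
      div_le_one hp0]
    exact hp.le
  have hfin : (volume.restrict Ω) Set.univ ^ e ≠ ⊤ :=
    ENNReal.rpow_ne_top_of_nonneg he0 (measure_ne_top _ _)
  set D : ℝ := (C + 1) * ((volume.restrict Ω) Set.univ ^ e).toReal with hD
  have hL1 : ∀ {V : Type} [NormedAddCommGroup V] (g : Eucl n → V), Function.support g ⊆ Ω →
      AEStronglyMeasurable g (volume.restrict Ω) →
      eLpNorm g (ENNReal.ofReal p) (volume.restrict Ω) ≤ ENNReal.ofReal (C + 1) →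
      ∫⁻ x, ‖g x‖ₑ ≤ ENNReal.ofReal D := by
    intro V _ g hg hgm hgC
    rw [← eLpNorm_one_eq_lintegral_enorm, ← eLpNorm_restrict_eq_of_support_subset hg]
    refine (eLpNorm_le_eLpNorm_mul_rpow_measure_univ hP hgm).trans ?_
    rw [hD, ENNReal.ofReal_mul (by positivity), ENNReal.ofReal_toReal hfin]
    gcongr
  have hnorm1 : ∀ k, eLpNorm (φ k) (ENNReal.ofReal p) (volume.restrict Ω) ≤
      ENNReal.ofReal (C + 1) := fun k => by
    rw [← eLpNorm_congr_ae (hφ1 k), ← ENNReal.ofReal_toReal (Lp.memLp (z k).1).eLpNorm_ne_top,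
      ← Lp.norm_def]
    exact ENNReal.ofReal_le_ofReal ((norm_fst_le _).trans (hzC k))
  have hnorm2 : ∀ k, eLpNorm (gradient (φ k)) (ENNReal.ofReal p) (volume.restrict Ω) ≤
      ENNReal.ofReal (C + 1) := fun k => by
    rw [← eLpNorm_congr_ae (hφ2 k), ← ENNReal.ofReal_toReal (Lp.memLp (z k).2).eLpNorm_ne_top,
      ← Lp.norm_def]
    exact ENNReal.ofReal_le_ofReal ((norm_snd_le _).trans (hzC k))
  have hmem : ∀ k, ((hφ k).memLp 1 (volume.restrict Ω)).toLp (φ k) ∈ boundedTestClasses Ω D := by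
    refine fun k => ⟨φ k, hφ k, MemLp.coeFn_toLp _, hL1 _ ((subset_tsupport _).trans (hφ k).2.2)
      (hφ k).1.continuous.aestronglyMeasurable (hnorm1 k), ?_⟩
    have h := hL1 _ (hφ k).tsupport_gradient_subset
      (hφ k).continuous_gradient.aestronglyMeasurable (hnorm2 k)
    refine le_trans (le_of_eq (lintegral_congr fun x => ?_)) h
    rw [← ofReal_norm, ← ofReal_norm, norm_gradient_eq]
  have hcomp : IsCompact (closure (boundedTestClasses Ω D)) :=
    (totallyBounded_testFunctions hΩ hΩb (by positivity)).closure.isCompact_of_isClosed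
      isClosed_closure
  obtain ⟨f, -, σ, hσ, hσlim⟩ := hcomp.tendsto_subseq fun k => subset_closure (hmem k)
  obtain ⟨τ, hτ, hτlim⟩ := exists_subseq_tendsto_ae_of_tendsto hσlim
  have hae : ∀ᵐ x ∂(volume.restrict Ω),
      Tendsto (fun k => (z (σ (τ k))).1 x) atTop (𝓝 (f x)) := by
    have h1 : ∀ᵐ x ∂(volume.restrict Ω), ∀ k,
        ((hφ k).memLp 1 (volume.restrict Ω)).toLp (φ k) x = φ k x :=
      ae_all_iff.2 fun k => MemLp.coeFn_toLp _
    filter_upwards [h1, ae_all_iff.2 hφ1, hτlim] with x a b c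
    simp only [Function.comp_apply, a] at c
    simpa only [b] using c
  -- strong convergence by higher integrability
  have hzL : Tendsto (fun k => (z (σ (τ k))).1) atTop
      (𝓝 ((memLp_of_tendsto_ae (fun k => (Lp.memLp (z (σ (τ k))).1).1)
        (fun k => by rw [eLpNorm_congr_ae (hφ1 _)]; exact hnorm1 _) hae).1.toLp f)) := by
    obtain ⟨S, hS, hSob⟩ := eLpNorm_le_norm_snd hΩb hp hpn
      (hp.le.trans (lt_critExp hp hpn).le) le_rfl
    have h1 : ∀ k, eLpNorm (z (σ (τ k))).1 (ENNReal.ofReal (critExp n p)) (volume.restrict Ω) ≤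
        ENNReal.ofReal (S * (C + 1)) := fun k => by
      refine (hSob _ (hzmem _)).2.trans (ENNReal.ofReal_le_ofReal ?_)
      gcongr
      exact (norm_snd_le _).trans (hzC _)
    have h2 := tendsto_eLpNorm_sub_of_tendsto_ae hp.le (lt_critExp hp hpn)
      (fun k => (Lp.memLp (z (σ (τ k))).1).1) h1 hae
    rw [Lp.tendsto_Lp_iff_tendsto_eLpNorm']
    refine h2.congr fun k => eLpNorm_congr_ae ?_
    exact (EventuallyEq.refl _ _).sub (MemLp.coeFn_toLp _).symm
  -- Transfers the convergence from the test functions back to the original sequence.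
  have hwz : Tendsto (fun k => (w k).1 - (z k).1) atTop (𝓝 0) := by
    refine squeeze_zero_norm (fun k => ?_) (tendsto_one_div_add_atTop_nhds_zero_nat (𝕜 := ℝ))
    rw [← dist_eq_norm]
    exact (le_max_left _ _).trans (hzd k).le
  have hwL := (hwz.comp (hσ.comp hτ).tendsto_atTop).add hzL
  simp only [Function.comp_apply, sub_add_cancel, zero_add] at hwL
  obtain ⟨ρ, hρ, hρlim⟩ := exists_subseq_tendsto_ae_of_tendsto hwL
  exact ⟨_, σ ∘ τ ∘ ρ, hσ.comp (hτ.comp hρ), hwL.comp hρ.tendsto_atTop, hρlim⟩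

end Rellich

/-! ### The anisotropic flux and its monotonicity. -/

section MatForm

variable {n : ℕ}

theorem continuous_matForm :
    Continuous fun z : Matrix (Fin n) (Fin n) ℝ × Eucl n × Eucl n => matForm z.1 z.2.1 z.2.2 := by
  unfold matForm
  have h : ∀ i, Continuous fun z : Matrix (Fin n) (Fin n) ℝ × Eucl n × Eucl n => z.2.1 i :=
    fun i => by fun_prop
  refine Continuous.dotProduct (Continuous.matrix_mulVec continuous_fst ?_) ?_
  · exact (PiLp.continuous_ofLp 2 _).comp (continuous_fst.comp continuous_snd)
  · exact (PiLp.continuous_ofLp 2 _).comp (continuous_snd.comp continuous_snd)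

theorem matForm_eq_inner (M : Matrix (Fin n) (Fin n) ℝ) (ξ ζ : Eucl n) :
    matForm M ξ ζ = inner ℝ (Matrix.toEuclideanCLM (𝕜 := ℝ) M ξ) ζ := by
  rw [matForm, EuclideanSpace.inner_eq_star_dotProduct, dotProduct_comm]
  simp

theorem matForm_sub_left (M : Matrix (Fin n) (Fin n) ℝ) (ξ η ζ : Eucl n) :
    matForm M (ξ - η) ζ = matForm M ξ ζ - matForm M η ζ := by
  simp only [matForm_eq_inner, map_sub, inner_sub_left]

theorem matForm_sub_right (M : Matrix (Fin n) (Fin n) ℝ) (ξ η ζ : Eucl n) :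
    matForm M ξ (η - ζ) = matForm M ξ η - matForm M ξ ζ := by
  simp only [matForm_eq_inner, inner_sub_right]

theorem matForm_smul_left (M : Matrix (Fin n) (Fin n) ℝ) (c : ℝ) (ξ ζ : Eucl n) :
    matForm M (c • ξ) ζ = c * matForm M ξ ζ := by
  simp only [matForm_eq_inner, map_smul, inner_smul_left]
  simp

theorem matForm_smul_right (M : Matrix (Fin n) (Fin n) ℝ) (c : ℝ) (ξ ζ : Eucl n) :
    matForm M ξ (c • ζ) = c * matForm M ξ ζ := by
  simp only [matForm_eq_inner, inner_smul_right]

theorem matForm_zero_left (M : Matrix (Fin n) (Fin n) ℝ) (ζ : Eucl n) : matForm M 0 ζ = 0 := by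
  simp [matForm_eq_inner]

theorem matForm_comm {M : Matrix (Fin n) (Fin n) ℝ} (hM : Mᵀ = M) (ξ ζ : Eucl n) :
    matForm M ξ ζ = matForm M ζ ξ := by
  rw [matForm, matForm, dotProduct_comm, Matrix.dotProduct_mulVec, ← Matrix.mulVec_transpose, hM]

/-- Symmetric matrices whose quadratic form lies between `τ|ξ|²` and `B|ξ|²`. -/
structure IsEllipticMatrix (τ B : ℝ) (M : Matrix (Fin n) (Fin n) ℝ) : Prop where
  symm : Mᵀ = M
  lower : ∀ ξ : Eucl n, τ * ‖ξ‖ ^ 2 ≤ matForm M ξ ξ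
  upper : ∀ ξ : Eucl n, matForm M ξ ξ ≤ B * ‖ξ‖ ^ 2

/-- The upper bound comes from compactness of the image of `closure Ω` under `A`, times the unit
sphere. -/
theorem IsCoefficient.exists_isEllipticMatrix {Ω : Set (Eucl n)}
    {A : Eucl n → Matrix (Fin n) (Fin n) ℝ} (hΩb : Bornology.IsBounded Ω)
    (hA : IsCoefficient Ω A) :
    ∃ τ B : ℝ, 0 < τ ∧ 0 < B ∧ ∀ x ∈ closure Ω, IsEllipticMatrix τ B (A x) := by
  obtain ⟨τ, hτ, hlow⟩ := hA.elliptic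
  have hK : IsCompact (A '' closure Ω) := hΩb.isCompact_closure.image_of_continuousOn hA.continuousOn
  obtain ⟨B, hB⟩ := (hK.prod (isCompact_sphere (0 : Eucl n) 1)).exists_bound_of_continuousOn
    (f := fun z => matForm z.1 z.2 z.2) (Continuous.continuousOn
      (continuous_matForm.comp (by fun_prop : Continuous fun z : Matrix (Fin n) (Fin n) ℝ × Eucl n =>
        (z.1, z.2, z.2))))
  refine ⟨τ, max B 1, hτ, by positivity, fun x hx => ⟨hA.symm x hx, hlow x hx, fun ξ => ?_⟩⟩
  by_cases hξ : ξ = 0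
  · simp [hξ, matForm_zero_left]
  · have hξ' : 0 < ‖ξ‖ := norm_pos_iff.2 hξ
    have h := hB (A x, ‖ξ‖⁻¹ • ξ) ⟨⟨x, hx, rfl⟩, by simp [norm_smul, hξ'.ne']⟩
    simp only [matForm_smul_left, matForm_smul_right] at h
    have h2 : matForm (A x) ξ ξ = ‖ξ‖ ^ 2 * (‖ξ‖⁻¹ * (‖ξ‖⁻¹ * matForm (A x) ξ ξ)) := by
      field_simp
    rw [h2, mul_comm]
    gcongr
    exact (le_abs_self _).trans (h.trans (le_max_left _ _))

variable {τ B : ℝ} {M : Matrix (Fin n) (Fin n) ℝ}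

theorem IsEllipticMatrix.nonneg (hM : IsEllipticMatrix τ B M) (hτ : 0 < τ) (ξ : Eucl n) :
    0 ≤ matForm M ξ ξ :=
  (by positivity : 0 ≤ τ * ‖ξ‖ ^ 2).trans (hM.lower ξ)

theorem IsEllipticMatrix.pos (hM : IsEllipticMatrix τ B M) (hτ : 0 < τ) {ξ : Eucl n} (hξ : ξ ≠ 0) :
    0 < matForm M ξ ξ :=
  (mul_pos hτ (pow_pos (norm_pos_iff.2 hξ) 2)).trans_le (hM.lower ξ)

theorem IsEllipticMatrix.abs_matForm_le (hM : IsEllipticMatrix τ B M) (hτ : 0 < τ) (ξ ζ : Eucl n) :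
    |matForm M ξ ζ| ≤ √(matForm M ξ ξ) * √(matForm M ζ ζ) := by
  by_cases hζ : ζ = 0
  · subst hζ
    simp [matForm_comm hM.symm ξ 0, matForm_zero_left]
  rw [← Real.sqrt_mul (hM.nonneg hτ ξ)]
  refine Real.abs_le_sqrt ?_
  -- Cauchy–Schwarz for the form of `M`: up to a positive factor this vector is the component of `ξ`
  -- orthogonal to `ζ`.
  have h := hM.nonneg hτ (matForm M ζ ζ • ξ - matForm M ξ ζ • ζ)
  simp only [matForm_sub_left, matForm_sub_right, matForm_smul_left, matForm_smul_right,
    matForm_comm hM.symm ζ ξ] at h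
  have hpos := hM.pos hτ hζ
  have h2 : 0 ≤ matForm M ζ ζ * (matForm M ξ ξ * matForm M ζ ζ - matForm M ξ ζ ^ 2) := by
    refine h.trans (le_of_eq ?_); ring
  linarith [nonneg_of_mul_nonneg_right h2 hpos]

/-- The pairing `⟨M ξ, ξ⟩ ^ ((p - 2) / 2) ⟨M ξ, ζ⟩`. -/
noncomputable def flux (p : ℝ) (M : Matrix (Fin n) (Fin n) ℝ) (ξ ζ : Eucl n) : ℝ :=
  matForm M ξ ξ ^ ((p - 2) / 2) * matForm M ξ ζ

variable {p : ℝ}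

theorem flux_sub_right (ξ η ζ : Eucl n) : flux p M ξ (η - ζ) = flux p M ξ η - flux p M ξ ζ := by
  simp only [flux, matForm_sub_right, mul_sub]

theorem flux_smul_right (c : ℝ) (ξ ζ : Eucl n) : flux p M ξ (c • ζ) = c * flux p M ξ ζ := by
  simp only [flux, matForm_smul_right]; ring

theorem IsEllipticMatrix.flux_self (hM : IsEllipticMatrix τ B M) (hτ : 0 < τ) (hp : 0 < p)
    (ξ : Eucl n) : flux p M ξ ξ = matForm M ξ ξ ^ (p / 2) := by
  rw [flux, ← Real.rpow_add_one' (hM.nonneg hτ ξ) (by linarith)]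
  ring_nf

theorem IsEllipticMatrix.flux_smul_left (hM : IsEllipticMatrix τ B M) (hτ : 0 < τ) {ρ : ℝ}
    (hρ : 0 < ρ) (ξ ζ : Eucl n) : flux p M (ρ • ξ) ζ = ρ ^ (p - 1) * flux p M ξ ζ := by
  simp only [flux, matForm_smul_left, matForm_smul_right]
  rw [← mul_assoc ρ ρ, Real.mul_rpow (by positivity) (hM.nonneg hτ ξ), ← pow_two,
    ← Real.rpow_natCast, ← Real.rpow_mul hρ.le]
  have : ρ ^ (p - 1) = ρ ^ (((2 : ℕ) : ℝ) * ((p - 2) / 2)) * ρ := by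
    rw [← Real.rpow_add_one hρ.ne']
    congr 1; push_cast; ring
  rw [this]; ring

theorem IsEllipticMatrix.sqrt_le (hM : IsEllipticMatrix τ B M) (hB : 0 < B) (ξ : Eucl n) :
    √(matForm M ξ ξ) ≤ √B * ‖ξ‖ := by
  rw [← Real.sqrt_sq (norm_nonneg ξ), ← Real.sqrt_mul hB.le]
  exact Real.sqrt_le_sqrt (hM.upper ξ)

theorem IsEllipticMatrix.abs_flux_le_sqrt (hM : IsEllipticMatrix τ B M) (hτ : 0 < τ) (hp : 1 < p)
    (ξ ζ : Eucl n) :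
    |flux p M ξ ζ| ≤ √(matForm M ξ ξ) ^ (p - 1) * √(matForm M ζ ζ) := by
  rw [flux, abs_mul, abs_of_nonneg (Real.rpow_nonneg (hM.nonneg hτ ξ) _),
    Real.rpow_div_two_eq_sqrt _ (hM.nonneg hτ ξ)]
  calc _ ≤ √(matForm M ξ ξ) ^ (p - 2) * (√(matForm M ξ ξ) * √(matForm M ζ ζ)) := by
        gcongr
        exact hM.abs_matForm_le hτ ξ ζ
    _ = √(matForm M ξ ξ) ^ (p - 1) * √(matForm M ζ ζ) := by
        rw [← mul_assoc, ← Real.rpow_add_one' (Real.sqrt_nonneg _) (by linarith)]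
        ring_nf

theorem IsEllipticMatrix.abs_flux_le (hM : IsEllipticMatrix τ B M) (hτ : 0 < τ) (hB : 0 < B)
    (hp : 1 < p) (ξ ζ : Eucl n) : |flux p M ξ ζ| ≤ √B ^ p * ‖ξ‖ ^ (p - 1) * ‖ζ‖ := by
  refine (hM.abs_flux_le_sqrt hτ hp ξ ζ).trans ?_
  have h0 : 0 ≤ p - 1 := by linarith
  calc _ ≤ (√B * ‖ξ‖) ^ (p - 1) * (√B * ‖ζ‖) := by
        gcongr
        · exact hM.sqrt_le hB ξ
        · exact hM.sqrt_le hB ζ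
    _ = √B ^ p * ‖ξ‖ ^ (p - 1) * ‖ζ‖ := by
        rw [Real.mul_rpow (Real.sqrt_nonneg _) (norm_nonneg _)]
        have : √B ^ p = √B ^ (p - 1) * √B := by
          rw [← Real.rpow_add_one (Real.sqrt_pos.2 hB).ne']; ring_nf
        rw [this]; ring

/-- With `a`, `b` the lengths of `ξ`, `η` for `M`, the expression splits into `(a^(p-1) - b^(p-1))
(a - b)` and two Cauchy–Schwarz defects, all nonnegative. If it vanishes then `a = b`, and it
becomes `a^(p-2)` times the form at `ξ - η`, which settles equality. No case distinction at `p = 2`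
is needed. -/
theorem IsEllipticMatrix.flux_sub_nonneg (hM : IsEllipticMatrix τ B M) (hτ : 0 < τ) (hp : 1 < p)
    (ξ η : Eucl n) : 0 ≤ flux p M ξ (ξ - η) - flux p M η (ξ - η) ∧
      (flux p M ξ (ξ - η) - flux p M η (ξ - η) = 0 → ξ = η) := by
  set a := √(matForm M ξ ξ) with ha
  set b := √(matForm M η η) with hb
  have ha0 : 0 ≤ a := Real.sqrt_nonneg _
  have hb0 : 0 ≤ b := Real.sqrt_nonneg _
  have hself : ∀ ζ : Eucl n, flux p M ζ ζ = √(matForm M ζ ζ) ^ (p - 1) * √(matForm M ζ ζ) := by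
    intro ζ
    rw [hM.flux_self hτ (by linarith), Real.rpow_div_two_eq_sqrt _ (hM.nonneg hτ ζ),
      ← Real.rpow_add_one' (Real.sqrt_nonneg _) (by linarith)]
    ring_nf
  have h1 : flux p M ξ η ≤ a ^ (p - 1) * b := (le_abs_self _).trans (hM.abs_flux_le_sqrt hτ hp ξ η)
  have h2 : flux p M η ξ ≤ b ^ (p - 1) * a := (le_abs_self _).trans (hM.abs_flux_le_sqrt hτ hp η ξ)
  have heq : flux p M ξ (ξ - η) - flux p M η (ξ - η) =
      (a ^ (p - 1) - b ^ (p - 1)) * (a - b) + (a ^ (p - 1) * b - flux p M ξ η) +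
        (b ^ (p - 1) * a - flux p M η ξ) := by
    rw [flux_sub_right, flux_sub_right, hself, hself]; ring
  have h0 : 0 < p - 1 := by linarith
  have hmono : 0 ≤ (a ^ (p - 1) - b ^ (p - 1)) * (a - b) := by
    rcases le_total a b with h | h
    · exact mul_nonneg_of_nonpos_of_nonpos (sub_nonpos.2 (Real.rpow_le_rpow ha0 h h0.le))
        (sub_nonpos.2 h)
    · exact mul_nonneg (sub_nonneg.2 (Real.rpow_le_rpow hb0 h h0.le)) (sub_nonneg.2 h)
  refine ⟨by rw [heq]; linarith, fun hz => ?_⟩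
  rw [heq] at hz
  have hab : a = b := by
    rcases lt_trichotomy a b with h | h | h
    · have := mul_pos_of_neg_of_neg (sub_neg.2 (Real.rpow_lt_rpow ha0 h h0)) (sub_neg.2 h)
      linarith
    · exact h
    · have := mul_pos (sub_pos.2 (Real.rpow_lt_rpow hb0 h h0)) (sub_pos.2 h)
      linarith
  by_contra hne
  have hpos := hM.pos hτ (sub_ne_zero.2 hne)
  have hqe : matForm M ξ ξ = matForm M η η := by
    rw [← Real.sq_sqrt (hM.nonneg hτ ξ), ← Real.sq_sqrt (hM.nonneg hτ η), ← ha, ← hb, hab]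
  have hflux : flux p M ξ (ξ - η) - flux p M η (ξ - η) =
      matForm M ξ ξ ^ ((p - 2) / 2) * matForm M (ξ - η) (ξ - η) := by
    rw [flux, flux, ← hqe, matForm_sub_left]; ring
  rw [← heq, hflux] at hz
  rcases mul_eq_zero.1 hz with h | h
  · have hq0 : matForm M ξ ξ = 0 := by
      by_contra hq
      exact (Real.rpow_pos_of_pos (lt_of_le_of_ne (hM.nonneg hτ ξ) (Ne.symm hq)) _).ne' h
    have e1 : ξ = 0 := by by_contra hx; exact (hM.pos hτ hx).ne' hq0
    have e2 : η = 0 := by by_contra hx; exact (hM.pos hτ hx).ne' (hqe ▸ hq0)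
    exact hne (e1.trans e2.symm)
  · exact hpos.ne' h

/-- For `p < 2` the factor with exponent `(p - 2) / 2` is singular at `ξ = 0`; continuity there
follows from the bound of order `‖ξ‖ ^ (p - 1)`. -/
theorem continuousOn_flux (hτ : 0 < τ) (hB : 0 < B) (hp : 1 < p) :
    ContinuousOn (fun z : Matrix (Fin n) (Fin n) ℝ × Eucl n × Eucl n => flux p z.1 z.2.1 z.2.2)
      ({M | IsEllipticMatrix τ B M} ×ˢ Set.univ) := by
  rintro ⟨M, ξ, ζ⟩ ⟨hM, -⟩
  have hM : IsEllipticMatrix τ B M := hM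
  by_cases hξ : ξ = 0
  · subst hξ
    rw [ContinuousWithinAt]
    have h0 : flux p M 0 ζ = 0 := by simp [flux, matForm_zero_left]
    simp only [h0]
    have hc : Continuous fun z : Matrix (Fin n) (Fin n) ℝ × Eucl n × Eucl n =>
        √B ^ p * ‖z.2.1‖ ^ (p - 1) * ‖z.2.2‖ := by
      refine Continuous.mul (continuous_const.mul (Continuous.rpow_const (by fun_prop) ?_))
        (by fun_prop)
      exact fun _ => Or.inr (by linarith)
    have hlim := (hc.tendsto (M, 0, ζ)).mono_left
      (nhdsWithin_le_nhds (s := {M | IsEllipticMatrix τ B M} ×ˢ Set.univ))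
    simp only [norm_zero, Real.zero_rpow (by linarith : p - 1 ≠ 0), mul_zero, zero_mul] at hlim
    refine squeeze_zero_norm' ?_ hlim
    filter_upwards [self_mem_nhdsWithin] with z hz
    exact IsEllipticMatrix.abs_flux_le hz.1 hτ hB hp _ _
  · refine ContinuousAt.continuousWithinAt ?_
    have hQ : Continuous fun z : Matrix (Fin n) (Fin n) ℝ × Eucl n × Eucl n =>
        matForm z.1 z.2.1 z.2.1 :=
      continuous_matForm.comp (by fun_prop : Continuous fun
        z : Matrix (Fin n) (Fin n) ℝ × Eucl n × Eucl n => (z.1, z.2.1, z.2.1))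
    exact (hQ.continuousAt.rpow_const (Or.inl (hM.pos hτ hξ).ne')).mul
      continuous_matForm.continuousAt

/-- Strict monotonicity of the flux, uniformly on compact sets. -/
theorem exists_pos_le_flux_sub {K : Set (Matrix (Fin n) (Fin n) ℝ)} (hK : IsCompact K)
    (hKM : ∀ M ∈ K, IsEllipticMatrix τ B M) (hτ : 0 < τ) (hB : 0 < B) (hp : 1 < p) {s : ℝ}
    (hs : 0 < s) (R : ℝ) :
    ∃ m : ℝ, 0 < m ∧ ∀ M ∈ K, ∀ ξ η : Eucl n, ‖ξ‖ ≤ R → ‖η‖ ≤ R → s ≤ ‖ξ - η‖ →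
      m ≤ flux p M ξ (ξ - η) - flux p M η (ξ - η) := by
  set S : Set (Matrix (Fin n) (Fin n) ℝ × Eucl n × Eucl n) :=
    (K ×ˢ (Metric.closedBall 0 R ×ˢ Metric.closedBall 0 R)) ∩ {z | s ≤ ‖z.2.1 - z.2.2‖} with hS
  have hSc : IsCompact S :=
    (hK.prod ((isCompact_closedBall _ _).prod (isCompact_closedBall _ _))).inter_right
      (isClosed_le continuous_const (by fun_prop))
  have hcont : ContinuousOn (fun z : Matrix (Fin n) (Fin n) ℝ × Eucl n × Eucl n =>
      flux p z.1 z.2.1 (z.2.1 - z.2.2) - flux p z.1 z.2.2 (z.2.1 - z.2.2)) S := by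
    have hf := continuousOn_flux (n := n) hτ hB hp
    refine ContinuousOn.sub ?_ ?_
    · exact hf.comp (f := fun z : Matrix (Fin n) (Fin n) ℝ × Eucl n × Eucl n =>
        (z.1, z.2.1, z.2.1 - z.2.2)) (by fun_prop) (fun z hz => ⟨hKM _ hz.1.1, trivial⟩)
    · exact hf.comp (f := fun z : Matrix (Fin n) (Fin n) ℝ × Eucl n × Eucl n =>
        (z.1, z.2.2, z.2.1 - z.2.2)) (by fun_prop) (fun z hz => ⟨hKM _ hz.1.1, trivial⟩)
  have hmem : ∀ M ∈ K, ∀ ξ η : Eucl n, ‖ξ‖ ≤ R → ‖η‖ ≤ R → s ≤ ‖ξ - η‖ → (M, ξ, η) ∈ S :=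
    fun M hM ξ η h1 h2 h3 => ⟨⟨hM, by simpa using h1, by simpa using h2⟩, h3⟩
  rcases S.eq_empty_or_nonempty with hE | hne
  · exact ⟨1, one_pos, fun M hM ξ η h1 h2 h3 => absurd (hmem M hM ξ η h1 h2 h3) (by simp [hE])⟩
  -- The minimum over the compact set is positive, since equality in the monotonicity would force `ξ
  -- = η` against `s ≤ ‖ξ - η‖`.
  · obtain ⟨z, hz, hmin⟩ := hSc.exists_isMinOn hne hcont
    have hz' := (hKM _ hz.1.1).flux_sub_nonneg hτ hp z.2.1 z.2.2
    refine ⟨_, lt_of_le_of_ne hz'.1 fun h0 => ?_, fun M hM ξ η h1 h2 h3 =>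
      isMinOn_iff.1 hmin (M, ξ, η) (hmem M hM ξ η h1 h2 h3)⟩
    have := hz'.2 h0.symm
    have h3 : s ≤ ‖z.2.1 - z.2.2‖ := hz.2
    rw [this, sub_self, norm_zero] at h3
    linarith

/-- The derivative of `⟨M ξ, ξ⟩ ^ (p / 2)`. -/
noncomputable def energyDeriv (p : ℝ) (M : Matrix (Fin n) (Fin n) ℝ) (ξ : Eucl n) :
    Eucl n →L[ℝ] ℝ :=
  (p * matForm M ξ ξ ^ ((p - 2) / 2)) • innerSL ℝ (Matrix.toEuclideanCLM (𝕜 := ℝ) M ξ)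

theorem energyDeriv_apply (ξ ζ : Eucl n) : energyDeriv p M ξ ζ = p * flux p M ξ ζ := by
  simp [energyDeriv, flux, matForm_eq_inner, mul_assoc]

theorem IsEllipticMatrix.hasFDerivAt (hM : IsEllipticMatrix τ B M) (hτ : 0 < τ) (hB : 0 < B)
    (hp : 1 < p) (ξ : Eucl n) :
    HasFDerivAt (fun ξ => matForm M ξ ξ ^ (p / 2)) (energyDeriv p M ξ) ξ := by
  by_cases hξ : ξ = 0
  · subst hξ
    have h0 : energyDeriv p M (0 : Eucl n) = 0 := by
      ext ζ; simp [energyDeriv]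
    rw [h0]
    -- At the origin the chain rule can fail. The energy density is squeezed below a multiple of
    -- `‖ξ‖ ^ p`, which has zero derivative as `p > 1`.
    have hN : HasFDerivAt (fun ξ : Eucl n => √B ^ p * ‖ξ‖ ^ p) (0 : Eucl n →L[ℝ] ℝ) 0 := by
      have := (hasFDerivAt_norm_rpow (0 : Eucl n) hp).const_mul (√B ^ p)
      refine this.congr_fderiv ?_
      ext ζ; simp
    rw [hasFDerivAt_iff_isLittleO_nhds_zero] at hN ⊢
    refine (Asymptotics.IsBigO.of_bound 1 (Eventually.of_forall fun ζ => ?_)).trans_isLittleO hN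
    have hp0 : 0 < p := by linarith
    have h1 : √B ^ p * ‖(0 : Eucl n) + ζ‖ ^ p - √B ^ p * ‖(0 : Eucl n)‖ ^ p -
        (0 : Eucl n →L[ℝ] ℝ) ζ = √B ^ p * ‖ζ‖ ^ p := by
      simp [Real.zero_rpow hp0.ne']
    have h2 : matForm M ((0 : Eucl n) + ζ) (0 + ζ) ^ (p / 2) - matForm M (0 : Eucl n) 0 ^ (p / 2) -
        (0 : Eucl n →L[ℝ] ℝ) ζ = matForm M ζ ζ ^ (p / 2) := by
      simp [matForm_zero_left, Real.zero_rpow (by positivity : p / 2 ≠ 0)]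
    rw [h1, h2, one_mul, Real.norm_of_nonneg (Real.rpow_nonneg (hM.nonneg hτ ζ) _),
      Real.norm_of_nonneg (by positivity), Real.rpow_div_two_eq_sqrt _ (hM.nonneg hτ ζ),
      ← Real.mul_rpow (Real.sqrt_nonneg _) (norm_nonneg _)]
    exact Real.rpow_le_rpow (Real.sqrt_nonneg _) (hM.sqrt_le hB ζ) hp0.le
  · have hQ : HasFDerivAt (fun ξ => matForm M ξ ξ)
        ((2 : ℝ) • innerSL ℝ (Matrix.toEuclideanCLM (𝕜 := ℝ) M ξ)) ξ := by
      have h1 := ((Matrix.toEuclideanCLM (𝕜 := ℝ) M).hasFDerivAt (x := ξ)).inner ℝ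
        (hasFDerivAt_id (𝕜 := ℝ) ξ)
      simp only [matForm_eq_inner]
      refine h1.congr_fderiv ?_
      ext ζ
      have := matForm_comm hM.symm ζ ξ
      simp only [matForm_eq_inner] at this
      simp [this, two_mul]
    have h := hQ.rpow_const (p := p / 2) (Or.inl (hM.pos hτ hξ).ne')
    refine h.congr_fderiv ?_
    rw [energyDeriv, smul_smul]
    congr 1
    have : p / 2 - 1 = (p - 2) / 2 := by ring
    rw [this]; ring

/-- Used for the strong measurability of the matrix-valued map `A`. -/
instance : TopologicalSpace.PseudoMetrizableSpace (Matrix (Fin n) (Fin n) ℝ) :=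
  inferInstanceAs (TopologicalSpace.PseudoMetrizableSpace (Fin n → Fin n → ℝ))

variable {Ω : Set (Eucl n)} {A : Eucl n → Matrix (Fin n) (Fin n) ℝ}

theorem IsCoefficient.aestronglyMeasurable_matForm (hA : IsCoefficient Ω A) (hΩ : IsOpen Ω)
    {U Φ : Eucl n → Eucl n} (hU : AEStronglyMeasurable U (volume.restrict Ω))
    (hΦ : AEStronglyMeasurable Φ (volume.restrict Ω)) :
    AEStronglyMeasurable (fun x => matForm (A x) (U x) (Φ x)) (volume.restrict Ω) := by
  have hAm : AEStronglyMeasurable A (volume.restrict Ω) :=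
    (hA.continuousOn.mono subset_closure).aestronglyMeasurable hΩ.measurableSet
  exact Continuous.comp_aestronglyMeasurable
    (g := fun z : Matrix (Fin n) (Fin n) ℝ × Eucl n × Eucl n => matForm z.1 z.2.1 z.2.2)
    (f := fun x => (A x, U x, Φ x)) continuous_matForm (hAm.prodMk (hU.prodMk hΦ))

theorem IsCoefficient.aestronglyMeasurable_flux (hA : IsCoefficient Ω A) (hΩ : IsOpen Ω)
    {U Φ : Eucl n → Eucl n} (hU : AEStronglyMeasurable U (volume.restrict Ω))
    (hΦ : AEStronglyMeasurable Φ (volume.restrict Ω)) :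
    AEStronglyMeasurable (fun x => flux p (A x) (U x) (Φ x)) (volume.restrict Ω) :=
  (((hA.aestronglyMeasurable_matForm hΩ hU hU).aemeasurable.pow_const _).mul
    (hA.aestronglyMeasurable_matForm hΩ hU hΦ).aemeasurable).aestronglyMeasurable

theorem IsEllipticMatrix.norm_energyDeriv_le (hM : IsEllipticMatrix τ B M) (hτ : 0 < τ)
    (hB : 0 < B) (hp : 1 < p) (ξ : Eucl n) :
    ‖energyDeriv p M ξ‖ ≤ p * √B ^ p * ‖ξ‖ ^ (p - 1) := by
  have hp0 : 0 < p := by linarith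
  refine ContinuousLinearMap.opNorm_le_bound _ (by positivity) fun ζ => ?_
  rw [energyDeriv_apply, Real.norm_eq_abs, abs_mul, abs_of_pos hp0]
  have := hM.abs_flux_le hτ hB hp ξ ζ
  calc _ ≤ p * (√B ^ p * ‖ξ‖ ^ (p - 1) * ‖ζ‖) := by gcongr
    _ = _ := by ring

theorem IsCoefficient.isPowerIntegrand (hA : IsCoefficient Ω A) (hΩ : IsOpen Ω)
    (hΩb : Bornology.IsBounded Ω) (hp : 1 < p) :
    IsPowerIntegrand (volume.restrict Ω) p (fun x ξ => matForm (A x) ξ ξ ^ (p / 2))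
      (fun x ξ => energyDeriv p (A x) ξ) where
  meas U hU := ((hA.aestronglyMeasurable_matForm hΩ hU hU).aemeasurable.pow_const
    _).aestronglyMeasurable
  meas' U Φ hU hΦ := by
    simp only [energyDeriv_apply]
    exact (hA.aestronglyMeasurable_flux hΩ hU hΦ).const_mul p
  zero := ae_of_all _ fun x => by
    simp only [matForm_zero_left]
    exact Real.zero_rpow (by linarith)
  deriv := by
    obtain ⟨τ, B, hτ, hB, hM⟩ := hA.exists_isEllipticMatrix hΩb
    filter_upwards [ae_restrict_mem hΩ.measurableSet] with x hx ξ
    exact (hM x (subset_closure hx)).hasFDerivAt hτ hB hp ξ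
  bound := by
    obtain ⟨τ, B, hτ, hB, hM⟩ := hA.exists_isEllipticMatrix hΩb
    refine ⟨p * √B ^ p, by positivity, ?_⟩
    filter_upwards [ae_restrict_mem hΩ.measurableSet] with x hx ξ
    exact (hM x (subset_closure hx)).norm_energyDeriv_le hτ hB hp ξ

end MatForm

/-! ### Sequences that are Cauchy in measure. -/

section CauchyInMeasure

variable {X : Type*} [MeasurableSpace X] {μ : Measure X} {V : Type*} [NormedAddCommGroup V]

/-- A sequence that is Cauchy in measure has an a.e. convergent subsequence. -/
theorem exists_subseq_tendsto_ae_of_cauchy_measure [CompleteSpace V] {f : ℕ → X → V}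
    (h : ∀ s : ℝ, 0 < s → ∃ N, ∀ k ≥ N, ∀ l ≥ N, μ {x | s ≤ ‖f k x - f l x‖} ≤ ENNReal.ofReal s) :
    ∃ σ : ℕ → ℕ, StrictMono σ ∧ ∀ᵐ x ∂μ, ∃ y, Tendsto (fun k => f (σ k) x) atTop (𝓝 y) := by
  obtain ⟨σ, hσ, hP⟩ := extraction_forall_of_eventually' (P := fun j k => ∀ l ≥ k,
    μ {x | (1 / 2 : ℝ) ^ j ≤ ‖f k x - f l x‖} ≤ ENNReal.ofReal ((1 / 2 : ℝ) ^ j)) (fun j => by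
      obtain ⟨N, hN⟩ := h ((1 / 2 : ℝ) ^ j) (by positivity)
      exact ⟨N, fun k hk l hl => hN k hk l (hk.trans hl)⟩)
  refine ⟨σ, hσ, ?_⟩
  -- Borel–Cantelli: almost every point lies in finitely many of these sets, so the tail there is
  -- geometrically Cauchy.
  have hsum : ∑' j, μ {x | (1 / 2 : ℝ) ^ j ≤ ‖f (σ j) x - f (σ (j + 1)) x‖} ≠ ⊤ := by
    refine ne_top_of_le_ne_top ?_ (ENNReal.tsum_le_tsum fun j => hP j (σ (j + 1))
      (hσ.monotone (Nat.le_succ j)))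
    rw [← ENNReal.ofReal_tsum_of_nonneg (fun _ => by positivity)
      (summable_geometric_of_lt_one (by norm_num) (by norm_num))]
    exact ENNReal.ofReal_ne_top
  filter_upwards [ae_eventually_notMem hsum] with x hx
  obtain ⟨J, hJ⟩ := eventually_atTop.1 hx
  have hc : CauchySeq fun j => f (σ (j + J)) x := by
    refine cauchySeq_of_le_geometric (1 / 2) ((1 / 2 : ℝ) ^ J) (by norm_num) fun j => ?_
    have := hJ (j + J) (by omega)
    simp only [not_le] at this
    rw [dist_eq_norm, ← pow_add, add_comm J j, show j + 1 + J = j + J + 1 by ring]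
    exact this.le
  obtain ⟨y, hy⟩ := cauchySeq_tendsto_of_complete hc
  exact ⟨y, (tendsto_add_atTop_iff_nat J).1 hy⟩

theorem measureReal_norm_ge_le {p : ℝ} (hp : 0 < p) {f : X → V}
    (hf : MemLp f (ENNReal.ofReal p) μ) {s : ℝ} (hs : 0 < s) :
    μ.real {x | s ≤ ‖f x‖} ≤ (lpNorm f (ENNReal.ofReal p) μ / s) ^ p := by
  have h := mul_meas_ge_le_integral_of_nonneg (μ := μ) (ae_of_all _ fun x => by positivity)
    (integrable_norm_rpow_of_memLp hp hf) (s ^ p)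
  have hset : {x | s ^ p ≤ ‖f x‖ ^ p} = {x | s ≤ ‖f x‖} := by
    ext x
    simp only [Set.mem_ofPred_eq]
    exact Real.rpow_le_rpow_iff hs.le (norm_nonneg _) hp
  rw [hset, ← lpNorm_rpow_eq_integral hp hf] at h
  rw [Real.div_rpow lpNorm_nonneg hs.le, le_div_iff₀ (by positivity), mul_comm]
  exact h

end CauchyInMeasure

/-! ### Almost everywhere convergence of gradients (Boccardo–Murat). -/

section GradientConvergence

variable {n : ℕ} {Ω : Set (Eucl n)} {p : ℝ} {A : Eucl n → Matrix (Fin n) (Fin n) ℝ}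

theorem abs_arctan_le_two (s : ℝ) : |Real.arctan s| ≤ 2 := by
  have h1 := Real.arctan_lt_pi_div_two s
  have h2 := Real.neg_pi_div_two_lt_arctan s
  rw [abs_le]
  constructor <;> linarith [Real.pi_le_four]

theorem hasDerivAt_scaled_arctan {δ : ℝ} (hδ : 0 < δ) (s : ℝ) :
    HasDerivAt (fun s => δ * Real.arctan (s / δ)) (1 / (1 + (s / δ) ^ 2)) s := by
  have := ((Real.hasDerivAt_arctan (s / δ)).comp s ((hasDerivAt_id s).div_const δ)).const_mul δ
  refine this.congr_deriv ?_
  field_simp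

theorem IsCoefficient.integrable_flux (hA : IsCoefficient Ω A) (hΩ : IsOpen Ω)
    (hΩb : Bornology.IsBounded Ω) (hp : 1 < p) {U Φ : Eucl n → Eucl n}
    (hU : MemLp U (ENNReal.ofReal p) (volume.restrict Ω))
    (hΦ : MemLp Φ (ENNReal.ofReal p) (volume.restrict Ω)) :
    Integrable (fun x => flux p (A x) (U x) (Φ x)) (volume.restrict Ω) := by
  have h := ((hA.isPowerIntegrand hΩ hΩb hp).integrable_deriv hp hU hΦ).const_mul p⁻¹
  simpa only [energyDeriv_apply, inv_mul_cancel_left₀ (by linarith : p ≠ 0)] using h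

variable [Fact (1 ≤ ENNReal.ofReal p)]

/-- Boccardo–Murat: if the equation holds along a bounded sequence with an error controlled by the
sup norm of the test function, then the gradients converge a.e. along a subsequence. -/
theorem exists_subseq_gradient_tendsto_ae (hΩ : IsOpen Ω) (hΩb : Bornology.IsBounded Ω)
    (hA : IsCoefficient Ω A) (hp : 1 < p) {C D : ℝ} (hD : 0 ≤ D) {ε : ℕ → ℝ}
    (hε : Tendsto ε atTop (𝓝 0)) {w : ℕ → LpPair Ω p} (hw : ∀ k, w k ∈ sobolevZero Ω p)
    (hC : ∀ k, ‖w k‖ ≤ C) (hcauchy : CauchySeq fun k => (w k).1)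
    (hres : ∀ k, ∀ z ∈ sobolevZero Ω p, ∀ M : ℝ, 0 ≤ M →
      (∀ᵐ x ∂(volume.restrict Ω), |z.1 x| ≤ M) →
      |∫ x in Ω, flux p (A x) ((w k).2 x) (z.2 x)| ≤ D * M + ε k * ‖z‖) :
    ∃ σ : ℕ → ℕ, StrictMono σ ∧ ∀ᵐ x ∂(volume.restrict Ω), ∃ y,
      Tendsto (fun k => (w (σ k)).2 x) atTop (𝓝 y) := by
  have : IsFiniteMeasure (volume.restrict Ω) := ⟨by simpa using hΩb.measure_lt_top⟩
  have hp0 : 0 < p := by linarith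
  have hC0 : 0 ≤ C := (norm_nonneg _).trans (hC 0)
  obtain ⟨τ, B, hτ, hB, hM⟩ := hA.exists_isEllipticMatrix hΩb
  have hΩae : ∀ᵐ x ∂(volume.restrict Ω), x ∈ Ω := ae_restrict_mem hΩ.measurableSet
  refine exists_subseq_tendsto_ae_of_cauchy_measure (f := fun k => (w k).2) fun s hs => ?_
  set μ := volume.restrict Ω with hμ
  -- parameters
  set R : ℝ := (C + 1) / (s / 8) ^ (1 / p) with hR
  have hR0 : 0 < R := by positivity
  obtain ⟨m, hm, hmono⟩ := exists_pos_le_flux_sub (hΩb.isCompact_closure.image_of_continuousOn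
    hA.continuousOn) (by rintro _ ⟨x, hx, rfl⟩; exact hM x hx) hτ hB hp hs R
  -- The test function below is bounded by `2 * δ`, so each right-hand side costs at most `s * m /
  -- 32`; so does each residual by the choice of `N₂`. The four terms sum to `m / 2 * (s / 4)`.
  set δ : ℝ := s * m / (64 * (D + 1)) with hδ
  have hδ0 : 0 < δ := by positivity
  obtain ⟨N₁, hN₁⟩ := Metric.cauchySeq_iff.1 hcauchy (δ * (s / 4) ^ (1 / p)) (by positivity)
  obtain ⟨N₂, hN₂⟩ := eventually_atTop.1 (hε.eventually (gt_mem_nhds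
    (show (0 : ℝ) < s * m / (64 * (C + 1)) by positivity)))
  refine ⟨max N₁ N₂, fun k hk l hl => ?_⟩
  have hroot : ∀ a : ℝ, 0 < a → (a ^ (1 / p)) ^ p = a := fun a ha => by
    rw [← Real.rpow_mul ha.le, one_div_mul_cancel hp0.ne', Real.rpow_one]
  -- large gradients
  have hlarge : ∀ k, μ.real {x | R ≤ ‖(w k).2 x‖} ≤ s / 8 := by
    intro k
    refine (measureReal_norm_ge_le hp0 (Lp.memLp (w k).2) hR0).trans ?_
    rw [lpNorm_coe_eq_norm]
    have h1 : ‖(w k).2‖ / R ≤ (s / 8) ^ (1 / p) := by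
      rw [div_le_iff₀ hR0, hR, mul_div_cancel₀ _ (by positivity)]
      linarith [norm_snd_le (w k), hC k]
    calc _ ≤ ((s / 8) ^ (1 / p)) ^ p := by gcongr
      _ = s / 8 := hroot _ (by positivity)
  -- large differences
  have hdiff : μ.real {x | δ ≤ ‖((w k).1 - (w l).1 : Lp ℝ (ENNReal.ofReal p) μ) x‖} ≤ s / 4 := by
    refine (measureReal_norm_ge_le hp0 (Lp.memLp _) hδ0).trans ?_
    rw [lpNorm_coe_eq_norm]
    have h0 := (hN₁ k ((le_max_left _ _).trans hk) l ((le_max_left _ _).trans hl)).le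
    rw [dist_eq_norm] at h0
    have h1 : ‖(w k).1 - (w l).1‖ / δ ≤ (s / 4) ^ (1 / p) := by
      rw [div_le_iff₀ hδ0]; linarith
    calc _ ≤ ((s / 4) ^ (1 / p)) ^ p := by gcongr
      _ = s / 4 := hroot _ (by positivity)
  -- the monotonicity defect
  have hb : ∀ s : ℝ, |1 / (1 + (s / δ) ^ 2)| ≤ 1 := fun s => by
    rw [abs_of_nonneg (by positivity), div_le_one (by positivity)]
    nlinarith [sq_nonneg (s / δ)]
  -- The test function is a smooth truncation of `w k - w l`. Its supremum is of order `δ`, while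
  -- its gradient is that of `w k - w l` times a weight which is at least `1 / 2` where `|w k - w l|
  -- < δ`.
  obtain ⟨z, hz, hz1, hz2, hzn⟩ := exists_comp_mem_sobolevZero hp
    (T := fun s => δ * Real.arctan (s / δ)) (T' := fun s => 1 / (1 + (s / δ) ^ 2))
    (contDiff_const.mul (Real.contDiff_arctan.comp (contDiff_id.div_const δ))) (by simp)
    (hasDerivAt_scaled_arctan hδ0) hb (Submodule.sub_mem _ (hw k) (hw l))
  have hzb : ∀ᵐ x ∂μ, |z.1 x| ≤ 2 * δ := by
    filter_upwards [hz1] with x hx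
    rw [hx, abs_mul, abs_of_pos hδ0, mul_comm]
    gcongr
    exact abs_arctan_le_two _
  have hzC : ‖z‖ ≤ 2 * C := hzn.trans ((norm_sub_le _ _).trans (by linarith [hC k, hC l]))
  set e : Eucl n → ℝ := fun x => flux p (A x) ((w k).2 x) (z.2 x) - flux p (A x) ((w l).2 x) (z.2 x)
    with he
  have hi : ∀ k, Integrable (fun x => flux p (A x) ((w k).2 x) (z.2 x)) μ := fun k =>
    hA.integrable_flux hΩ hΩb hp (Lp.memLp _) (Lp.memLp _)
  have heform : ∀ᵐ x ∂μ, e x = 1 / (1 + (((w k).1 - (w l).1 : Lp ℝ (ENNReal.ofReal p) μ) x / δ) ^ 2) *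
      (flux p (A x) ((w k).2 x) ((w k).2 x - (w l).2 x) -
        flux p (A x) ((w l).2 x) ((w k).2 x - (w l).2 x)) := by
    filter_upwards [hz2, Lp.coeFn_sub (w k).2 (w l).2] with x h1 h2
    have h3 : (w k - w l).2 x = (w k).2 x - (w l).2 x := h2
    simp only [he, h1, h3, flux_smul_right, mul_sub]
    rfl
  have he0 : 0 ≤ᵐ[μ] e := by
    filter_upwards [heform, hΩae] with x hx hxΩ
    rw [hx]
    exact mul_nonneg (by positivity) ((hM x (subset_closure hxΩ)).flux_sub_nonneg hτ hp _ _).1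
  have heint : ∫ x, e x ∂μ ≤ m / 2 * (s / 4) := by
    rw [he, integral_sub (hi k) (hi l)]
    have h1 := hres k z hz (2 * δ) (by positivity) hzb
    have h2 := hres l z hz (2 * δ) (by positivity) hzb
    have h3 : ∀ k ≥ max N₁ N₂, ε k * ‖z‖ ≤ s * m / 32 := by
      intro k hk
      have h4 := (hN₂ k ((le_max_right _ _).trans hk)).le
      calc ε k * ‖z‖ ≤ s * m / (64 * (C + 1)) * (2 * C) := by gcongr
        _ = s * m / 32 * (C / (C + 1)) := by field_simp; ring
        _ ≤ s * m / 32 * 1 := by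
            gcongr
            rw [div_le_one (by positivity)]; linarith
        _ = s * m / 32 := mul_one _
    have h5 : D * (2 * δ) ≤ s * m / 32 := by
      calc D * (2 * δ) = s * m / 32 * (D / (D + 1)) := by rw [hδ]; field_simp; ring
        _ ≤ s * m / 32 * 1 := by
            gcongr
            rw [div_le_one (by positivity)]; linarith
        _ = s * m / 32 := mul_one _
    have h6 := h3 k hk
    have h7 := h3 l hl
    have h8 := (le_abs_self _).trans h1
    have h9 := (neg_le_abs _).trans h2
    linarith
  have hdefect : μ.real {x | m / 2 ≤ e x} ≤ s / 4 := by
    have h := (mul_meas_ge_le_integral_of_nonneg he0 ((hi k).sub (hi l)) (m / 2)).trans heint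
    exact le_of_mul_le_mul_left h (by positivity)
  -- conclusion
  have hsub : {x | s ≤ ‖(w k).2 x - (w l).2 x‖} ≤ᵐ[μ]
      (({x | R ≤ ‖(w k).2 x‖} ∪ {x | R ≤ ‖(w l).2 x‖}) ∪
        ({x | δ ≤ ‖((w k).1 - (w l).1 : Lp ℝ (ENNReal.ofReal p) μ) x‖} ∪ {x | m / 2 ≤ e x}) :
        Set (Eucl n)) := by
    filter_upwards [heform, hΩae] with x hx hxΩ hxs
    by_contra hcon
    have hxs : s ≤ ‖(w k).2 x - (w l).2 x‖ := hxs
    obtain ⟨h12, h34⟩ := not_or.1 hcon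
    obtain ⟨h1, h2⟩ := not_or.1 h12
    obtain ⟨h3, h4⟩ := not_or.1 h34
    have h1 : ‖(w k).2 x‖ < R := not_le.1 h1
    have h2 : ‖(w l).2 x‖ < R := not_le.1 h2
    have h3 : ‖((w k).1 - (w l).1 : Lp ℝ (ENNReal.ofReal p) μ) x‖ < δ := not_le.1 h3
    have h4 : e x < m / 2 := not_le.1 h4
    rw [hx] at h4
    have h5 := hmono _ ⟨x, subset_closure hxΩ, rfl⟩ _ _ h1.le h2.le hxs
    have h6 : (1 : ℝ) / 2 ≤ 1 / (1 + (((w k).1 - (w l).1 : Lp ℝ (ENNReal.ofReal p) μ) x / δ) ^ 2) := by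
      apply one_div_le_one_div_of_le (by positivity)
      have : (((w k).1 - (w l).1 : Lp ℝ (ENNReal.ofReal p) μ) x / δ) ^ 2 ≤ 1 := by
        rw [sq_le_one_iff_abs_le_one, abs_div, abs_of_pos hδ0, div_le_one hδ0]
        exact h3.le
      linarith
    have h7 : 1 / 2 * m ≤ 1 / (1 + (((w k).1 - (w l).1 : Lp ℝ (ENNReal.ofReal p) μ) x / δ) ^ 2) *
        (flux p (A x) ((w k).2 x) ((w k).2 x - (w l).2 x) -
        flux p (A x) ((w l).2 x) ((w k).2 x - (w l).2 x)) := mul_le_mul h6 h5 hm.le (by positivity)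
    linarith
  refine (measure_mono_ae hsub).trans ?_
  rw [← ofReal_measureReal (measure_ne_top _ _)]
  refine ENNReal.ofReal_le_ofReal ((measureReal_union_le _ _).trans ?_)
  have h1 := measureReal_union_le (μ := μ) {x | R ≤ ‖(w k).2 x‖} {x | R ≤ ‖(w l).2 x‖}
  have h2 := measureReal_union_le (μ := μ)
    {x | δ ≤ ‖((w k).1 - (w l).1 : Lp ℝ (ENNReal.ofReal p) μ) x‖} {x | m / 2 ≤ e x}
  linarith [hlarge k, hlarge l]

end GradientConvergence

/-! ### Energy and potential functionals on vectors of Sobolev functions. -/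

section Functionals

variable {n d : ℕ} {Ω : Set (Eucl n)} {p : ℝ} [Fact (1 ≤ ENNReal.ofReal p)]
  {A : Eucl n → Matrix (Fin n) (Fin n) ℝ} {q : ℝ}

/-- The values of a vector of Sobolev functions. -/
noncomputable def values (u : Fin d → sobolevZero Ω p) (x : Eucl n) : Eucl d :=
  WithLp.toLp 2 fun j => (u j : LpPair Ω p).1 x

/-- `∑ⱼ ∫_Ω ⟨A ∇uⱼ, ∇uⱼ⟩^(p/2)`. -/
noncomputable def energy (A : Eucl n → Matrix (Fin n) (Fin n) ℝ) (u : Fin d → sobolevZero Ω p) : ℝ :=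
  ∑ j, ∫ x in Ω, matForm (A x) ((u j : LpPair Ω p).2 x) ((u j : LpPair Ω p).2 x) ^ (p / 2)

/-- `∫_Ω H(u)`. -/
noncomputable def potential (H : Eucl d → ℝ) (u : Fin d → sobolevZero Ω p) : ℝ :=
  ∫ x in Ω, H (values u x)

theorem exists_sobolev_embedding (hΩb : Bornology.IsBounded Ω) (hp : 1 < p) (hpn : p < n)
    (hq1 : 1 ≤ q) (hq : q ≤ critExp n p) [Fact (1 ≤ ENNReal.ofReal q)] :
    ∃ ι : sobolevZero Ω p →L[ℝ] Lp ℝ (ENNReal.ofReal q) (volume.restrict Ω),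
      ∀ w, ι w =ᵐ[volume.restrict Ω] (w : LpPair Ω p).1 := by
  obtain ⟨C, hC, h⟩ := eLpNorm_le_norm_snd hΩb hp hpn hq1 hq
  let L : sobolevZero Ω p →ₗ[ℝ] Lp ℝ (ENNReal.ofReal q) (volume.restrict Ω) :=
    { toFun := fun w => (h w w.2).1.toLp _
      map_add' := fun w z => by
        rw [← MemLp.toLp_add]
        exact MemLp.toLp_congr _ _ (Lp.coeFn_add (w : LpPair Ω p).1 (z : LpPair Ω p).1)
      map_smul' := fun c w => by
        rw [RingHom.id_apply, ← MemLp.toLp_const_smul]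
        exact MemLp.toLp_congr _ _ (Lp.coeFn_smul c (w : LpPair Ω p).1) }
  refine ⟨L.mkContinuous C fun w => ?_, fun w => (h w w.2).1.coeFn_toLp⟩
  change ‖(h w w.2).1.toLp _‖ ≤ _
  rw [Lp.norm_toLp]
  refine (ENNReal.toReal_le_of_le_ofReal (by positivity) (h w w.2).2).trans ?_
  gcongr
  exact norm_snd_le _

/-- As a continuous linear map, this lets regularity of integral functionals on `L^q` be pulled back
to the Sobolev space. -/
theorem exists_values_embedding (hΩb : Bornology.IsBounded Ω) (hp : 1 < p) (hpn : p < n)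
    (hq1 : 1 ≤ q) (hq : q ≤ critExp n p) [Fact (1 ≤ ENNReal.ofReal q)] (d : ℕ) :
    ∃ ι : (Fin d → sobolevZero Ω p) →L[ℝ] Lp (Eucl d) (ENNReal.ofReal q) (volume.restrict Ω),
      ∀ u, ι u =ᵐ[volume.restrict Ω] values u := by
  obtain ⟨ι, hι⟩ := exists_sobolev_embedding (Ω := Ω) hΩb hp hpn hq1 hq
  let S : Fin d → ℝ →L[ℝ] Eucl d := fun j =>
    (ContinuousLinearMap.id ℝ ℝ).smulRight (EuclideanSpace.single j (1 : ℝ))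
  refine ⟨∑ j, ((S j).compLpL (ENNReal.ofReal q) (volume.restrict Ω)).comp
    (ι.comp (ContinuousLinearMap.proj j)), fun u => ?_⟩
  have h1 : ∀ᵐ x ∂(volume.restrict Ω), ∀ j,
      (S j).compLpL (ENNReal.ofReal q) (volume.restrict Ω) (ι (u j)) x =
        (u j : LpPair Ω p).1 x • EuclideanSpace.single j (1 : ℝ) := by
    refine ae_all_iff.2 fun j => ?_
    filter_upwards [(S j).coeFn_compLpL (p := ENNReal.ofReal q) (ι (u j)), hι (u j)] with x a b
    rw [a, b]
    simp [S]
  have h2 : ((∑ j, ((S j).compLpL (ENNReal.ofReal q) (volume.restrict Ω)).comp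
      (ι.comp (ContinuousLinearMap.proj j))) u : Lp (Eucl d) (ENNReal.ofReal q) (volume.restrict Ω))
      = ∑ j, (S j).compLpL (ENNReal.ofReal q) (volume.restrict Ω) (ι (u j)) := by
    simp
  rw [h2]
  filter_upwards [h1, Lp.coeFn_finsetSum Finset.univ
    (fun j => (S j).compLpL (ENNReal.ofReal q) (volume.restrict Ω) (ι (u j)))] with x a b
  rw [b, Finset.sum_apply]
  simp only [a]
  ext i
  have h3 : ∀ j, (u j : LpPair Ω p).1 x * (Pi.single j (1 : ℝ) : Fin d → ℝ) i =
      if i = j then (u j : LpPair Ω p).1 x else 0 := fun j => by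
    rw [Pi.single_apply, mul_ite, mul_one, mul_zero]
  simp [values, h3]

theorem values_add_smul (u φ : Fin d → sobolevZero Ω p) (t : ℝ) :
    values (u + t • φ) =ᵐ[volume.restrict Ω] fun x => values u x + t • values φ x := by
  have h : ∀ᵐ x ∂(volume.restrict Ω), ∀ j,
      ((u + t • φ) j : LpPair Ω p).1 x = (u j : LpPair Ω p).1 x + t * (φ j : LpPair Ω p).1 x := by
    refine ae_all_iff.2 fun j => ?_
    filter_upwards [Lp.coeFn_add (u j : LpPair Ω p).1 (t • (φ j : LpPair Ω p).1),
      Lp.coeFn_smul t (φ j : LpPair Ω p).1] with x a b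
    have : ((u + t • φ) j : LpPair Ω p).1 = (u j : LpPair Ω p).1 + t • (φ j : LpPair Ω p).1 := rfl
    rw [this, a, Pi.add_apply, b, Pi.smul_apply, smul_eq_mul]
  filter_upwards [h] with x hx
  ext j
  exact hx j

theorem values_smul (u : Fin d → sobolevZero Ω p) (t : ℝ) :
    values (t • u) =ᵐ[volume.restrict Ω] fun x => t • values u x := by
  have h : ∀ᵐ x ∂(volume.restrict Ω), ∀ j,
      ((t • u) j : LpPair Ω p).1 x = t * (u j : LpPair Ω p).1 x := by
    refine ae_all_iff.2 fun j => ?_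
    filter_upwards [Lp.coeFn_smul t (u j : LpPair Ω p).1] with x b
    have : ((t • u) j : LpPair Ω p).1 = t • (u j : LpPair Ω p).1 := rfl
    rw [this, b, Pi.smul_apply, smul_eq_mul]
  filter_upwards [h] with x hx
  ext j
  exact hx j

theorem values_single (j : Fin d) (z : sobolevZero Ω p) :
    values (Pi.single j z : Fin d → sobolevZero Ω p) =ᵐ[volume.restrict Ω]
      fun x => (z : LpPair Ω p).1 x • EuclideanSpace.single j (1 : ℝ) := by
  filter_upwards [Lp.coeFn_zero ℝ (ENNReal.ofReal p) (volume.restrict Ω)] with x hx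
  ext i
  by_cases hij : i = j
  · subst hij; simp [values]
  · simp only [values, Pi.single_eq_of_ne hij]
    change (0 : Lp ℝ (ENNReal.ofReal p) (volume.restrict Ω)) x = _
    rw [hx]
    simp [hij]

theorem memLp_values (hΩb : Bornology.IsBounded Ω) (hp : 1 < p) (hpn : p < n)
    (hq1 : 1 ≤ q) (hq : q ≤ critExp n p) (u : Fin d → sobolevZero Ω p) :
    MemLp (values u) (ENNReal.ofReal q) (volume.restrict Ω) := by
  have : Fact (1 ≤ ENNReal.ofReal q) := ⟨by simpa using hq1⟩
  obtain ⟨ι, hι⟩ := exists_values_embedding (Ω := Ω) hΩb hp hpn hq1 hq d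
  exact (Lp.memLp (ι u)).ae_eq (hι u)

theorem exists_lpNorm_values_le (hΩb : Bornology.IsBounded Ω) (hp : 1 < p) (hpn : p < n)
    (hq1 : 1 ≤ q) (hq : q ≤ critExp n p) (d : ℕ) :
    ∃ C : ℝ, 0 ≤ C ∧ ∀ u : Fin d → sobolevZero Ω p,
      lpNorm (values u) (ENNReal.ofReal q) (volume.restrict Ω) ≤ C * ‖u‖ := by
  have : Fact (1 ≤ ENNReal.ofReal q) := ⟨by simpa using hq1⟩
  obtain ⟨ι, hι⟩ := exists_values_embedding (Ω := Ω) hΩb hp hpn hq1 hq d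
  refine ⟨‖ι‖, norm_nonneg ι, fun u => ?_⟩
  rw [← toReal_eLpNorm (memLp_values hΩb hp hpn hq1 hq u).1, ← eLpNorm_congr_ae (hι u),
    ← Lp.norm_def]
  exact ι.le_opNorm u

variable {H : Eucl d → ℝ}

theorem continuous_potential (hΩb : Bornology.IsBounded Ω) (hp : 1 < p) (hpn : p < n)
    (hq1 : 1 < q) (hq : q ≤ critExp n p) (hH : ContDiff ℝ 1 H) (hHq : IsHomogeneous q H) :
    Continuous (potential H : (Fin d → sobolevZero Ω p) → ℝ) := by
  have : Fact (1 ≤ ENNReal.ofReal q) := ⟨by simpa using hq1.le⟩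
  obtain ⟨ι, hι⟩ := exists_values_embedding (Ω := Ω) hΩb hp hpn hq1.le hq d
  have h := ((hHq.isPowerIntegrand (volume.restrict Ω) hH hq1).continuous_Lp hq1).comp ι.continuous
  refine h.congr fun u => integral_congr_ae ?_
  filter_upwards [hι u] with x hx
  rw [hx]

theorem hasDerivAt_potential (hΩb : Bornology.IsBounded Ω) (hp : 1 < p) (hpn : p < n)
    (hq1 : 1 < q) (hq : q ≤ critExp n p) (hH : ContDiff ℝ 1 H) (hHq : IsHomogeneous q H)
    (u φ : Fin d → sobolevZero Ω p) :
    HasDerivAt (fun t : ℝ => potential H (u + t • φ))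
      (∫ x in Ω, fderiv ℝ H (values u x) (values φ x)) 0 := by
  have h := (hHq.isPowerIntegrand (volume.restrict Ω) hH hq1).hasDerivAt hq1
    (memLp_values hΩb hp hpn hq1.le hq u) (memLp_values hΩb hp hpn hq1.le hq φ)
  have heq : (fun t : ℝ => potential H (u + t • φ)) =
      fun t : ℝ => ∫ x in Ω, H (values u x + t • values φ x) := by
    ext t
    refine integral_congr_ae ?_
    filter_upwards [values_add_smul u φ t] with x hx
    rw [hx]
  rw [heq]
  exact h

theorem potential_smul (hHq : IsHomogeneous q H) {ρ : ℝ} (hρ : 0 < ρ)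
    (u : Fin d → sobolevZero Ω p) : potential H (ρ • u) = ρ ^ q * potential H u := by
  rw [potential, potential, ← integral_const_mul]
  refine integral_congr_ae ?_
  filter_upwards [values_smul u ρ] with x hx
  rw [hx, hHq ρ hρ]

theorem continuous_energy (hΩ : IsOpen Ω) (hΩb : Bornology.IsBounded Ω) (hp : 1 < p)
    (hA : IsCoefficient Ω A) :
    Continuous (energy A : (Fin d → sobolevZero Ω p) → ℝ) := by
  refine continuous_finsetSum _ fun j _ => ?_
  exact ((hA.isPowerIntegrand hΩ hΩb hp).continuous_Lp hp).comp
    (continuous_snd.comp (continuous_subtype_val.comp (continuous_apply j)))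

theorem hasDerivAt_energy (hΩ : IsOpen Ω) (hΩb : Bornology.IsBounded Ω) (hp : 1 < p)
    (hA : IsCoefficient Ω A) (u φ : Fin d → sobolevZero Ω p) :
    HasDerivAt (fun t : ℝ => energy A (u + t • φ))
      (∑ j, p * ∫ x in Ω, flux p (A x) ((u j : LpPair Ω p).2 x) ((φ j : LpPair Ω p).2 x)) 0 := by
  refine HasDerivAt.fun_sum fun j _ => ?_
  have h := (hA.isPowerIntegrand hΩ hΩb hp).hasDerivAt hp
    (Lp.memLp (u j : LpPair Ω p).2) (Lp.memLp (φ j : LpPair Ω p).2)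
  simp only [energyDeriv_apply, integral_const_mul] at h
  refine h.congr_of_eventuallyEq (Eventually.of_forall fun t => integral_congr_ae ?_)
  filter_upwards [Lp.coeFn_add (u j : LpPair Ω p).2 (t • (φ j : LpPair Ω p).2),
      Lp.coeFn_smul t (φ j : LpPair Ω p).2] with x a b
  have : ((u + t • φ) j : LpPair Ω p).2 = (u j : LpPair Ω p).2 + t • (φ j : LpPair Ω p).2 := rfl
  rw [this, a, Pi.add_apply, b, Pi.smul_apply]

theorem energy_smul (hΩ : IsOpen Ω) (hΩb : Bornology.IsBounded Ω) (hA : IsCoefficient Ω A)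
    {ρ : ℝ} (hρ : 0 < ρ) (u : Fin d → sobolevZero Ω p) :
    energy A (ρ • u) = ρ ^ p * energy A u := by
  obtain ⟨τ, B, hτ, hB, hM⟩ := hA.exists_isEllipticMatrix hΩb
  rw [energy, energy, Finset.mul_sum]
  refine Finset.sum_congr rfl fun j _ => ?_
  rw [← integral_const_mul]
  refine integral_congr_ae ?_
  filter_upwards [Lp.coeFn_smul ρ (u j : LpPair Ω p).2, ae_restrict_mem hΩ.measurableSet]
    with x hx hxΩ
  have : ((ρ • u) j : LpPair Ω p).2 = ρ • (u j : LpPair Ω p).2 := rfl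
  rw [this, hx, Pi.smul_apply, matForm_smul_left, matForm_smul_right, ← mul_assoc,
    Real.mul_rpow (by positivity) ((hM x (subset_closure hxΩ)).nonneg hτ _), ← pow_two,
    ← Real.rpow_natCast, ← Real.rpow_mul hρ.le]
  congr 2
  push_cast
  ring

/-- The gradient controls the full norm by the Sobolev bound with `q = p`, and ellipticity turns the
gradient norm into energy. -/
theorem exists_norm_rpow_le_energy (hΩ : IsOpen Ω) (hΩb : Bornology.IsBounded Ω) (hp : 1 < p)
    (hpn : p < n) (hA : IsCoefficient Ω A) (d : ℕ) :
    ∃ c : ℝ, 0 < c ∧ ∀ u : Fin d → sobolevZero Ω p, ‖u‖ ^ p ≤ c * energy A u := by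
  have hp0 : 0 < p := by linarith
  obtain ⟨τ, B, hτ, hB, hM⟩ := hA.exists_isEllipticMatrix hΩb
  obtain ⟨C, hC, hS⟩ := eLpNorm_le_norm_snd (Ω := Ω) hΩb hp hpn hp.le (lt_critExp hp hpn).le
  have hnorm : ∀ w : sobolevZero Ω p, ‖w‖ ≤ (C + 1) * ‖(w : LpPair Ω p).2‖ := by
    intro w
    have h1 : ‖(w : LpPair Ω p).1‖ ≤ C * ‖(w : LpPair Ω p).2‖ := by
      rw [Lp.norm_def]
      exact ENNReal.toReal_le_of_le_ofReal (by positivity) (hS w w.2).2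
    refine max_le (h1.trans ?_) ?_
    · gcongr; linarith
    · exact le_mul_of_one_le_left (norm_nonneg _) (by linarith)
  have hterm : ∀ (u : Fin d → sobolevZero Ω p) j, √τ ^ p * ‖(u j : LpPair Ω p).2‖ ^ p ≤
      ∫ x in Ω, matForm (A x) ((u j : LpPair Ω p).2 x) ((u j : LpPair Ω p).2 x) ^ (p / 2) := by
    intro u j
    rw [← lpNorm_coe_eq_norm, lpNorm_rpow_eq_integral hp0 (Lp.memLp _), ← integral_const_mul]
    refine integral_mono_ae ((integrable_norm_rpow_of_memLp hp0 (Lp.memLp _)).const_mul _)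
      ((hA.isPowerIntegrand hΩ hΩb hp).integrable hp (Lp.memLp (u j : LpPair Ω p).2)) ?_
    filter_upwards [ae_restrict_mem hΩ.measurableSet] with x hx
    have hE := hM x (subset_closure hx)
    rw [Real.rpow_div_two_eq_sqrt _ (hE.nonneg hτ _), ← Real.mul_rpow (Real.sqrt_nonneg _)
      (norm_nonneg _)]
    refine Real.rpow_le_rpow (by positivity) ?_ hp0.le
    rw [← Real.sqrt_sq (norm_nonneg ((u j : LpPair Ω p).2 x)), ← Real.sqrt_mul hτ.le]
    exact Real.sqrt_le_sqrt (hE.lower _)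
  have hτp : 0 < √τ ^ p := Real.rpow_pos_of_pos (Real.sqrt_pos.2 hτ) _
  have hnn : ∀ (u : Fin d → sobolevZero Ω p), ∀ j ∈ Finset.univ, 0 ≤
      ∫ x in Ω, matForm (A x) ((u j : LpPair Ω p).2 x) ((u j : LpPair Ω p).2 x) ^ (p / 2) :=
    fun u j _ => le_trans (by positivity) (hterm u j)
  refine ⟨(C + 1) ^ p / √τ ^ p, by positivity, fun u => ?_⟩
  have hE0 : 0 ≤ energy A u := Finset.sum_nonneg (hnn u)
  have hle : ‖u‖ ≤ ((C + 1) ^ p / √τ ^ p * energy A u) ^ (1 / p) := by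
    refine (pi_norm_le_iff_of_nonneg (by positivity)).2 fun j => (hnorm (u j)).trans ?_
    rw [← Real.rpow_le_rpow_iff (by positivity) (by positivity) hp0, ← Real.rpow_mul (by positivity),
      one_div_mul_cancel hp0.ne', Real.rpow_one, Real.mul_rpow (by positivity) (norm_nonneg _),
      div_mul_eq_mul_div, mul_div_assoc]
    gcongr
    rw [le_div_iff₀ hτp, mul_comm]
    exact (hterm u j).trans (Finset.single_le_sum (hnn u) (Finset.mem_univ j))
  calc ‖u‖ ^ p ≤ (((C + 1) ^ p / √τ ^ p * energy A u) ^ (1 / p)) ^ p := by gcongr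
    _ = _ := by rw [← Real.rpow_mul (by positivity), one_div_mul_cancel hp0.ne', Real.rpow_one]

end Functionals

/-! ### Compactness of almost solutions and the limiting Euler–Lagrange equation. -/

section Variational

variable {n d : ℕ} {Ω : Set (Eucl n)} {p : ℝ}
  {A : Eucl n → Matrix (Fin n) (Fin n) ℝ} {q : ℝ}

theorem tendsto_integral_flux (hΩ : IsOpen Ω) (hΩb : Bornology.IsBounded Ω)
    (hA : IsCoefficient Ω A) (hp : 1 < p) {C : ℝ}
    {w : ℕ → Lp (Eucl n) (ENNReal.ofReal p) (volume.restrict Ω)}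
    {v z : Lp (Eucl n) (ENNReal.ofReal p) (volume.restrict Ω)} (hC : ∀ k, ‖w k‖ ≤ C)
    (hlim : ∀ᵐ x ∂(volume.restrict Ω), Tendsto (fun k => w k x) atTop (𝓝 (v x))) :
    Tendsto (fun k => ∫ x in Ω, flux p (A x) (w k x) (z x)) atTop
      (𝓝 (∫ x in Ω, flux p (A x) (v x) (z x))) := by
  have : IsFiniteMeasure (volume.restrict Ω) := ⟨by simpa using hΩb.measure_lt_top⟩
  obtain ⟨τ, B, hτ, hB, hM⟩ := hA.exists_isEllipticMatrix hΩb
  refine tendsto_integral_of_le_rpow_mul hp (C := √B ^ p) (M := C) (by positivity)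
    (fun k => Lp.memLp (w k)) (fun k => (lpNorm_coe_eq_norm _ _).le.trans (hC k)) (Lp.memLp z)
    (fun k => hA.aestronglyMeasurable_flux hΩ (Lp.memLp (w k)).1 (Lp.memLp z).1) (fun k => ?_)
    (hA.integrable_flux hΩ hΩb hp (Lp.memLp v) (Lp.memLp z)) ?_
  · filter_upwards [ae_restrict_mem hΩ.measurableSet] with x hx
    rw [← mul_assoc]
    exact (hM x (subset_closure hx)).abs_flux_le hτ hB hp _ _
  · filter_upwards [ae_restrict_mem hΩ.measurableSet, hlim] with x hx hxlim
    have hE := hM x (subset_closure hx)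
    have hcont := continuousOn_flux (n := n) hτ hB hp (A x, v x, z x) ⟨hE, Set.mem_univ _⟩
    refine Tendsto.comp (g := fun y : Matrix (Fin n) (Fin n) ℝ × Eucl n × Eucl n =>
      flux p y.1 y.2.1 y.2.2) (f := fun k => (A x, w k x, z x)) hcont ?_
    refine tendsto_nhdsWithin_iff.2 ⟨?_, Eventually.of_forall fun k => ⟨hE, Set.mem_univ _⟩⟩
    exact tendsto_const_nhds.prodMk_nhds (hxlim.prodMk_nhds tendsto_const_nhds)

variable [Fact (1 ≤ ENNReal.ofReal p)]

theorem eLpNorm_coe_eq_ofReal_norm {X V : Type*} [MeasurableSpace X] {μ : Measure X}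
    [NormedAddCommGroup V] {P : ℝ≥0∞} (f : Lp V P μ) : eLpNorm f P μ = ENNReal.ofReal ‖f‖ := by
  rw [Lp.norm_def, ENNReal.ofReal_toReal (Lp.eLpNorm_ne_top f)]

/-- A bounded sequence of almost solutions has a subsequence that converges a.e., together with
the gradients, to an element of `W₀^{1,p}`. -/
theorem exists_subseq_tendsto_ae_of_residual (hΩ : IsOpen Ω) (hΩb : Bornology.IsBounded Ω)
    (hA : IsCoefficient Ω A) (hp : 1 < p) (hpn : p < n) {C D : ℝ} (hD : 0 ≤ D) {ε : ℕ → ℝ}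
    (hε : Tendsto ε atTop (𝓝 0)) {w : ℕ → sobolevZero Ω p} (hC : ∀ k, ‖w k‖ ≤ C)
    (hres : ∀ k, ∀ z ∈ sobolevZero Ω p, ∀ M : ℝ, 0 ≤ M →
      (∀ᵐ x ∂(volume.restrict Ω), |z.1 x| ≤ M) →
      |∫ x in Ω, flux p (A x) ((w k : LpPair Ω p).2 x) (z.2 x)| ≤ D * M + ε k * ‖z‖) :
    ∃ (u : sobolevZero Ω p) (σ : ℕ → ℕ), StrictMono σ ∧
      (∀ᵐ x ∂(volume.restrict Ω),
        Tendsto (fun k => (w (σ k) : LpPair Ω p).1 x) atTop (𝓝 ((u : LpPair Ω p).1 x))) ∧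
      ∀ᵐ x ∂(volume.restrict Ω),
        Tendsto (fun k => (w (σ k) : LpPair Ω p).2 x) atTop (𝓝 ((u : LpPair Ω p).2 x)) := by
  have : IsFiniteMeasure (volume.restrict Ω) := ⟨by simpa using hΩb.measure_lt_top⟩
  obtain ⟨u₁, σ, hσ, h1, h2⟩ := exists_subseq_tendsto_of_bounded hΩ hΩb hp hpn
    (fun k => (w k).2) hC
  obtain ⟨θ, hθ, h3⟩ := exists_subseq_gradient_tendsto_ae hΩ hΩb hA hp hD
    (hε.comp hσ.tendsto_atTop) (fun k => (w (σ k)).2) (fun k => hC (σ k)) h1.cauchySeq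
    (fun k => hres (σ k))
  obtain ⟨v, -, hv⟩ := exists_stronglyMeasurable_limit_of_tendsto_ae
    (fun k => (Lp.memLp (w (σ (θ k)) : LpPair Ω p).2).1) h3
  have hC2 : ∀ k, ‖(w k : LpPair Ω p).2‖ ≤ C := fun k => (norm_snd_le _).trans (hC k)
  have hvL := (memLp_of_tendsto_ae (Q := ENNReal.ofReal p) (M := C)
    (fun k => (Lp.memLp (w (σ (θ k)) : LpPair Ω p).2).1)
    (fun k => by
      rw [eLpNorm_coe_eq_ofReal_norm]
      exact ENNReal.ofReal_le_ofReal (hC2 _)) hv).1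
  have hlim2 : ∀ᵐ x ∂(volume.restrict Ω),
      Tendsto (fun k => (w (σ (θ k)) : LpPair Ω p).2 x) atTop (𝓝 (hvL.toLp v x)) := by
    filter_upwards [hv, hvL.coeFn_toLp] with x a b
    rw [b]
    exact a
  refine ⟨⟨(u₁, hvL.toLp v), ?_⟩, σ ∘ θ, hσ.comp hθ, ?_, hlim2⟩
  · exact mem_sobolevZero_of_tendsto_ae hp (fun k => (w (σ (θ k))).2) (fun k => hC2 _)
      (h1.comp hθ.tendsto_atTop) hlim2
  · filter_upwards [h2] with x hx
    exact hx.comp hθ.tendsto_atTop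

/-- The version of `exists_subseq_tendsto_ae_of_residual` for vector valued functions. -/
theorem exists_subseq_values_tendsto_ae (hΩ : IsOpen Ω) (hΩb : Bornology.IsBounded Ω)
    (hA : IsCoefficient Ω A) (hp : 1 < p) (hpn : p < n) {C D : ℝ} (hD : 0 ≤ D) {ε : ℕ → ℝ}
    (hε : Tendsto ε atTop (𝓝 0)) {w : ℕ → Fin d → sobolevZero Ω p} (hC : ∀ k, ‖w k‖ ≤ C)
    (hres : ∀ k j, ∀ z ∈ sobolevZero Ω p, ∀ M : ℝ, 0 ≤ M →
      (∀ᵐ x ∂(volume.restrict Ω), |z.1 x| ≤ M) →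
      |∫ x in Ω, flux p (A x) ((w k j : LpPair Ω p).2 x) (z.2 x)| ≤ D * M + ε k * ‖z‖) :
    ∃ (u : Fin d → sobolevZero Ω p) (σ : ℕ → ℕ), StrictMono σ ∧
      (∀ᵐ x ∂(volume.restrict Ω),
        Tendsto (fun k => values (w (σ k)) x) atTop (𝓝 (values u x))) ∧
      ∀ j, ∀ᵐ x ∂(volume.restrict Ω),
        Tendsto (fun k => (w (σ k) j : LpPair Ω p).2 x) atTop (𝓝 ((u j : LpPair Ω p).2 x)) := by
  -- Components are treated one at a time, passing to a further subsequence for each.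
  have key : ∀ s : Finset (Fin d), ∃ σ : ℕ → ℕ, StrictMono σ ∧ ∀ j ∈ s,
      ∃ u : sobolevZero Ω p, (∀ᵐ x ∂(volume.restrict Ω),
        Tendsto (fun k => (w (σ k) j : LpPair Ω p).1 x) atTop (𝓝 ((u : LpPair Ω p).1 x))) ∧
      ∀ᵐ x ∂(volume.restrict Ω),
        Tendsto (fun k => (w (σ k) j : LpPair Ω p).2 x) atTop (𝓝 ((u : LpPair Ω p).2 x)) := by
    intro s
    induction s using Finset.induction_on with
    | empty => exact ⟨id, strictMono_id, by simp⟩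
    | insert i s his ih =>
      obtain ⟨σ, hσ, h⟩ := ih
      obtain ⟨u, θ, hθ, h1, h2⟩ := exists_subseq_tendsto_ae_of_residual hΩ hΩb hA hp hpn hD
        (hε.comp hσ.tendsto_atTop) (w := fun k => w (σ k) i)
        (fun k => (norm_le_pi_norm (w (σ k)) i).trans (hC _)) (fun k => hres (σ k) i)
      refine ⟨σ ∘ θ, hσ.comp hθ, fun j hj => ?_⟩
      rcases Finset.mem_insert.1 hj with rfl | hj
      · exact ⟨u, h1, h2⟩
      · obtain ⟨u', h1', h2'⟩ := h j hj
        refine ⟨u', ?_, ?_⟩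
        · filter_upwards [h1'] with x hx using hx.comp hθ.tendsto_atTop
        · filter_upwards [h2'] with x hx using hx.comp hθ.tendsto_atTop
  obtain ⟨σ, hσ, h⟩ := key Finset.univ
  choose u hu using fun j => h j (Finset.mem_univ j)
  refine ⟨u, σ, hσ, ?_, fun j => (hu j).2⟩
  filter_upwards [ae_all_iff.2 fun j => (hu j).1] with x hx
  exact ((PiLp.continuous_toLp 2 _).tendsto _).comp (tendsto_pi_nhds.2 hx)

/-- The bound by `‖φ‖` controls the Ekeland error. The bound by the supremum of the test function is
the form required by Boccardo–Murat, and it holds at the critical exponent too. -/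
theorem exists_abs_integral_fderiv_le {H : Eucl d → ℝ} (hΩb : Bornology.IsBounded Ω) (hp : 1 < p)
    (hpn : p < n) (hq1 : 1 < q) (hq : q ≤ critExp n p) (hH : ContDiff ℝ 1 H)
    (hHq : IsHomogeneous q H) (C : ℝ) :
    ∃ K : ℝ, 0 ≤ K ∧ ∀ u φ : Fin d → sobolevZero Ω p, ‖u‖ ≤ C →
      |∫ x in Ω, fderiv ℝ H (values u x) (values φ x)| ≤ K * ‖φ‖ ∧
      ∀ M : ℝ, 0 ≤ M → (∀ᵐ x ∂(volume.restrict Ω), ‖values φ x‖ ≤ M) →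
        |∫ x in Ω, fderiv ℝ H (values u x) (values φ x)| ≤ K * M := by
  have : IsFiniteMeasure (volume.restrict Ω) := ⟨by simpa using hΩb.measure_lt_top⟩
  obtain ⟨K, hK, hb⟩ :=
    (hHq.isPowerIntegrand (volume.restrict Ω) hH hq1).abs_integral_deriv_le hq1
  obtain ⟨S, hS, hSb⟩ := exists_lpNorm_values_le (Ω := Ω) hΩb hp hpn hq1.le hq d
  set Q := ENNReal.ofReal q with hQ
  set V : ℝ := ((volume.restrict Ω) Set.univ ^ Q.toReal⁻¹).toReal with hV
  have hV0 : 0 ≤ V := ENNReal.toReal_nonneg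
  have hbound : ∀ u φ : Fin d → sobolevZero Ω p, ‖u‖ ≤ C → ∀ N : ℝ, 0 ≤ N →
      lpNorm (values φ) Q (volume.restrict Ω) ≤ (S + V) * N →
      |∫ x in Ω, fderiv ℝ H (values u x) (values φ x)| ≤
        (K * ((S * |C|) ^ (q - 1) * (S + V))) * N := by
    intro u φ hu N hN hφ
    refine (hb _ _ (memLp_values hΩb hp hpn hq1.le hq u)
      (memLp_values hΩb hp hpn hq1.le hq φ)).trans ?_
    have h1 : lpNorm (values u) Q (volume.restrict Ω) ≤ S * |C| :=
      (hSb u).trans (by gcongr; exact hu.trans (le_abs_self C))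
    have hq0 : 0 ≤ q - 1 := by linarith
    calc _ ≤ K * ((S * |C|) ^ (q - 1) * ((S + V) * N)) := by
          gcongr
          · exact lpNorm_nonneg
          · exact lpNorm_nonneg
      _ = _ := by ring
  refine ⟨K * ((S * |C|) ^ (q - 1) * (S + V)), by positivity, fun u φ hu => ⟨?_, ?_⟩⟩
  · exact hbound u φ hu _ (norm_nonneg φ) ((hSb φ).trans (by gcongr; linarith))
  · intro M hM hφM
    refine hbound u φ hu M hM ?_
    have h1 := eLpNorm_le_of_ae_bound (p := Q) hφM
    rw [← toReal_eLpNorm (memLp_values hΩb hp hpn hq1.le hq φ).1]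
    have hfin : (volume.restrict Ω) Set.univ ^ Q.toReal⁻¹ ≠ ⊤ :=
      ENNReal.rpow_ne_top_of_nonneg (by positivity) (measure_ne_top _ _)
    have h2 := ENNReal.toReal_mono (ENNReal.mul_ne_top hfin ENNReal.ofReal_ne_top) h1
    rw [ENNReal.toReal_mul, ENNReal.toReal_ofReal hM] at h2
    refine h2.trans ?_
    gcongr
    linarith

/-- The critical exponent is allowed: `φ` is fixed and the derivative grows with power `q - 1`, so
Vitali's theorem applies without strong convergence in `L^q`. -/
theorem tendsto_integral_fderiv {H : Eucl d → ℝ} (hΩb : Bornology.IsBounded Ω) (hp : 1 < p)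
    (hpn : p < n) (hq1 : 1 < q) (hq : q ≤ critExp n p) (hH : ContDiff ℝ 1 H)
    (hHq : IsHomogeneous q H) {C : ℝ} {w : ℕ → Fin d → sobolevZero Ω p}
    {u φ : Fin d → sobolevZero Ω p} (hC : ∀ k, ‖w k‖ ≤ C)
    (hlim : ∀ᵐ x ∂(volume.restrict Ω),
      Tendsto (fun k => values (w k) x) atTop (𝓝 (values u x))) :
    Tendsto (fun k => ∫ x in Ω, fderiv ℝ H (values (w k) x) (values φ x)) atTop
      (𝓝 (∫ x in Ω, fderiv ℝ H (values u x) (values φ x))) := by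
  have : IsFiniteMeasure (volume.restrict Ω) := ⟨by simpa using hΩb.measure_lt_top⟩
  have hI := hHq.isPowerIntegrand (volume.restrict Ω) hH hq1
  obtain ⟨K, hK, hb⟩ := hHq.norm_fderiv_le hH hq1
  obtain ⟨S, hS, hSb⟩ := exists_lpNorm_values_le (Ω := Ω) hΩb hp hpn hq1.le hq d
  have hm := fun v : Fin d → sobolevZero Ω p => memLp_values hΩb hp hpn hq1.le hq v
  refine tendsto_integral_of_le_rpow_mul hq1 (C := K) (M := S * C) hK
    (fun k => hm (w k)) (fun k => (hSb _).trans (by gcongr; exact hC k)) (hm φ)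
    (fun k => hI.meas' _ _ (hm (w k)).1 (hm φ).1) (fun k => ae_of_all _ fun x => ?_)
    (hI.integrable_deriv hq1 (hm u) (hm φ)) ?_
  · refine ((fderiv ℝ H (values (w k) x)).le_opNorm _).trans ?_
    rw [← mul_assoc]
    gcongr
    exact hb _
  · filter_upwards [hlim] with x hx
    have h : Continuous fun z : Eucl d × Eucl d => fderiv ℝ H z.1 z.2 :=
      ((hH.continuous_fderiv one_ne_zero).comp continuous_fst).clm_apply continuous_snd
    exact (h.tendsto (values u x, values φ x)).comp (hx.prodMk_nhds tendsto_const_nhds)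

/-- Since `p < critExp n p`, the critical bound upgrades a.e. convergence to strong convergence in
`L^p`. -/
theorem tendsto_potential {F : Eucl d → ℝ} (hΩb : Bornology.IsBounded Ω) (hp : 1 < p)
    (hpn : p < n) (hF : ContDiff ℝ 1 F) (hFp : IsHomogeneous p F) {C : ℝ}
    {w : ℕ → Fin d → sobolevZero Ω p} {u : Fin d → sobolevZero Ω p} (hC : ∀ k, ‖w k‖ ≤ C)
    (hlim : ∀ᵐ x ∂(volume.restrict Ω),
      Tendsto (fun k => values (w k) x) atTop (𝓝 (values u x))) :
    Tendsto (fun k => potential F (w k)) atTop (𝓝 (potential F u)) := by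
  have : IsFiniteMeasure (volume.restrict Ω) := ⟨by simpa using hΩb.measure_lt_top⟩
  have hpc := lt_critExp hp hpn
  obtain ⟨S, hS, hSb⟩ := exists_lpNorm_values_le (Ω := Ω) hΩb hp hpn (hp.trans hpc).le le_rfl d
  have hm := fun v : Fin d → sobolevZero Ω p =>
    memLp_values hΩb hp hpn (hp.trans hpc).le le_rfl v
  have hmp := fun v : Fin d → sobolevZero Ω p => memLp_values hΩb hp hpn hp.le hpc.le v
  have h1 := tendsto_eLpNorm_sub_of_tendsto_ae hp.le hpc (M := S * C) (fun k => (hm (w k)).1)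
    (fun k => by
      rw [← ENNReal.ofReal_toReal (hm (w k)).eLpNorm_ne_top, toReal_eLpNorm (hm (w k)).1]
      exact ENNReal.ofReal_le_ofReal ((hSb _).trans (by gcongr; exact hC k))) hlim
  have h2 := (Lp.tendsto_Lp_iff_tendsto_eLpNorm'' _ (fun k => hmp (w k)) _ (hmp u)).2 h1
  have h3 := (((hFp.isPowerIntegrand (volume.restrict Ω) hF hp).continuous_Lp hp).tendsto _).comp h2
  have h4 : ∀ v : Fin d → sobolevZero Ω p,
      ∫ x in Ω, F ((hmp v).toLp _ x) = potential F v := fun v =>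
    integral_congr_ae (by filter_upwards [(hmp v).coeFn_toLp] with x hx; rw [hx])
  simpa only [Function.comp_def, h4] using h3

set_option maxHeartbeats 2000000 in
/-- A constrained minimization problem for a coercive functional has a minimizing sequence that
converges a.e. to a solution of the Euler–Lagrange equation. The constraint is not claimed to pass
to the limit. -/
theorem exists_minimizing_seq_tendsto_solution {F H : Eucl d → ℝ} (hΩ : IsOpen Ω)
    (hΩb : Bornology.IsBounded Ω) (hA : IsCoefficient Ω A) (hp : 1 < p) (hpn : p < n)
    (hF : ContDiff ℝ 1 F) (hFp : IsHomogeneous p F)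
    (hq1 : 1 < q) (hq : q ≤ critExp n p) (hH : ContDiff ℝ 1 H) (hHq : IsHomogeneous q H)
    {c : ℝ} (hc : 0 < c)
    (hcoer : ∀ u : Fin d → sobolevZero Ω p, c * energy A u ≤ energy A u - potential F u)
    (hne : ∃ u : Fin d → sobolevZero Ω p, potential H u = 1) :
    ∃ (u : Fin d → sobolevZero Ω p) (w : ℕ → Fin d → sobolevZero Ω p) (S : ℝ),
      S = sInf ((fun u => energy A u - potential F u) ''
        {u : Fin d → sobolevZero Ω p | potential H u = 1}) ∧
      (∀ k, potential H (w k) = 1) ∧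
      Tendsto (fun k => energy A (w k) - potential F (w k)) atTop (𝓝 S) ∧
      (∀ P : Eucl d → ℝ, ContDiff ℝ 1 P → IsHomogeneous p P →
        Tendsto (fun k => potential P (w k)) atTop (𝓝 (potential P u))) ∧
      ∀ j, ∀ z : sobolevZero Ω p,
        p * ∫ x in Ω, flux p (A x) ((u j : LpPair Ω p).2 x) ((z : LpPair Ω p).2 x) =
          (∫ x in Ω, fderiv ℝ F (values u x) (values (Pi.single j z : Fin d → sobolevZero Ω p) x))
          + p / q * S *
            ∫ x in Ω, fderiv ℝ H (values u x)
              (values (Pi.single j z : Fin d → sobolevZero Ω p) x) := by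
  have hp0 : 0 < p := by linarith
  have hq0 : 0 < q := by linarith
  have hpc := (lt_critExp hp hpn).le
  obtain ⟨c₁, hc₁, hE⟩ := exists_norm_rpow_le_energy hΩ hΩb hp hpn hA d
  have hE0 : ∀ u : Fin d → sobolevZero Ω p, 0 ≤ energy A u := fun u =>
    nonneg_of_mul_nonneg_right ((by positivity : (0 : ℝ) ≤ ‖u‖ ^ p).trans (hE u)) hc₁
  obtain ⟨w, hw1, hw2, hw3⟩ := exists_minimizing_palais_smale (m := 0) (p := p) hq0
    (J := fun u : Fin d → sobolevZero Ω p => energy A u - potential F u) (K := potential H)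
    ((continuous_energy hΩ hΩb hp hA).sub (continuous_potential hΩb hp hpn hp hpc hF hFp))
    (continuous_potential hΩb hp hpn hq1 hq hH hHq)
    (fun u φ => (hasDerivAt_energy hΩ hΩb hp hA u φ).sub
      (hasDerivAt_potential hΩb hp hpn hp hpc hF hFp u φ))
    (fun u φ => hasDerivAt_potential hΩb hp hpn hq1 hq hH hHq u φ)
    (fun ρ hρ u => by
      rw [energy_smul hΩ hΩb hA hρ, potential_smul hFp hρ]
      ring)
    (fun ρ hρ u => potential_smul hHq hρ u) hne
    (fun u _ => le_trans (mul_nonneg hc.le (hE0 u)) (hcoer u))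
  set S := sInf ((fun u => energy A u - potential F u) ''
        {u : Fin d → sobolevZero Ω p | potential H u = 1}) with hS
  obtain ⟨B, hB⟩ := (Metric.isBounded_range_of_tendsto _ hw2).exists_norm_le
  replace hB : ∀ k, |energy A (w k) - potential F (w k)| ≤ B := fun k => hB _ ⟨k, rfl⟩
  have hB0 : 0 ≤ B := (abs_nonneg _).trans (hB 0)
  -- From `‖w‖ ^ p ≤ c₁ * energy` and coercivity with constant `c`, as the functional is bounded by
  -- `B` along the sequence.
  set C : ℝ := (c₁ * (B / c)) ^ (1 / p) with hCdef
  have hC : ∀ k, ‖w k‖ ≤ C := by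
    intro k
    rw [← Real.rpow_le_rpow_iff (norm_nonneg _) (by positivity) hp0, hCdef,
      ← Real.rpow_mul (by positivity), one_div_mul_cancel hp0.ne', Real.rpow_one]
    refine (hE _).trans ?_
    gcongr
    rw [le_div_iff₀ hc, mul_comm]
    exact (hcoer _).trans ((le_abs_self _).trans (hB k))
  have hC0 : 0 ≤ C := by positivity
  obtain ⟨KF, hKF, hKFb⟩ := exists_abs_integral_fderiv_le (Ω := Ω) hΩb hp hpn hp hpc hF hFp C
  obtain ⟨KH, hKH, hKHb⟩ := exists_abs_integral_fderiv_le (Ω := Ω) hΩb hp hpn hq1 hq hH hHq C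
  set R : (Fin d → sobolevZero Ω p) → Fin d → sobolevZero Ω p → ℝ := fun u j z =>
    p * ∫ x in Ω, flux p (A x) ((u j : LpPair Ω p).2 x) ((z : LpPair Ω p).2 x) with hR
  have hsum : ∀ u j z, ∑ i, p * ∫ x in Ω, flux p (A x) ((u i : LpPair Ω p).2 x)
      (((Pi.single j z : Fin d → sobolevZero Ω p) i : LpPair Ω p).2 x) = R u j z := by
    intro u j z
    rw [Finset.sum_eq_single j, Pi.single_eq_same]
    · intro i _ hij
      rw [Pi.single_eq_of_ne hij]
      have h0 : (((0 : sobolevZero Ω p) : LpPair Ω p).2 : Eucl n → Eucl n)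
          =ᵐ[volume.restrict Ω] 0 := Lp.coeFn_zero _ _ _
      rw [integral_congr_ae (g := fun _ => (0 : ℝ)), integral_zero, mul_zero]
      filter_upwards [h0] with x hx
      rw [hx]
      have := flux_smul_right (p := p) (M := A x) 0 ((u i : LpPair Ω p).2 x) 0
      simpa using this
    · simp
  set ε : ℕ → ℝ := fun k => 1 / ((k : ℝ) + 1) * (1 + 1 / q * KH * C) with hε
  have hεlim : Tendsto ε atTop (𝓝 0) := by
    have := (tendsto_one_div_add_atTop_nhds_zero_nat (𝕜 := ℝ)).mul_const (1 + 1 / q * KH * C)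
    rwa [zero_mul] at this
  have hnorm : ∀ (j : Fin d) (z : sobolevZero Ω p),
      ‖(Pi.single j z : Fin d → sobolevZero Ω p)‖ = ‖z‖ := fun j z =>
    Pi.norm_single (G := fun _ : Fin d => sobolevZero Ω p) (i := j) z
  have hres : ∀ k j z, |R (w k) j z - (∫ x in Ω, fderiv ℝ F (values (w k) x)
        (values (Pi.single j z : Fin d → sobolevZero Ω p) x)) -
      p / q * (energy A (w k) - potential F (w k)) * ∫ x in Ω, fderiv ℝ H (values (w k) x)
        (values (Pi.single j z : Fin d → sobolevZero Ω p) x)| ≤ ε k * ‖z‖ := by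
    intro k j z
    have h := hw3 k (Pi.single j z)
    rw [hsum, hnorm] at h
    refine h.trans ?_
    have h1 := (hKHb (w k) (Pi.single j z) (hC k)).1
    rw [hnorm] at h1
    calc _ ≤ 1 / ((k : ℝ) + 1) * (‖z‖ + 1 / q * (KH * ‖z‖) * C) := by
          gcongr
          exact hC k
      _ = _ := by rw [hε]; ring
  obtain ⟨u, σ, hσ, hu1, hu2⟩ := exists_subseq_values_tendsto_ae hΩ hΩb hA hp hpn
    -- The terms from `F` and `H` are bounded against the supremum of the test function and form
    -- `D`; only the Ekeland error needs the Sobolev norm.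
    (C := C) (D := (KF + p / q * B * KH) / p) (by positivity) (ε := fun k => ε k / p)
    (by simpa using hεlim.div_const p) hC (by
      intro k j z hz M hM hzM
      have h := hres k j ⟨z, hz⟩
      have hv : ∀ᵐ x ∂(volume.restrict Ω),
          ‖values (Pi.single j ⟨z, hz⟩ : Fin d → sobolevZero Ω p) x‖ ≤ M := by
        filter_upwards [values_single j (⟨z, hz⟩ : sobolevZero Ω p), hzM] with x a b
        rw [a, norm_smul]
        simpa using b
      have h1 := (hKFb (w k) (Pi.single j ⟨z, hz⟩) (hC k)).2 M hM hv
      have h2 := (hKHb (w k) (Pi.single j ⟨z, hz⟩) (hC k)).2 M hM hv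
      have h3 : |p / q * (energy A (w k) - potential F (w k)) *
          ∫ x in Ω, fderiv ℝ H (values (w k) x)
            (values (Pi.single j ⟨z, hz⟩ : Fin d → sobolevZero Ω p) x)| ≤
          p / q * B * (KH * M) := by
        rw [abs_mul, abs_mul, abs_of_pos (by positivity : 0 < p / q)]
        gcongr
        exact hB k
      have h4 : |R (w k) j ⟨z, hz⟩| ≤ (KF + p / q * B * KH) * M + ε k * ‖z‖ := by
        have h' : |_| ≤ ε k * ‖z‖ := h
        rw [abs_le] at h' h1 h3 ⊢
        constructor <;> nlinarith
      have h5 : R (w k) j ⟨z, hz⟩ =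
        p * ∫ x in Ω, flux p (A x) ((w k j : LpPair Ω p).2 x) (z.2 x) := rfl
      rw [h5, abs_mul, abs_of_pos hp0] at h4
      have h6 : (KF + p / q * B * KH) / p * M + ε k / p * ‖z‖ =
          ((KF + p / q * B * KH) * M + ε k * ‖z‖) / p := by ring
      rw [h6, le_div_iff₀ hp0]
      linarith)
  refine ⟨u, w ∘ σ, S, rfl, fun k => hw1 _, hw2.comp hσ.tendsto_atTop, fun P hP hPp =>
    tendsto_potential hΩb hp hpn hP hPp (fun k => hC _) hu1, fun j z => ?_⟩
  have t1 := (tendsto_integral_flux hΩ hΩb hA hp (C := C) (z := (z : LpPair Ω p).2)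
    (fun k => (norm_snd_le (w (σ k) j : LpPair Ω p)).trans
      ((norm_le_pi_norm (w (σ k)) j).trans (hC _))) (hu2 j)).const_mul p
  have t2 := tendsto_integral_fderiv hΩb hp hpn hp hpc hF hFp (φ := Pi.single j z)
    (fun k => hC (σ k)) hu1
  have t3 := tendsto_integral_fderiv hΩb hp hpn hq1 hq hH hHq (φ := Pi.single j z)
    (fun k => hC (σ k)) hu1
  -- The multiplier is the limit `S` of the functional along the sequence, not its value at `u`.
  have t4 := (t1.sub t2).sub (((hw2.comp hσ.tendsto_atTop).const_mul (p / q)).mul t3)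
  have t5 : Tendsto (fun k => ε (σ k) * ‖z‖) atTop (𝓝 0) := by
    have := (hεlim.comp hσ.tendsto_atTop).mul_const ‖z‖
    rwa [zero_mul] at this
  have t6 := squeeze_zero_norm (fun k => (Real.norm_eq_abs _).le.trans (hres (σ k) j z)) t5
  have := tendsto_nhds_unique t4 t6
  linarith

end Variational

/-! ### Bounds of a homogeneous function by its extrema on the `p`-sphere. -/

section Sphere

variable {d : ℕ} {p : ℝ}

theorem isCompact_pSphere (hp : 0 < p) : IsCompact (pSphere d p) := by
  refine Metric.isCompact_of_isClosed_isBounded ?_ ?_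
  · refine isClosed_eq (continuous_finsetSum _ fun j _ => ?_) continuous_const
    exact Continuous.rpow_const (by fun_prop) fun _ => Or.inr hp.le
  · have h1 : Bornology.IsBounded (Metric.closedBall (0 : Fin d → ℝ) 1) := Metric.isBounded_closedBall
    have h2 := ((PiLp.antilipschitzWith_ofLp 2 fun _ : Fin d => ℝ).isBounded_preimage h1)
    refine h2.subset fun s hs => ?_
    rw [Set.mem_preimage, mem_closedBall_zero_iff, pi_norm_le_iff_of_nonneg zero_le_one]
    intro j
    have h3 : |s j| ^ p ≤ 1 := by
      have hs : ∑ j, |s j| ^ p = 1 := hs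
      rw [← hs]
      exact Finset.single_le_sum (f := fun j => |s j| ^ p) (fun i _ => by positivity)
        (Finset.mem_univ j)
    exact le_of_not_gt fun h => absurd h3 (not_le.2 (Real.one_lt_rpow h hp))

theorem IsHomogeneous.sphereMin_mul_le_and_le_sphereMax_mul {F : Eucl d → ℝ}
    (hFp : IsHomogeneous p F) (hF : Continuous F) (hp : 0 < p) (s : Eucl d) :
    sphereMin p F * ∑ j, |s j| ^ p ≤ F s ∧ F s ≤ sphereMax p F * ∑ j, |s j| ^ p := by
  have hK := (isCompact_pSphere (d := d) hp).image hF
  have hnn : ∀ j ∈ Finset.univ, 0 ≤ |s j| ^ p := fun j _ => by positivity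
  rcases (Finset.sum_nonneg hnn).eq_or_lt with h0 | hpos
  · have hs : s = 0 := by
      ext j
      have := (Finset.sum_eq_zero_iff_of_nonneg hnn).1 h0.symm j (Finset.mem_univ j)
      simpa [Real.rpow_eq_zero_iff_of_nonneg (abs_nonneg (s j)), hp.ne'] using this
    rw [← h0, hs, hFp.map_zero hp]
    simp
  · set t := ∑ j, |s j| ^ p with ht
    have hr : 0 < t ^ (1 / p) := by positivity
    have hrp : (t ^ (1 / p)) ^ p = t := by
      rw [← Real.rpow_mul hpos.le, one_div_mul_cancel hp.ne', Real.rpow_one]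
    have hmem : (t ^ (1 / p))⁻¹ • s ∈ pSphere d p := by
      change ∑ j, |((t ^ (1 / p))⁻¹ • s) j| ^ p = 1
      have h : ∀ j, |((t ^ (1 / p))⁻¹ • s) j| ^ p = t⁻¹ * |s j| ^ p := fun j => by
        rw [PiLp.smul_apply, smul_eq_mul, abs_mul, abs_of_pos (by positivity),
          Real.mul_rpow (by positivity) (abs_nonneg _), Real.inv_rpow hr.le, hrp]
      simp only [h, ← Finset.mul_sum]
      exact inv_mul_cancel₀ hpos.ne'
    have hFs : F s = t * F ((t ^ (1 / p))⁻¹ • s) := by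
      conv_lhs => rw [← smul_inv_smul₀ hr.ne' s]
      rw [hFp _ hr, hrp]
    rw [hFs, mul_comm _ t, mul_comm _ t]
    exact ⟨mul_le_mul_of_nonneg_left (csInf_le hK.bddBelow ⟨_, hmem, rfl⟩) hpos.le,
      mul_le_mul_of_nonneg_left (le_csSup hK.bddAbove ⟨_, hmem, rfl⟩) hpos.le⟩

end Sphere

/-! ### Normalization and the lower energy bound on the constraint set. -/

section Potential

variable {n d : ℕ} {Ω : Set (Eucl n)} {p : ℝ} [Fact (1 ≤ ENNReal.ofReal p)]
  {A : Eucl n → Matrix (Fin n) (Fin n) ℝ} {q : ℝ} {H : Eucl d → ℝ}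

theorem integrable_comp_values (hΩb : Bornology.IsBounded Ω) (hp : 1 < p) (hpn : p < n)
    (hq1 : 1 < q) (hq : q ≤ critExp n p) (hH : ContDiff ℝ 1 H) (hHq : IsHomogeneous q H)
    (u : Fin d → sobolevZero Ω p) :
    Integrable (fun x => H (values u x)) (volume.restrict Ω) :=
  (hHq.isPowerIntegrand (volume.restrict Ω) hH hq1).integrable hq1
    (memLp_values hΩb hp hpn hq1.le hq u)

theorem IsPosHomogeneous.nonneg (h : IsPosHomogeneous q H) (hq : 0 < q) (s : Eucl d) : 0 ≤ H s := by
  by_cases hs : s = 0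
  · rw [hs, h.1.map_zero hq]
  · exact (h.2 s hs).le

theorem potential_pos (hΩb : Bornology.IsBounded Ω) (hp : 1 < p) (hpn : p < n)
    (hq1 : 1 < q) (hq : q ≤ critExp n p) (hH : ContDiff ℝ 1 H) (hHq : IsPosHomogeneous q H)
    {u : Fin d → sobolevZero Ω p} (hu : ¬ values u =ᵐ[volume.restrict Ω] 0) :
    0 < potential H u := by
  have hq0 : 0 < q := by linarith
  refine lt_of_le_of_ne (integral_nonneg fun x => hHq.nonneg hq0 _) fun h => hu ?_
  have h0 := (integral_eq_zero_iff_of_nonneg (fun x => hHq.nonneg hq0 (values u x))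
    (integrable_comp_values hΩb hp hpn hq1 hq hH hHq.1 u)).1 h.symm
  filter_upwards [h0] with x hx
  by_contra hne
  exact (hHq.2 _ hne).ne' hx

theorem exists_smul_potential_eq_one (hq : 0 < q) (hHq : IsHomogeneous q H)
    {u : Fin d → sobolevZero Ω p} (hu : 0 < potential H u) :
    potential H ((potential H u) ^ (-(1 / q)) • u) = 1 := by
  rw [potential_smul hHq (by positivity), ← Real.rpow_mul hu.le, neg_mul,
    one_div_mul_cancel hq.ne', Real.rpow_neg_one, inv_mul_cancel₀ hu.ne']

theorem values_single_eq_zero_iff (j : Fin d) (z : sobolevZero Ω p) :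
    values (Pi.single j z : Fin d → sobolevZero Ω p) =ᵐ[volume.restrict Ω] 0 ↔
      ((z : LpPair Ω p).1 : Eucl n → ℝ) =ᵐ[volume.restrict Ω] 0 := by
  constructor <;> intro h
  · filter_upwards [h, values_single j z] with x a b
    rw [a] at b
    simpa using b.symm
  · filter_upwards [h, values_single j z] with x a b
    rw [b, a]
    simp

theorem exists_sobolevZero_ne_zero (hΩ : IsOpen Ω) (hne : Ω.Nonempty) :
    ∃ z : sobolevZero Ω p, ¬ ((z : LpPair Ω p).1 : Eucl n → ℝ) =ᵐ[volume.restrict Ω] 0 := by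
  obtain ⟨x₀, hx₀⟩ := hne
  obtain ⟨r, hr, hball⟩ := Metric.isOpen_iff.1 hΩ x₀ hx₀
  let f : ContDiffBump x₀ := ⟨r / 4, r / 2, by positivity, by linarith⟩
  have hf : IsTestFunction Ω f := by
    refine ⟨f.contDiff, f.hasCompactSupport, ?_⟩
    rw [f.tsupport_eq]
    exact (Metric.closedBall_subset_ball (by change r / 2 < r; linarith)).trans hball
  refine ⟨⟨hf.toPair p, testPairs_le_sobolevZero (hf.toPair_mem p)⟩, fun h => ?_⟩
  have h1 : (f : Eucl n → ℝ) =ᵐ[volume.restrict Ω] 0 :=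
    ((hf.memLp _ _).coeFn_toLp).symm.trans h
  have h2 := (Continuous.ae_eq_iff_eq volume f.continuous continuous_const).1
    (show (f : Eucl n → ℝ) =ᵐ[volume] fun _ => 0 by
      rw [EventuallyEq, ae_restrict_iff' hΩ.measurableSet] at h1
      filter_upwards [h1] with x hx
      by_cases hxΩ : x ∈ Ω
      · exact hx hxΩ
      · exact image_eq_zero_of_notMem_tsupport fun hx' => hxΩ (hf.2.2 hx'))
  have h3 := congrFun h2 x₀
  rw [f.one_of_mem_closedBall (Metric.mem_closedBall_self (by positivity))] at h3
  exact one_ne_zero h3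

/-- The energy is bounded below on the constraint set. -/
theorem exists_pos_le_energy_of_potential_eq_one (hΩ : IsOpen Ω) (hΩb : Bornology.IsBounded Ω)
    (hA : IsCoefficient Ω A) (hp : 1 < p) (hpn : p < n)
    (hq1 : 1 < q) (hq : q ≤ critExp n p) (hH : ContDiff ℝ 1 H) (hHq : IsHomogeneous q H) :
    ∃ m : ℝ, 0 < m ∧ ∀ u : Fin d → sobolevZero Ω p, potential H u = 1 → m ≤ energy A u := by
  have hp0 : 0 < p := by linarith
  have hq0 : 0 < q := by linarith
  obtain ⟨c₁, hc₁, hE⟩ := exists_norm_rpow_le_energy hΩ hΩb hp hpn hA d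
  obtain ⟨C, hC, hb⟩ := (hHq.isPowerIntegrand (volume.restrict Ω) hH hq1).abs_le hq1
  obtain ⟨S, hS, hSb⟩ := exists_lpNorm_values_le (Ω := Ω) hΩb hp hpn hq1.le hq d
  have hK : ∀ u : Fin d → sobolevZero Ω p, potential H u ≤ C * S ^ q * ‖u‖ ^ q := by
    intro u
    have hm := memLp_values hΩb hp hpn hq1.le hq u
    calc potential H u ≤ ∫ x in Ω, C * ‖values u x‖ ^ q := by
          refine integral_mono_ae (integrable_comp_values hΩb hp hpn hq1 hq hH hHq u)
            ((integrable_norm_rpow_of_memLp hq0 hm).const_mul C) ?_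
          filter_upwards [hb] with x hx using (le_abs_self _).trans (hx _)
      _ = C * lpNorm (values u) (ENNReal.ofReal q) (volume.restrict Ω) ^ q := by
          rw [integral_const_mul, lpNorm_rpow_eq_integral hq0 hm]
      _ ≤ C * (S * ‖u‖) ^ q := by
          gcongr
          · exact lpNorm_nonneg
          · exact hSb u
      _ = _ := by rw [Real.mul_rpow hS (norm_nonneg _), mul_assoc]
  set D := C * S ^ q + 1 with hD
  have hD0 : 0 < D := by positivity
  refine ⟨D ^ (-(p / q)) / c₁, by positivity, fun u hu => ?_⟩
  rw [div_le_iff₀' hc₁]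
  refine le_trans ?_ (hE u)
  -- The constraint and the embedding keep `‖u‖` away from zero; raising to the power `p / q`
  -- compares with the energy.
  have h1 : 1 ≤ D * ‖u‖ ^ q := by
    rw [← hu]
    refine (hK u).trans ?_
    gcongr
    linarith
  rw [Real.rpow_neg hD0.le, inv_le_iff_one_le_mul₀' (by positivity)]
  have h2 := Real.one_le_rpow h1 (by positivity : 0 ≤ p / q)
  rwa [Real.mul_rpow hD0.le (by positivity), ← Real.rpow_mul (norm_nonneg _),
    mul_div_cancel₀ _ hq0.ne'] at h2

end Potential

/-! ### The first eigenvalue as the attained minimum of the Rayleigh quotient. -/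

section Eigenvalue

variable {n : ℕ} {Ω : Set (Eucl n)} {p : ℝ}
  {A : Eucl n → Matrix (Fin n) (Fin n) ℝ}

theorem norm_eucl_one (s : Eucl 1) : ‖s‖ = |s 0| := by
  rw [EuclideanSpace.norm_eq, Fin.sum_univ_one, Real.sqrt_sq (norm_nonneg _), Real.norm_eq_abs]

theorem isPosHomogeneous_norm_rpow {d : ℕ} {q : ℝ} :
    IsPosHomogeneous q (fun s : Eucl d => ‖s‖ ^ q) :=
  ⟨isHomogeneous_norm_rpow, fun _ hs => Real.rpow_pos_of_pos (norm_pos_iff.2 hs) q⟩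

theorem integral_flux_self (hΩ : IsOpen Ω) (hΩb : Bornology.IsBounded Ω) (hA : IsCoefficient Ω A)
    (hp : 1 < p) (v : Eucl n → Eucl n) :
    ∫ x in Ω, flux p (A x) (v x) (v x) = ∫ x in Ω, matForm (A x) (v x) (v x) ^ (p / 2) := by
  obtain ⟨τ, B, hτ, hB, hM⟩ := hA.exists_isEllipticMatrix hΩb
  refine integral_congr_ae ?_
  filter_upwards [ae_restrict_mem hΩ.measurableSet] with x hx
  exact (hM x (subset_closure hx)).flux_self hτ (by linarith) _

theorem opPairing_congr {v v' ψ ψ' : Eucl n → Eucl n} (hv : v =ᵐ[volume.restrict Ω] v')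
    (hψ : ψ =ᵐ[volume.restrict Ω] ψ') : opPairing Ω p A v ψ = opPairing Ω p A v' ψ' := by
  refine integral_congr_ae ?_
  filter_upwards [hv, hψ] with x a b
  rw [a, b]

variable [Fact (1 ≤ ENNReal.ofReal p)]

theorem potential_norm_rpow_one (u : Fin 1 → sobolevZero Ω p) :
    potential (fun s : Eucl 1 => ‖s‖ ^ p) u = ∫ x in Ω, |(u 0 : LpPair Ω p).1 x| ^ p := by
  simp only [potential, norm_eucl_one]
  rfl

theorem energy_one (u : Fin 1 → sobolevZero Ω p) : energy A u =
    ∫ x in Ω, matForm (A x) ((u 0 : LpPair Ω p).2 x) ((u 0 : LpPair Ω p).2 x) ^ (p / 2) :=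
  Fin.sum_univ_one _

set_option maxHeartbeats 1000000 in
/-- The first eigenvalue is the attained minimum of the Rayleigh quotient. -/
theorem exists_first_eigenfunction (hΩ : IsOpen Ω) (hΩb : Bornology.IsBounded Ω)
    (hne : Ω.Nonempty) (hA : IsCoefficient Ω A) (hp : 1 < p) (hpn : p < n) :
    0 < firstEigenvalue Ω p A ∧
    (∀ w : sobolevZero Ω p, firstEigenvalue Ω p A * ∫ x in Ω, |(w : LpPair Ω p).1 x| ^ p ≤
      ∫ x in Ω, matForm (A x) ((w : LpPair Ω p).2 x) ((w : LpPair Ω p).2 x) ^ (p / 2)) ∧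
    ∃ e : sobolevZero Ω p, ∫ x in Ω, |(e : LpPair Ω p).1 x| ^ p = 1 ∧
      ∫ x in Ω, matForm (A x) ((e : LpPair Ω p).2 x) ((e : LpPair Ω p).2 x) ^ (p / 2) =
        firstEigenvalue Ω p A := by
  have : IsFiniteMeasure (volume.restrict Ω) := ⟨by simpa using hΩb.measure_lt_top⟩
  have hp0 : 0 < p := by linarith
  have hpc := (lt_critExp hp hpn).le
  set H : Eucl 1 → ℝ := fun s => ‖s‖ ^ p with hH
  have hHd : ContDiff ℝ 1 H := contDiff_norm_rpow hp
  have hHh : IsPosHomogeneous p H := isPosHomogeneous_norm_rpow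
  have hF : IsHomogeneous p (fun _ : Eucl 1 => (0 : ℝ)) := fun ρ _ s => (mul_zero _).symm
  have hpot0 : ∀ u : Fin 1 → sobolevZero Ω p, potential (fun _ : Eucl 1 => (0 : ℝ)) u = 0 :=
    fun u => by simp [potential]
  have hadm : ∃ u : Fin 1 → sobolevZero Ω p, potential H u = 1 := by
    obtain ⟨z, hz⟩ := exists_sobolevZero_ne_zero (p := p) hΩ hne
    have hpos := potential_pos hΩb hp hpn hp hpc hHd hHh
      (mt (values_single_eq_zero_iff (0 : Fin 1) z).1 hz)
    exact ⟨_, exists_smul_potential_eq_one hp0 hHh.1 hpos⟩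
  obtain ⟨m, hm, hmE⟩ := exists_pos_le_energy_of_potential_eq_one hΩ hΩb hA hp hpn hp hpc hHd hHh.1
  obtain ⟨c₁, hc₁, hE⟩ := exists_norm_rpow_le_energy hΩ hΩb hp hpn hA 1
  have hE0 : ∀ u : Fin 1 → sobolevZero Ω p, 0 ≤ energy A u := fun u =>
    nonneg_of_mul_nonneg_right ((by positivity : (0 : ℝ) ≤ ‖u‖ ^ p).trans (hE u)) hc₁
  obtain ⟨u, w, S, hS, hw1, -, hw3, hEL⟩ := exists_minimizing_seq_tendsto_solution hΩ hΩb hA hp hpn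
    contDiff_const hF hp hpc hHd hHh.1 one_pos (by simp [hpot0]) hadm
  simp only [hpot0, sub_zero] at hS
  -- The constraint has exponent `p`, so it passes to the limit.
  have hu1 : potential H u = 1 := by
    have h := hw3 H hHd hHh.1
    simp only [hw1] at h
    exact tendsto_nhds_unique h tendsto_const_nhds
  have hfd : ∀ s v : Eucl 1, fderiv ℝ H s v = p * |s 0| ^ (p - 2) * s 0 * v 0 := by
    intro s v
    rw [hH, fderiv_norm_rpow s hp, norm_eucl_one]
    simp [PiLp.inner_apply]
    ring
  have hweak : ∀ z : sobolevZero Ω p,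
      ∫ x in Ω, flux p (A x) ((u 0 : LpPair Ω p).2 x) ((z : LpPair Ω p).2 x) =
        ∫ x in Ω, S * |(u 0 : LpPair Ω p).1 x| ^ (p - 2) * (u 0 : LpPair Ω p).1 x *
          (z : LpPair Ω p).1 x := by
    intro z
    have h := hEL 0 z
    have h0 : ∫ x in Ω, fderiv ℝ (fun _ : Eucl 1 => (0 : ℝ)) (values u x)
        (values (Pi.single 0 z : Fin 1 → sobolevZero Ω p) x) = 0 := by simp
    have h1 : ∫ x in Ω, fderiv ℝ H (values u x)
        (values (Pi.single 0 z : Fin 1 → sobolevZero Ω p) x) =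
        p * ∫ x in Ω, |(u 0 : LpPair Ω p).1 x| ^ (p - 2) * (u 0 : LpPair Ω p).1 x *
          (z : LpPair Ω p).1 x := by
      rw [← integral_const_mul]
      refine integral_congr_ae ?_
      filter_upwards [values_single (0 : Fin 1) z] with x hx
      rw [hfd, hx]
      simp [values]
      ring
    rw [h0, h1, div_self hp0.ne', one_mul, zero_add, mul_left_comm] at h
    rw [mul_left_cancel₀ hp0.ne' h, ← integral_const_mul]
    refine integral_congr_ae (ae_of_all _ fun x => ?_)
    ring
  have hmass : ∀ (c : ℝ) (f : Eucl n → ℝ), ∫ x in Ω, c * |f x| ^ (p - 2) * f x * f x =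
      c * ∫ x in Ω, |f x| ^ p := by
    intro c f
    rw [← integral_const_mul]
    refine integral_congr_ae (ae_of_all _ fun x => ?_)
    change c * |f x| ^ (p - 2) * f x * f x = c * |f x| ^ p
    rw [mul_assoc, ← abs_mul_abs_self (f x), mul_assoc, ← mul_assoc (|f x| ^ (p - 2)),
      ← Real.rpow_add_one' (abs_nonneg _) (by linarith),
      ← Real.rpow_add_one' (abs_nonneg _) (by linarith)]
    ring_nf
  -- Testing the limiting equation with `u` itself identifies `u` as a minimizer.
  have hES : energy A u = S := by
    rw [energy_one, ← integral_flux_self hΩ hΩb hA hp, hweak, hmass, ← potential_norm_rpow_one,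
      hu1, mul_one]
  have hS0 : 0 < S := hES ▸ hm.trans_le (hmE u hu1)
  have hray : ∀ w : sobolevZero Ω p, S * ∫ x in Ω, |(w : LpPair Ω p).1 x| ^ p ≤
      ∫ x in Ω, matForm (A x) ((w : LpPair Ω p).2 x) ((w : LpPair Ω p).2 x) ^ (p / 2) := by
    intro w
    set W : Fin 1 → sobolevZero Ω p := fun _ => w
    have h1 : potential H W = ∫ x in Ω, |(w : LpPair Ω p).1 x| ^ p := potential_norm_rpow_one W
    have h2 : energy A W = ∫ x in Ω, matForm (A x) ((w : LpPair Ω p).2 x)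
        ((w : LpPair Ω p).2 x) ^ (p / 2) := energy_one W
    rw [← h1, ← h2]
    have h3 : 0 ≤ potential H W := integral_nonneg fun x => hHh.nonneg hp0 _
    rcases h3.eq_or_lt with h0 | hpos
    · rw [← h0, mul_zero]
      exact hE0 W
    · have h4 : S ≤ energy A ((potential H W) ^ (-(1 / p)) • W) := by
        rw [hS]
        exact csInf_le ⟨0, by rintro _ ⟨v, -, rfl⟩; exact hE0 v⟩
          ⟨_, exists_smul_potential_eq_one hp0 hHh.1 hpos, rfl⟩
      rw [energy_smul hΩ hΩb hA (by positivity), ← Real.rpow_mul hpos.le, neg_mul,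
        one_div_mul_cancel hp0.ne', Real.rpow_neg_one, inv_mul_eq_div, le_div_iff₀ hpos] at h4
      exact h4
  have hfirst : firstEigenvalue Ω p A = S := by
    have hmem : IsEigenvalue Ω p A S := by
      refine ⟨(u 0 : LpPair Ω p).1, (u 0 : LpPair Ω p).2, isW0_of_mem_sobolevZero (u 0).2, ?_, ?_⟩
      · intro h
        have : potential H u = 0 := by
          rw [potential_norm_rpow_one, integral_congr_ae (g := fun _ => (0 : ℝ)), integral_zero]
          filter_upwards [h] with x hx
          rw [hx, Pi.zero_apply, abs_zero, Real.zero_rpow hp0.ne']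
        rw [this] at hu1
        exact zero_ne_one hu1
      · intro φ ψ hφ
        obtain ⟨z, hz, hz1, hz2⟩ := hφ.exists_mem_sobolevZero
        rw [opPairing_congr EventuallyEq.rfl hz2.symm]
        refine (hweak ⟨z, hz⟩).trans (integral_congr_ae ?_)
        filter_upwards [hz1] with x hx
        rw [← hx]
    refine le_antisymm (csInf_le ⟨S, ?_⟩ hmem) (le_csInf ⟨S, hmem⟩ ?_)
    -- Boundedness below and minimality both say that `S ≤ lam` for every eigenvalue `lam`: test its
    -- equation with the eigenfunction and apply `hray`.
    all_goals
      rintro lam ⟨f, v, hW, hf0, hf⟩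
      obtain ⟨z, hz, hz1, hz2⟩ := hW.exists_mem_sobolevZero
      have h1 : ∫ x in Ω, matForm (A x) (v x) (v x) ^ (p / 2) = lam * ∫ x in Ω, |f x| ^ p := by
        rw [← hmass, ← hf f v hW, ← integral_flux_self hΩ hΩb hA hp]
        rfl
      have h2 := hray ⟨z, hz⟩
      have h3 : ∫ x in Ω, |z.1 x| ^ p = ∫ x in Ω, |f x| ^ p :=
        integral_congr_ae (by filter_upwards [hz1] with x hx; rw [hx])
      have h4 : ∫ x in Ω, matForm (A x) (z.2 x) (z.2 x) ^ (p / 2) =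
          ∫ x in Ω, matForm (A x) (v x) (v x) ^ (p / 2) :=
        integral_congr_ae (by filter_upwards [hz2] with x hx; rw [hx])
      have h5 : 0 < ∫ x in Ω, |z.1 x| ^ p := by
        have h := potential_pos hΩb hp hpn hp hpc hHd hHh
          (mt (values_single_eq_zero_iff (0 : Fin 1) ⟨z, hz⟩).1
            fun h => hf0 (hz1.symm.trans h))
        rwa [potential_norm_rpow_one] at h
      rw [h3] at h5
      change S * ∫ x in Ω, |z.1 x| ^ p ≤ ∫ x in Ω, matForm (A x) (z.2 x) (z.2 x) ^ (p / 2) at h2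
      rw [h3, h4, h1] at h2
      exact le_of_mul_le_mul_right h2 h5
  rw [hfirst]
  exact ⟨hS0, hray, u 0, by rw [← potential_norm_rpow_one, hu1], by rw [← energy_one, hES]⟩

end Eigenvalue

/-! ### Existence and nontriviality for the system, and the threshold. -/

section System

variable {n d : ℕ} {Ω : Set (Eucl n)} {p : ℝ} [Fact (1 ≤ ENNReal.ofReal p)]
  {A : Eucl n → Matrix (Fin n) (Fin n) ℝ} {F G : Eucl d → ℝ}

theorem integrable_abs_rpow_coe (hp : 0 < p) (w : sobolevZero Ω p) :
    Integrable (fun x => |(w : LpPair Ω p).1 x| ^ p) (volume.restrict Ω) :=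
  integrable_norm_rpow_of_memLp hp (Lp.memLp (w : LpPair Ω p).1)

theorem sphereMin_mul_le_potential_and_le (hΩb : Bornology.IsBounded Ω) (hp : 1 < p) (hpn : p < n)
    (hF : ContDiff ℝ 1 F) (hFp : IsHomogeneous p F) (u : Fin d → sobolevZero Ω p) :
    sphereMin p F * ∑ j, ∫ x in Ω, |(u j : LpPair Ω p).1 x| ^ p ≤ potential F u ∧
      potential F u ≤ sphereMax p F * ∑ j, ∫ x in Ω, |(u j : LpPair Ω p).1 x| ^ p := by
  have hp0 : 0 < p := by linarith
  have hFi := integrable_comp_values hΩb hp hpn hp (lt_critExp hp hpn).le hF hFp u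
  have hi : Integrable (fun x => ∑ j, |(u j : LpPair Ω p).1 x| ^ p) (volume.restrict Ω) :=
    integrable_finsetSum _ fun j _ => integrable_abs_rpow_coe hp0 (u j)
  have hs : ∑ j, ∫ x in Ω, |(u j : LpPair Ω p).1 x| ^ p =
      ∫ x in Ω, ∑ j, |(u j : LpPair Ω p).1 x| ^ p :=
    (integral_finsetSum _ fun j _ => integrable_abs_rpow_coe hp0 (u j)).symm
  rw [hs, ← integral_const_mul, ← integral_const_mul]
  exact ⟨integral_mono (hi.const_mul _) hFi fun x =>
      (hFp.sphereMin_mul_le_and_le_sphereMax_mul hF.continuous hp0 (values u x)).1,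
    integral_mono hFi (hi.const_mul _) fun x =>
      (hFp.sphereMin_mul_le_and_le_sphereMax_mul hF.continuous hp0 (values u x)).2⟩

/-- If `F` stays below the first eigenvalue, the quadratic part of the functional is coercive. -/
theorem mul_energy_le_energy_sub_potential (hΩ : IsOpen Ω) (hΩb : Bornology.IsBounded Ω)
    (hne : Ω.Nonempty) (hA : IsCoefficient Ω A) (hp : 1 < p) (hpn : p < n)
    (hF : ContDiff ℝ 1 F) (hFp : IsHomogeneous p F) (hM : 0 ≤ sphereMax p F)
    (u : Fin d → sobolevZero Ω p) :
    (1 - sphereMax p F / firstEigenvalue Ω p A) * energy A u ≤ energy A u - potential F u := by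
  obtain ⟨hΛ, hray, -⟩ := exists_first_eigenfunction hΩ hΩb hne hA hp hpn
  have h1 := (sphereMin_mul_le_potential_and_le hΩb hp hpn hF hFp u).2
  have h2 : firstEigenvalue Ω p A * ∑ j, ∫ x in Ω, |(u j : LpPair Ω p).1 x| ^ p ≤ energy A u := by
    rw [Finset.mul_sum]
    exact Finset.sum_le_sum fun j _ => hray (u j)
  have h3 : ∑ j, ∫ x in Ω, |(u j : LpPair Ω p).1 x| ^ p ≤ energy A u / firstEigenvalue Ω p A := by
    rwa [le_div_iff₀' hΛ]
  have h4 := h1.trans (mul_le_mul_of_nonneg_left h3 hM)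
  rw [sub_mul, one_mul, div_mul_eq_mul_div, mul_div_assoc]
  linarith

theorem energy_single (hΩ : IsOpen Ω) (hΩb : Bornology.IsBounded Ω)
    (hA : IsCoefficient Ω A) (hp : 1 < p) (j : Fin d) (z : sobolevZero Ω p) :
    energy A (Pi.single j z : Fin d → sobolevZero Ω p) =
      ∫ x in Ω, matForm (A x) ((z : LpPair Ω p).2 x) ((z : LpPair Ω p).2 x) ^ (p / 2) := by
  rw [energy, Finset.sum_eq_single j, Pi.single_eq_same]
  · intro i _ hij
    rw [Pi.single_eq_of_ne hij, integral_congr_ae (g := fun _ => (0 : ℝ)), integral_zero]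
    have h0 : (((0 : sobolevZero Ω p) : LpPair Ω p).2 : Eucl n → Eucl n)
        =ᵐ[volume.restrict Ω] 0 := Lp.coeFn_zero _ _ _
    filter_upwards [h0, (hA.isPowerIntegrand hΩ hΩb hp).zero] with x a b
    rw [a]
    exact b
  · simp

theorem sum_integral_abs_rpow_single (hp : 0 < p) (j : Fin d) (z : sobolevZero Ω p) :
    ∑ i, ∫ x in Ω, |((Pi.single j z : Fin d → sobolevZero Ω p) i : LpPair Ω p).1 x| ^ p =
      ∫ x in Ω, |(z : LpPair Ω p).1 x| ^ p := by
  rw [Finset.sum_eq_single j, Pi.single_eq_same]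
  · intro i _ hij
    rw [Pi.single_eq_of_ne hij, integral_congr_ae (g := fun _ => (0 : ℝ)), integral_zero]
    have h0 : (((0 : sobolevZero Ω p) : LpPair Ω p).1 : Eucl n → ℝ)
        =ᵐ[volume.restrict Ω] 0 := Lp.coeFn_zero _ _ _
    filter_upwards [h0] with x a
    rw [a, Pi.zero_apply, abs_zero, Real.zero_rpow hp.ne']
  · simp

/-- A solution of the Euler–Lagrange system, tested with vectors of the form `z e_j`, is a weak
solution. -/
theorem isWeakSolution_values (hΩb : Bornology.IsBounded Ω) (hp : 1 < p) (hpn : p < n)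
    (hF : ContDiff ℝ 1 F) (hFp : IsHomogeneous p F) (hG : ContDiff ℝ 1 G)
    (hGh : IsHomogeneous (critExp n p) G) {u : Fin d → sobolevZero Ω p}
    (hu : ∀ j, ∀ z : sobolevZero Ω p,
      ∫ x in Ω, flux p (A x) ((u j : LpPair Ω p).2 x) ((z : LpPair Ω p).2 x) =
        1 / p * (∫ x in Ω, fderiv ℝ F (values u x)
          (values (Pi.single j z : Fin d → sobolevZero Ω p) x)) +
        1 / critExp n p * ∫ x in Ω, fderiv ℝ G (values u x)
          (values (Pi.single j z : Fin d → sobolevZero Ω p) x)) :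
    IsWeakSolution Ω p A F G (values u) := by
  have : IsFiniteMeasure (volume.restrict Ω) := ⟨by simpa using hΩb.measure_lt_top⟩
  have hpc := lt_critExp hp hpn
  refine ⟨fun j => (u j : LpPair Ω p).2, fun j => isW0_of_mem_sobolevZero (u j).2,
    fun j φ ψ hφ => ?_⟩
  obtain ⟨z, hz, hz1, hz2⟩ := hφ.exists_mem_sobolevZero
  set Z : Fin d → sobolevZero Ω p := Pi.single j ⟨z, hz⟩ with hZ
  have hIF := ((hFp.isPowerIntegrand (volume.restrict Ω) hF hp).integrable_deriv hp
    (memLp_values hΩb hp hpn hp.le hpc.le u) (memLp_values hΩb hp hpn hp.le hpc.le Z)).const_mul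
      (1 / p)
  have hIG := ((hGh.isPowerIntegrand (volume.restrict Ω) hG (hp.trans hpc)).integrable_deriv
    (hp.trans hpc) (memLp_values hΩb hp hpn (hp.trans hpc).le le_rfl u)
    (memLp_values hΩb hp hpn (hp.trans hpc).le le_rfl Z)).const_mul (1 / critExp n p)
  have heq : (fun x => 1 / p * fderiv ℝ F (values u x) (values Z x) +
      1 / critExp n p * fderiv ℝ G (values u x) (values Z x)) =ᵐ[volume.restrict Ω]
      fun x => nonlinearity n p F G (values u x) j * φ x := by
    filter_upwards [values_single j (⟨z, hz⟩ : sobolevZero Ω p), hz1] with x a b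
    rw [hZ, a, nonlinearity, gradient_apply_eq_fderiv, gradient_apply_eq_fderiv, map_smul,
      map_smul, smul_eq_mul, smul_eq_mul, ← b]
    ring
  refine ⟨(hIF.add hIG).congr heq, ?_⟩
  rw [opPairing_congr EventuallyEq.rfl hz2.symm, ← integral_congr_ae heq, integral_add hIF hIG,
    integral_const_mul, integral_const_mul]
  exact hu j ⟨z, hz⟩

/-- Rescaling removes the Lagrange multiplier. -/
theorem isWeakSolution_values_smul (hΩ : IsOpen Ω) (hΩb : Bornology.IsBounded Ω)
    (hA : IsCoefficient Ω A) (hp : 1 < p) (hpn : p < n)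
    (hF : ContDiff ℝ 1 F) (hFp : IsHomogeneous p F) (hG : ContDiff ℝ 1 G)
    (hGh : IsHomogeneous (critExp n p) G) {u : Fin d → sobolevZero Ω p} {S : ℝ} (hS : 0 < S)
    (hu : ∀ j, ∀ z : sobolevZero Ω p,
      p * ∫ x in Ω, flux p (A x) ((u j : LpPair Ω p).2 x) ((z : LpPair Ω p).2 x) =
        (∫ x in Ω, fderiv ℝ F (values u x)
          (values (Pi.single j z : Fin d → sobolevZero Ω p) x)) +
        p / critExp n p * S * ∫ x in Ω, fderiv ℝ G (values u x)
          (values (Pi.single j z : Fin d → sobolevZero Ω p) x)) :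
    IsWeakSolution Ω p A F G (values (S ^ (1 / (critExp n p - p)) • u)) := by
  have hp0 : 0 < p := by linarith
  have hpc := lt_critExp hp hpn
  obtain ⟨τ, B, hτ, hB, hM⟩ := hA.exists_isEllipticMatrix hΩb
  set q := critExp n p with hq
  have hq0 : 0 < q := hp0.trans hpc
  set ρ := S ^ (1 / (q - p)) with hρdef
  have hρ : 0 < ρ := by positivity
  -- The operator and the `F` term scale by `ρ ^ (p - 1)`, the `G` term by `ρ ^ (q - 1)`; this
  -- choice of `ρ` absorbs the multiplier.
  have hρS : ρ ^ (q - 1) = ρ ^ (p - 1) * S := by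
    have h1 : ρ ^ (q - p) = S := by
      rw [hρdef, ← Real.rpow_mul hS.le, one_div_mul_cancel (by linarith), Real.rpow_one]
    rw [← h1, ← Real.rpow_add hρ]
    ring_nf
  refine isWeakSolution_values hΩb hp hpn hF hFp hG hGh fun j z => ?_
  have e1 : ∫ x in Ω, flux p (A x) (((ρ • u) j : LpPair Ω p).2 x) ((z : LpPair Ω p).2 x) =
      ρ ^ (p - 1) * ∫ x in Ω, flux p (A x) ((u j : LpPair Ω p).2 x) ((z : LpPair Ω p).2 x) := by
    rw [← integral_const_mul]
    refine integral_congr_ae ?_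
    filter_upwards [Lp.coeFn_smul ρ (u j : LpPair Ω p).2, ae_restrict_mem hΩ.measurableSet]
      with x a hx
    have : ((ρ • u) j : LpPair Ω p).2 = ρ • (u j : LpPair Ω p).2 := rfl
    rw [this, a, Pi.smul_apply]
    exact (hM x (subset_closure hx)).flux_smul_left hτ hρ _ _
  have e2 : ∀ {r : ℝ} {H : Eucl d → ℝ}, ContDiff ℝ 1 H → IsHomogeneous r H →
      ∫ x in Ω, fderiv ℝ H (values (ρ • u) x)
        (values (Pi.single j z : Fin d → sobolevZero Ω p) x) =
      ρ ^ (r - 1) * ∫ x in Ω, fderiv ℝ H (values u x)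
        (values (Pi.single j z : Fin d → sobolevZero Ω p) x) := by
    intro r H hH hHr
    rw [← integral_const_mul]
    refine integral_congr_ae ?_
    filter_upwards [values_smul u ρ] with x a
    rw [a, hHr.fderiv_smul hH hρ]
    rfl
  rw [e1, e2 hF hFp, e2 hG hGh, hρS, ← hq]
  have h := hu j z
  field_simp at h ⊢
  linarith

/-- The constrained minimization problem yields a nontrivial solution if its infimum is below the
bound `m` for the energy on the constraint set. -/
theorem exists_nontrivial_weakSolution (hΩ : IsOpen Ω) (hΩb : Bornology.IsBounded Ω)
    (hne : Ω.Nonempty) (hA : IsCoefficient Ω A) (hp : 1 < p) (hpn : p < n)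
    (hF : ContDiff ℝ 1 F) (hFp : IsHomogeneous p F) (hG : ContDiff ℝ 1 G)
    (hGh : IsHomogeneous (critExp n p) G) {m : ℝ} (hm : 0 < m)
    (hmE : ∀ u : Fin d → sobolevZero Ω p, potential G u = 1 → m ≤ energy A u)
    (hM0 : 0 ≤ sphereMax p F) (hM : sphereMax p F < firstEigenvalue Ω p A)
    (hlt : ∃ u : Fin d → sobolevZero Ω p, potential G u = 1 ∧ energy A u - potential F u < m) :
    ∃ u : Eucl n → Eucl d, IsWeakSolution Ω p A F G u ∧ ¬ (u =ᵐ[volume.restrict Ω] 0) := by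
  have hp0 : 0 < p := by linarith
  have hpc := lt_critExp hp hpn
  obtain ⟨hΛ, -⟩ := exists_first_eigenfunction hΩ hΩb hne hA hp hpn
  have hc : 0 < 1 - sphereMax p F / firstEigenvalue Ω p A := by
    rw [sub_pos, div_lt_one hΛ]
    exact hM
  have hcoer := mul_energy_le_energy_sub_potential hΩ hΩb hne hA hp hpn hF hFp hM0
  obtain ⟨u, w, S, hS, hw1, hw2, hw3, hEL⟩ := exists_minimizing_seq_tendsto_solution hΩ hΩb hA hp
    hpn hF hFp (hp.trans hpc) le_rfl hG hGh hc hcoer (hlt.imp fun _ h => h.1)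
  have hlow : ∀ v : Fin d → sobolevZero Ω p, potential G v = 1 →
      (1 - sphereMax p F / firstEigenvalue Ω p A) * m ≤ energy A v - potential F v := fun v hv =>
    (mul_le_mul_of_nonneg_left (hmE v hv) hc.le).trans (hcoer v)
  have hS0 : 0 < S := (mul_pos hc hm).trans_le (ge_of_tendsto' hw2 fun k => hlow _ (hw1 k))
  refine ⟨_, isWeakSolution_values_smul hΩ hΩb hA hp hpn hF hFp hG hGh hS0 hEL, fun h0 => ?_⟩
  have hρ : 0 < S ^ (1 / (critExp n p - p)) := by positivity
  have hu0 : values u =ᵐ[volume.restrict Ω] 0 := by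
    filter_upwards [h0, values_smul u (S ^ (1 / (critExp n p - p)))] with x a b
    rw [b] at a
    exact (smul_eq_zero.1 a).resolve_left hρ.ne'
  have hpot : potential F u = 0 := by
    rw [potential, integral_congr_ae (g := fun _ => (0 : ℝ)), integral_zero]
    filter_upwards [hu0] with x hx
    rw [hx]
    exact hFp.map_zero hp0
  -- If the limit vanished, the lower-order term would disappear and the energies alone would tend
  -- to `S`, giving `m ≤ S` against `hlt`.
  have hE : Tendsto (fun k => energy A (w k)) atTop (𝓝 S) := by
    have := hw2.add (hw3 F hF hFp)
    simpa [hpot] using this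
  have h1 : m ≤ S := ge_of_tendsto' hE fun k => hmE _ (hw1 k)
  obtain ⟨v, hv, hvlt⟩ := hlt
  have h2 : S ≤ energy A v - potential F v := by
    rw [hS]
    exact csInf_le ⟨_, by rintro _ ⟨v', hv', rfl⟩; exact hlow v' hv'⟩ ⟨v, hv, rfl⟩
  linarith

/-- If `F` lies between `lam` and the first eigenvalue on the sphere, with `lam` close to the first
eigenvalue, then the system has a nontrivial solution. -/
theorem exists_threshold (hd : 1 ≤ d) (hΩ : IsOpen Ω) (hΩb : Bornology.IsBounded Ω)
    (hne : Ω.Nonempty) (hA : IsCoefficient Ω A) (hp : 1 < p) (hpn : p < n)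
    (hG : ContDiff ℝ 1 G) (hGh : IsPosHomogeneous (critExp n p) G) :
    ∃ lam : ℝ, 0 < lam ∧ lam < firstEigenvalue Ω p A ∧
      ∀ F : Eucl d → ℝ, ContDiff ℝ 1 F → IsHomogeneous p F → 0 < sphereMax p F →
        sphereMax p F < firstEigenvalue Ω p A → lam < sphereMin p F →
        ∃ u : Eucl n → Eucl d, IsWeakSolution Ω p A F G u ∧ ¬ (u =ᵐ[volume.restrict Ω] 0) := by
  have hp0 : 0 < p := by linarith
  have hpc := lt_critExp hp hpn
  have hq1 := hp.trans hpc
  obtain ⟨hΛ, -, e, he1, heE⟩ := exists_first_eigenfunction hΩ hΩb hne hA hp hpn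
  set Λ := firstEigenvalue Ω p A with hΛdef
  obtain ⟨m, hm, hmE⟩ :=
    exists_pos_le_energy_of_potential_eq_one hΩ hΩb hA hp hpn hq1 le_rfl hG hGh.1
  set E : Fin d → sobolevZero Ω p := Pi.single ⟨0, hd⟩ e with hE
  have he0 : ¬ values E =ᵐ[volume.restrict Ω] 0 := by
    rw [hE, values_single_eq_zero_iff]
    intro h
    rw [integral_congr_ae (g := fun _ => (0 : ℝ)), integral_zero] at he1
    · exact zero_ne_one he1
    · filter_upwards [h] with x hx
      rw [hx, Pi.zero_apply, abs_zero, Real.zero_rpow hp0.ne']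
  have hκ := potential_pos hΩb hp hpn hq1 le_rfl hG hGh he0
  set r := potential G E ^ (-(1 / critExp n p)) with hr
  have hr0 : 0 < r := by positivity
  have hrp : 0 < r ^ p := by positivity
  -- `Λ - m / r ^ p` is the value required by the test vector `r • E`; the maximum with `Λ / 2` only
  -- keeps the threshold positive.
  refine ⟨max (Λ / 2) (Λ - m / r ^ p), lt_max_of_lt_left (by positivity),
    max_lt (by linarith) (by linarith [div_pos hm hrp]), fun F hF hFp hM0 hM hμ => ?_⟩
  refine exists_nontrivial_weakSolution hΩ hΩb hne hA hp hpn hF hFp hG hGh.1 hm hmE hM0.le hM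
    ⟨r • E, exists_smul_potential_eq_one (by linarith) hGh.1 hκ, ?_⟩
  have h1 := (sphereMin_mul_le_potential_and_le hΩb hp hpn hF hFp E).1
  rw [hE, sum_integral_abs_rpow_single hp0, he1, mul_one, ← hE] at h1
  -- The functional at `r • E` is at most `r ^ p * (Λ - sphereMin p F)`, since `e` has unit mass and
  -- energy `Λ`.
  rw [energy_smul hΩ hΩb hA hr0, potential_smul hFp hr0, ← mul_sub, ← lt_div_iff₀' hrp, hE,
    energy_single hΩ hΩb hA hp, heE, ← hE]
  linarith [(le_max_right (Λ / 2) (Λ - m / r ^ p)).trans_lt hμ]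

end System

end AnisoPLap

theorem theorem1 (n d : ℕ) (hd : 1 ≤ d) (p : ℝ) (hp1 : 1 < p) (hpn : p < n)
    (Ω : Set (AnisoPLap.Eucl n)) (hΩ : IsOpen Ω) (hΩb : Bornology.IsBounded Ω)
    (A : AnisoPLap.Eucl n → Matrix (Fin n) (Fin n) ℝ) (hA : AnisoPLap.IsCoefficient Ω A)
    (G : AnisoPLap.Eucl d → ℝ) (hG : ContDiff ℝ 1 G)
    (hGhom : AnisoPLap.IsPosHomogeneous (AnisoPLap.critExp n p) G)
    (x₀ : AnisoPLap.Eucl n) (hx₀ : x₀ ∈ Ω)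
    (hmin : ∀ x ∈ closure Ω, (A x₀).det ≤ (A x).det)
    (C₀ : ℝ) (hC₀ : 0 < C₀) (γ : ℝ) (hγ : 0 < γ) (hγp : γ ≤ p)
    (hexp : ∀ x ∈ Ω, ∀ ξ : AnisoPLap.Eucl n,
      AnisoPLap.matForm (A x₀) ξ ξ ^ (p / 2) + C₀ * ‖x - x₀‖ ^ γ * ‖ξ‖ ^ p
        ≤ AnisoPLap.matForm (A x) ξ ξ ^ (p / 2)) :
    ∃ lam : ℝ, 0 < lam ∧ lam < AnisoPLap.firstEigenvalue Ω p A ∧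
      ∀ F : AnisoPLap.Eucl d → ℝ, ContDiff ℝ 1 F → AnisoPLap.IsHomogeneous p F →
        0 < AnisoPLap.sphereMax p F →
        AnisoPLap.sphereMax p F < AnisoPLap.firstEigenvalue Ω p A →
        lam < AnisoPLap.sphereMin p F →
        ∃ u : AnisoPLap.Eucl n → AnisoPLap.Eucl d,
          AnisoPLap.IsWeakSolution Ω p A F G u ∧ ¬ (u =ᵐ[volume.restrict Ω] 0) := by
  have : Fact (1 ≤ ENNReal.ofReal p) := ⟨by simpa using hp1.le⟩
  exact AnisoPLap.exists_threshold hd hΩ hΩb ⟨x₀, hx₀⟩ hA hp1 hpn hG hGhom
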